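/- **Setting.** Let $G$ be a real Lie group with semisimple Lie algebra $\mathfrak g=\mathfrak g_{-2}\oplus\dots\oplus\mathfrak g_2$, $|2|$-graded: $[\mathfrak g_i,\mathfrak g_j]\subset\mathfrak g_{i+j}$, $\mathfrak g_0$ contains no simple ideal of $\mathfrak g$, and $\mathfrak g_1$ generates $\mathfrak g^1=\mathfrak g_1\oplus\mathfrak g_2$. Let $G_0\subset G$ be the subgroup of those $g$ for which $\mathrm{Ad}(g)$ preserves the grading. Put $W=\wedge^2\mathfrak g_{-1}^*\otimes\mathfrak g_{-2}$, let $k\in W$ be the Lie bracket of $\mathfrak g$, let $S=GL(\mathfrak g_{-1})\times GL(\mathfrak g_{-2})$ with Lie algebra $\mathfrak s=\mathrm{End}(\mathfrak g_{-1})\oplus\mathrm{End}(\mathfrak g_{-2})$, and define $\partial^*:W\to\mathfrak s$ and $\partial^*:\mathfrak s\to\mathfrak g_0$ by $$(\partial^*\psi)(x)=\sum_l[z^l,\psi(x,z_l)]-\tfrac12\sum_l\psi([z^l,x]_-,z_l),\qquad \partial^*\varphi=\sum_l[z^l,\varphi(z_l)],$$ where $(z_l)$ is a basis of $\mathfrak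 g_-=\mathfrak g_{-2}\oplus\mathfrak g_{-1}$ consisting of homogeneous elements, $(z^l)$ is the basis of $\mathfrak g^1$ dual to it under the Killing form, $[\cdot,\cdot]_-$ is the $\mathfrak g_-$-part of the bracket, and $\psi(x,y)=0$ if $x$ or $y$ lies in $\mathfrak g_{-2}$. Let $H^1(\mathfrak g^1,\mathfrak g)_0=\ker(\partial^*|_{\mathfrak s})/\partial^*(W)$. Let $M$ be a smooth (Hausdorff) manifold and $H\subset TM$ a smooth distribution of rank $\dim\mathfrak g_{-1}$ and corank $\dim\mathfrak g_{-2}$. A graded frame at $x$ is a pair $u$ of linear isomorphisms $\mathfrak g_{-1}\to H_x$, $\mathfrak g_{-2}\to T_xM/H_x$; it turns the Levi bracket $\mathcal L_x:\wedge^2H_x\to T_xM/H_x$, $\mathcal L(X,Y)=[X,Y]\bmod H$, into an element $l=f_{\mathcal L}(u)\in W$. A *partial regularisation* of $H$ at $x$ is a reduction to $G_0$ of the structure group of $H_x\oplus T_xM/H_x$, i.e. a $G_0$-orbit of graded frames at $x$, such that $\partial^*(k-l)=0$ for its frames $u$, with $l=f_{\mathcal L}(u)$. It is *suitable* if moreover,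 for these $l$, the orbit $S\cdot l$ is transverse at $l$ to the affine subspace $\{w\in W:\partial^*(k-w)=0\}$. A (suitable) partial regularisation of $H$ is a smooth field of (suitable) partial regularisations at all points of $M$, smooth meaning that it has smooth local sections by graded frames. **Proposition.** Let $H_t$, $t\in(a,b)\subset\mathbb R$, be a family of smooth distributions on $M$ of rank $\dim\mathfrak g_{-1}$ and corank $\dim\mathfrak g_{-2}$, continuous in the sense that locally $H_t$ has a frame of vector fields that are smooth for each $t$ and are continuous in $(t,x)$ together with their first derivatives in $x$. Suppose that $H_t$ is independent of $t$ outside a compact subset $M'\subset M$. Let $\tau\in(a,b)$, let $\mathcal K_\tau$ be a suitable partial regularisation of $H_\tau$, and suppose that $H^1(\mathfrak g^1,\mathfrak g)_0=0$. Then there is an open interval $I$ with $\tau\in I\subset(a,b)$ and a family $(\mathcal K_t)_{t\in I}$, where $\mathcal K_t$ is a suitable partial regularisation of $H_t$ for every $t\in I$, which is continuous in $(t,x)\in I\times M$ (it has local sections by graded frames that are continuous in $(t,x)$) and is equal to the given $\mathcal K_\tau$ at $t=\tau$. This family is unique: every family, over $t\in I$, of pointwise suitable partial regularisations of $H_t$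 at all points of $M$ that is continuous in $(t,x)$ and equal to $\mathcal K_\tau$ at $t=\tau$ is equal to $(\mathcal K_t)_{t\in I}$. -/

import Mathlib

open Set Filter Topology
open scoped Manifold ContDiff

namespace PartialReg

/-! ### Graded semisimple Lie algebras -/

section Algebra

section LinearAlgebra

variable (V U : Type*) [AddCommGroup V] [Module ℝ V] [AddCommGroup U] [Module ℝ U]

/-- The subspace of alternating maps in the space of bilinear maps `V × V → U`. -/
def altSubmodule : Submodule ℝ (V →ₗ[ℝ] V →ₗ[ℝ] U) where
  carrier := {w | ∀ x, w x x = 0}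
  add_mem' := fun {v w} hv hw x => by
    have h1 : v x x = 0 := hv x
    have h2 : w x x = 0 := hw x
    simp [h1, h2]
  zero_mem' := fun x => by simp
  smul_mem' := fun c w hw x => by
    have h1 : w x x = 0 := hw x
    simp [h1]

/-- `Λ²V* ⊗ U`: the vector space of alternating bilinear maps `V × V → U`. -/
def AltMaps : Type _ := altSubmodule V U

instance : AddCommGroup (AltMaps V U) := inferInstanceAs (AddCommGroup (altSubmodule V U))

instance : Module ℝ (AltMaps V U) := inferInstanceAs (Module ℝ (altSubmodule V U))

variable {V U}

/-- The bilinear map underlying an alternating map, as a linear function of the latter. -/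
def AltMaps.toBilin : AltMaps V U →ₗ[ℝ] V →ₗ[ℝ] V →ₗ[ℝ] U := (altSubmodule V U).subtype

theorem AltMaps.toBilin_injective :
    Function.Injective (AltMaps.toBilin : AltMaps V U →ₗ[ℝ] V →ₗ[ℝ] V →ₗ[ℝ] U) :=
  (altSubmodule V U).injective_subtype

theorem AltMaps.toBilin_self (w : AltMaps V U) (x : V) : AltMaps.toBilin w x x = 0 := w.2 x

/-- An alternating bilinear map, as an element of `AltMaps`. -/
def AltMaps.mk (w : V →ₗ[ℝ] V →ₗ[ℝ] U) (hw : ∀ x, w x x = 0) : AltMaps V U := ⟨w, hw⟩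

@[simp] theorem AltMaps.toBilin_mk (w : V →ₗ[ℝ] V →ₗ[ℝ] U) (hw : ∀ x, w x x = 0) :
    AltMaps.toBilin (AltMaps.mk w hw) = w := rfl

/-- The homology `ker d₁ / im d₂` at the middle term of `A → B → C`. -/
abbrev Homology {A B C : Type*} [AddCommGroup A] [Module ℝ A] [AddCommGroup B] [Module ℝ B]
    [AddCommGroup C] [Module ℝ C] (d₂ : A →ₗ[ℝ] B) (d₁ : B →ₗ[ℝ] C) : Type _ :=
  LinearMap.ker d₁ ⧸ (LinearMap.range d₂).submoduleOf (LinearMap.ker d₁)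

end LinearAlgebra

/-- A `|2|`-grading `𝔤 = 𝔤₋₂ ⊕ 𝔤₋₁ ⊕ 𝔤₀ ⊕ 𝔤₁ ⊕ 𝔤₂` of a (semisimple) real Lie algebra `L`:
`[𝔤ᵢ, 𝔤ⱼ] ⊆ 𝔤ᵢ₊ⱼ`, the subalgebra `𝔤₀` contains no simple ideal of `𝔤` (the simple ideals of a
semisimple Lie algebra are the atoms of its lattice of ideals), and `𝔤₁` generates
`𝔤¹ = 𝔤₁ ⊕ 𝔤₂`. -/
structure TwoGrading (L : Type*) [LieRing L] [LieAlgebra ℝ L] where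
  /-- the graded piece `𝔤ᵢ` -/
  piece : ℤ → Submodule ℝ L
  isInternal : DirectSum.IsInternal piece
  eq_bot : ∀ i : ℤ, 2 < |i| → piece i = ⊥
  lie_mem : ∀ (i j : ℤ) (x y : L), x ∈ piece i → y ∈ piece j → ⁅x, y⁆ ∈ piece (i + j)
  no_simple_ideal : ∀ I : LieIdeal ℝ L, IsAtom I → ¬ (I.toSubmodule ≤ piece 0)
  generates : (LieSubalgebra.lieSpan ℝ L (piece 1 : Set L)).toSubmodule = piece 1 ⊔ piece 2

variable {L : Type*} [LieRing L] [LieAlgebra ℝ L]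

/-- The Lie bracket `𝔤ᵢ × 𝔤ⱼ → 𝔤ₖ`, `k = i + j`. -/
def TwoGrading.br (𝔤 : TwoGrading L) (i j k : ℤ) (h : i + j = k) :
    𝔤.piece i →ₗ[ℝ] 𝔤.piece j →ₗ[ℝ] 𝔤.piece k :=
  LinearMap.mk₂ ℝ (fun x y => ⟨⁅(x : L), (y : L)⁆, h ▸ 𝔤.lie_mem i j x y x.2 y.2⟩)
    (fun x x' y => Subtype.ext (by simp))
    (fun c x y => Subtype.ext (by simp))
    (fun x y y' => Subtype.ext (by simp))
    (fun c x y => Subtype.ext (by simp))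

@[simp] theorem TwoGrading.coe_br (𝔤 : TwoGrading L) (i j k : ℤ) (h : i + j = k)
    (x : 𝔤.piece i) (y : 𝔤.piece j) : (𝔤.br i j k h x y : L) = ⁅(x : L), (y : L)⁆ := rfl

variable [FiniteDimensional ℝ L]

theorem TwoGrading.killingForm_eq_zero (𝔤 : TwoGrading L) {i j : ℤ} (hij : i + j ≠ 0)
    {x y : L} (hx : x ∈ 𝔤.piece i) (hy : y ∈ 𝔤.piece j) : killingForm ℝ L x y = 0 := by
  rw [killingForm_apply_apply]
  refine LinearMap.trace_eq_zero_of_mapsTo_ne 𝔤.isInternal (fun k => i + (j + k))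
    (fun k h => hij (by omega)) ?_
  intro k z hz
  exact 𝔤.lie_mem i (j + k) _ _ hx (𝔤.lie_mem j k _ _ hy hz)

variable [LieAlgebra.IsSemisimple ℝ L]

/-- The Killing form as a map `𝔤ᵢ → (𝔤₋ᵢ)*`. -/
noncomputable def TwoGrading.killingPairing (𝔤 : TwoGrading L) (i : ℤ) :
    𝔤.piece i →ₗ[ℝ] Module.Dual ℝ (𝔤.piece (-i)) :=
  (Submodule.dualRestrict (𝔤.piece (-i))) ∘ₗ (killingForm ℝ L) ∘ₗ (𝔤.piece i).subtype

theorem TwoGrading.killingPairing_injective (𝔤 : TwoGrading L) (i : ℤ) :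
    Function.Injective (𝔤.killingPairing i) := by
  rw [injective_iff_map_eq_zero]
  intro x hx
  have key : killingForm ℝ L (x : L) = 0 := by
    rw [← LinearMap.ker_eq_top, eq_top_iff, ← 𝔤.isInternal.submodule_iSup_eq_top, iSup_le_iff]
    intro j y hy
    by_cases h : j = -i
    · subst h
      exact LinearMap.congr_fun hx ⟨y, hy⟩
    · exact 𝔤.killingForm_eq_zero (fun h' => h (by omega)) x.2 hy
  have := (LieAlgebra.IsKilling.ker_killingForm_eq_bot ℝ L)
  exact Subtype.ext ((LinearMap.ker_eq_bot'.1 this) _ key)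

/-- The Killing form identifies `𝔤ᵢ` with the dual of `𝔤₋ᵢ`. -/
noncomputable def TwoGrading.killingEquiv (𝔤 : TwoGrading L) (i : ℤ) :
    𝔤.piece i ≃ₗ[ℝ] Module.Dual ℝ (𝔤.piece (-i)) :=
  LinearEquiv.ofBijective (𝔤.killingPairing i) ⟨𝔤.killingPairing_injective i, by
    refine (LinearMap.injective_iff_surjective_of_finrank_eq_finrank ?_).1
      (𝔤.killingPairing_injective i)
    have h1 := LinearMap.finrank_le_finrank_of_injective (𝔤.killingPairing_injective i)
    have h2 := LinearMap.finrank_le_finrank_of_injective (𝔤.killingPairing_injective (-i))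
    rw [neg_neg] at h2
    rw [Subspace.dual_finrank_eq] at h1 h2 ⊢
    omega⟩

/-- A basis `(z_l)` of `𝔤₋ᵢ`. -/
noncomputable abbrev TwoGrading.negBasis (𝔤 : TwoGrading L) (i : ℤ) :
    Module.Basis (Fin (Module.finrank ℝ (𝔤.piece (-i)))) ℝ (𝔤.piece (-i)) :=
  Module.finBasis ℝ (𝔤.piece (-i))

/-- The basis `(z^l)` of `𝔤ᵢ` dual to `(z_l)` under the Killing form. -/
noncomputable def TwoGrading.dualVec (𝔤 : TwoGrading L) (i : ℤ)
    (l : Fin (Module.finrank ℝ (𝔤.piece (-i)))) : 𝔤.piece i :=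
  (𝔤.killingEquiv i).symm ((𝔤.negBasis i).coord l)

/-- `W = Λ²(𝔤₋₁)* ⊗ 𝔤₋₂`, the homogeneity zero part of `C₂ = Λ²𝔤¹ ⊗ 𝔤`. -/
abbrev TwoGrading.W (𝔤 : TwoGrading L) : Type _ := AltMaps (𝔤.piece (-1)) (𝔤.piece (-2))

/-- `𝔰 = End(𝔤₋₁) ⊕ End(𝔤₋₂)`, the homogeneity zero part of `C₁ = 𝔤¹ ⊗ 𝔤`; also the Lie algebra of
`S = GL(𝔤₋₁) × GL(𝔤₋₂)`. -/
abbrev TwoGrading.𝔰 (𝔤 : TwoGrading L) : Type _ :=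
  (𝔤.piece (-1) →ₗ[ℝ] 𝔤.piece (-1)) × (𝔤.piece (-2) →ₗ[ℝ] 𝔤.piece (-2))

/-- The homogeneity zero part of `∂* : C₂ → C₁`,
`(∂* ψ)(x) = ∑ [z^l, ψ(x, z_l)] - ½ ∑ ψ([z^l, x]₋, z_l)`.
On `W` only the basis vectors `z_l` of `𝔤₋₁` contribute; the first sum is nonzero only for
`x ∈ 𝔤₋₁`, the second only for `x ∈ 𝔤₋₂`. -/
noncomputable def TwoGrading.codiff₂ (𝔤 : TwoGrading L) : 𝔤.W →ₗ[ℝ] 𝔤.𝔰 where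
  toFun ψ :=
    (∑ l, (𝔤.br 1 (-2) (-1) (by norm_num) (𝔤.dualVec 1 l)) ∘ₗ
        (ψ.toBilin.flip (𝔤.negBasis 1 l)),
      -(1 / 2 : ℝ) • ∑ l,
        (ψ.toBilin.flip (𝔤.negBasis 1 l)) ∘ₗ
        (𝔤.br 1 (-2) (-1) (by norm_num) (𝔤.dualVec 1 l)))
  map_add' ψ ψ' := by
    refine Prod.ext ?_ ?_ <;> ext x <;> simp [Finset.sum_add_distrib]
  map_smul' c ψ := by
    refine Prod.ext ?_ ?_
    · ext x; simp [Finset.smul_sum]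
    · ext x; simp [Finset.smul_sum, smul_smul, mul_comm]

/-- The homogeneity zero part of `∂* : C₁ → C₀ = 𝔤`, `∂* φ = ∑ [z^l, φ(z_l)]`, the sum being over
bases of `𝔤₋₁` and of `𝔤₋₂`. -/
noncomputable def TwoGrading.codiff₁ (𝔤 : TwoGrading L) : 𝔤.𝔰 →ₗ[ℝ] 𝔤.piece 0 where
  toFun φ :=
    ∑ l, 𝔤.br 1 (-1) 0 (by norm_num) (𝔤.dualVec 1 l) (φ.1 (𝔤.negBasis 1 l)) +
      ∑ l, 𝔤.br 2 (-2) 0 (by norm_num) (𝔤.dualVec 2 l) (φ.2 (𝔤.negBasis 2 l))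
  map_add' φ φ' := by
    simp only [Prod.fst_add, Prod.snd_add, LinearMap.add_apply, map_add, Finset.sum_add_distrib]
    abel
  map_smul' c φ := by
    simp only [Prod.smul_fst, Prod.smul_snd, LinearMap.smul_apply, map_smul, Finset.smul_sum,
      smul_add, RingHom.id_apply]

/-- `H¹(𝔤¹, 𝔤)₀ = ker ∂*₁ / im ∂*₂` in homogeneity zero. -/
abbrev TwoGrading.H1Zero (𝔤 : TwoGrading L) : Type _ :=
  Homology 𝔤.codiff₂ 𝔤.codiff₁

/-- The standard bracket `k ∈ W`. -/
noncomputable def TwoGrading.k (𝔤 : TwoGrading L) : 𝔤.W :=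
  AltMaps.mk (𝔤.br (-1) (-1) (-2) (by norm_num)) fun x => Subtype.ext (by simp)

/-- The derivative at `s = Id` of `s ↦ s · l`, where `(s · l)(x, y) = s₂ (l (s₁ x, s₁ y))`. Its range
is the tangent space at `l` of the orbit `S · l`. -/
noncomputable def TwoGrading.orbitDeriv (𝔤 : TwoGrading L) (l : 𝔤.W) : 𝔤.𝔰 →ₗ[ℝ] 𝔤.W where
  toFun t :=
    AltMaps.mk (LinearMap.mk₂ ℝ
      (fun x y => t.2 (l.toBilin x y) + l.toBilin (t.1 x) y + l.toBilin x (t.1 y))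
      (fun x x' y => by simp only [map_add, LinearMap.add_apply]; abel)
      (fun c x y => by simp only [map_smul, LinearMap.smul_apply, smul_add])
      (fun x y y' => by simp only [map_add]; abel)
      (fun c x y => by simp only [map_smul, smul_add])) fun x => by
        have h1 := l.toBilin_self (x + t.1 x)
        simp only [map_add, LinearMap.add_apply, l.toBilin_self, zero_add, add_zero] at h1
        simp only [LinearMap.mk₂_apply, l.toBilin_self, map_zero, zero_add]
        exact h1
  map_add' t t' := by
    refine AltMaps.toBilin_injective (LinearMap.ext fun x => LinearMap.ext fun y => ?_)
    simp only [map_add, AltMaps.toBilin_mk, LinearMap.add_apply, LinearMap.mk₂_apply,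
      Prod.fst_add, Prod.snd_add]
    abel
  map_smul' c t := by
    refine AltMaps.toBilin_injective (LinearMap.ext fun x => LinearMap.ext fun y => ?_)
    simp only [AltMaps.toBilin_mk, LinearMap.smul_apply, LinearMap.mk₂_apply, Prod.smul_fst,
      Prod.smul_snd, map_smul, smul_add, RingHom.id_apply]

/-- At `l` the orbit `S · l` is transverse to the affine subspace `{w | ∂* (k - w) = 0}` of `W`,
whose direction is `ker ∂*`. -/
def TwoGrading.IsTransverse (𝔤 : TwoGrading L) (l : 𝔤.W) : Prop :=
  LinearMap.range (𝔤.orbitDeriv l) ⊔ LinearMap.ker 𝔤.codiff₂ = ⊤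

/-- A graded frame of `gr(T) = H ⊕ T/H`, for a subspace `H` of a vector space `T`, modelled on
`𝔤₋₁ ⊕ 𝔤₋₂`. -/
structure GradedFrame (𝔤 : TwoGrading L) {T : Type*} [AddCommGroup T] [Module ℝ T]
    (Hx : Submodule ℝ T) where
  /-- the frame of `H` -/
  fst : 𝔤.piece (-1) ≃ₗ[ℝ] Hx
  /-- the frame of `T/H` -/
  snd : 𝔤.piece (-2) ≃ₗ[ℝ] (T ⧸ Hx)

end Algebra

/-! ### The group `G₀` -/

section Group

variable {EG : Type*} [NormedAddCommGroup EG] [NormedSpace ℝ EG]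
  {G : Type*} [Group G] [TopologicalSpace G] [ChartedSpace EG G]

/-- The adjoint action of a Lie group on its Lie algebra: the derivative at `1` of conjugation. -/
noncomputable def Ad (g : G) :
    GroupLieAlgebra 𝓘(ℝ, EG) G →ₗ[ℝ] GroupLieAlgebra 𝓘(ℝ, EG) G :=
  (mfderiv 𝓘(ℝ, EG) 𝓘(ℝ, EG) (fun h : G => g * h * g⁻¹) 1).toLinearMap

variable [FiniteDimensional ℝ EG] [LieGroup 𝓘(ℝ, EG) ∞ G]

/-- The smoothness that Mathlib asks for in order to define the Lie algebra of a Lie group. -/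
instance instLieGroupMinSmoothness : LieGroup 𝓘(ℝ, EG) (minSmoothness ℝ 3) G :=
  LieGroup.of_le (n := ∞) (by rw [minSmoothness_of_isRCLikeNormedField]; exact ENat.LEInfty.out)

instance instFiniteDimensionalGroupLieAlgebra :
    FiniteDimensional ℝ (GroupLieAlgebra 𝓘(ℝ, EG) G) :=
  inferInstanceAs (FiniteDimensional ℝ EG)

/-- `G₀ ⊆ G`: the elements of `G` that preserve the grading of its Lie algebra. -/
def GZero (𝔤 : TwoGrading (GroupLieAlgebra 𝓘(ℝ, EG) G)) : Set G :=
  {g | ∀ i : ℤ, ∀ x ∈ 𝔤.piece i, Ad g x ∈ 𝔤.piece i}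

/-- `K` is a reduction to `G₀` (equivalently to `P`, since `exp 𝔤¹` acts trivially on the associated
graded space) of the structure group of `H ⊕ T/H`, that is, a `G₀`-orbit in the
set of graded frames, `g ∈ G₀` acting by `u ↦ u ∘ Ad g`. -/
def IsG₀Orbit (𝔤 : TwoGrading (GroupLieAlgebra 𝓘(ℝ, EG) G)) {T : Type*} [AddCommGroup T]
    [Module ℝ T] {Hx : Submodule ℝ T} (K : Set (GradedFrame 𝔤 Hx)) : Prop :=
  ∃ u : GradedFrame 𝔤 Hx, K = {u' | ∃ (g : G) (hg : g ∈ GZero 𝔤),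
    (∀ v : 𝔤.piece (-1), u'.fst v = u.fst ⟨Ad g v, hg (-1) v v.2⟩) ∧
    (∀ w : 𝔤.piece (-2), u'.snd w = u.snd ⟨Ad g w, hg (-2) w w.2⟩)}

end Group

/-! ### Distributions and partial regularisations -/

section Manifold

variable {E : Type*} [NormedAddCommGroup E] [NormedSpace ℝ E]
  {M : Type*} [TopologicalSpace M] [ChartedSpace E M] [IsManifold 𝓘(ℝ, E) ∞ M]

/-- The isomorphism from `E` onto the tangent space of `M` at the point with coordinates `y` in the
chart around `x₀`. -/
noncomputable def ofCoord (x₀ : M) (y : E) :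
    E →ₗ[ℝ] TangentSpace 𝓘(ℝ, E) ((extChartAt 𝓘(ℝ, E) x₀).symm y) :=
  (mfderiv 𝓘(ℝ, E) 𝓘(ℝ, E) (extChartAt 𝓘(ℝ, E) x₀).symm y).toLinearMap

/-- `(H_t)_{t ∈ J}` is a continuous family of smooth distributions of rank `m`: near each
`(t₀, x₀)` there are, in the chart around `x₀`, vector fields `X_i(t, ·)` that span `H_t`, are
smooth for fixed `t`, and depend continuously on `(t, x)` together with their first derivatives in
`x` (continuity in the `C¹` topology). -/
def IsContinuousFamily (J : Set ℝ) (m : ℕ)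
    (H : ℝ → (x : M) → Submodule ℝ (TangentSpace 𝓘(ℝ, E) x)) : Prop :=
  ∀ t₀ ∈ J, ∀ x₀ : M, ∃ N ∈ 𝓝 ((t₀, extChartAt 𝓘(ℝ, E) x₀ x₀) : ℝ × E),
    ∃ X : Fin m → ℝ → E → E,
      (∀ i, ∀ p ∈ N, ContDiffAt ℝ ∞ (X i p.1) p.2) ∧
      (∀ i, ContinuousOn (fun p : ℝ × E => X i p.1 p.2) N) ∧
      (∀ i, ContinuousOn (fun p : ℝ × E => fderiv ℝ (X i p.1) p.2) N) ∧
      ∀ p ∈ N, LinearIndependent ℝ (fun i => X i p.1 p.2) ∧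
        H p.1 ((extChartAt 𝓘(ℝ, E) x₀).symm p.2) =
          Submodule.span ℝ (range fun i => ofCoord x₀ p.2 (X i p.1 p.2))

variable {L : Type*} [LieRing L] [LieAlgebra ℝ L] [FiniteDimensional ℝ L]
  [LieAlgebra.IsSemisimple ℝ L]

/-- `l = f_ℒ(u)`: in the graded frame `u` at `x`, the Levi bracket `ℒ : Λ²H_x → T_xM/H_x`,
`ℒ(X, Y) = [X, Y] mod H` for sections `X`, `Y` of `H`, is given by `l ∈ W`. -/
def IsLevi (𝔤 : TwoGrading L) (H : (x : M) → Submodule ℝ (TangentSpace 𝓘(ℝ, E) x)) (x : M)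
    (u : GradedFrame 𝔤 (H x)) (l : 𝔤.W) : Prop :=
  ∀ X Y : (y : M) → TangentSpace 𝓘(ℝ, E) y,
    ContMDiffAt 𝓘(ℝ, E) 𝓘(ℝ, E).tangent ∞
      (fun y => (⟨y, X y⟩ : TangentBundle 𝓘(ℝ, E) M)) x →
    ContMDiffAt 𝓘(ℝ, E) 𝓘(ℝ, E).tangent ∞
      (fun y => (⟨y, Y y⟩ : TangentBundle 𝓘(ℝ, E) M)) x →
    (∀ᶠ y in 𝓝 x, X y ∈ H y ∧ Y y ∈ H y) →
    ∀ v w : 𝔤.piece (-1), X x = u.fst v → Y x = u.fst w →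
      (H x).mkQ (VectorField.mlieBracket 𝓘(ℝ, E) X Y x) = u.snd (l.toBilin v w)

/-- In the chart around `x₀`, at the point with coordinates `y`, the graded frame `u` is given by
`v ↦ A v` on `𝔤₋₁` and by `w ↦ B w mod H` on `𝔤₋₂`. -/
def IsCoordFrame (𝔤 : TwoGrading L) (x₀ : M) (y : E)
    {Hx : Submodule ℝ (TangentSpace 𝓘(ℝ, E) ((extChartAt 𝓘(ℝ, E) x₀).symm y))}
    (u : GradedFrame 𝔤 Hx) (A : 𝔤.piece (-1) → E) (B : 𝔤.piece (-2) → E) : Prop :=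
  (∀ v, (u.fst v : TangentSpace 𝓘(ℝ, E) ((extChartAt 𝓘(ℝ, E) x₀).symm y)) =
      ofCoord x₀ y (A v)) ∧
    ∀ w, u.snd w = Hx.mkQ (ofCoord x₀ y (B w))

/-- A field of sets of graded frames of `gr(TM) = H ⊕ TM/H` is smooth: it has smooth local
sections. -/
def IsSmoothField (𝔤 : TwoGrading L) (H : (x : M) → Submodule ℝ (TangentSpace 𝓘(ℝ, E) x))
    (K : (x : M) → Set (GradedFrame 𝔤 (H x))) : Prop :=
  ∀ x₀ : M, ∃ N ∈ 𝓝 (extChartAt 𝓘(ℝ, E) x₀ x₀),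
    ∃ (A : 𝔤.piece (-1) → E → E) (B : 𝔤.piece (-2) → E → E),
      (∀ v, ContDiffOn ℝ ∞ (A v) N) ∧ (∀ w, ContDiffOn ℝ ∞ (B w) N) ∧
      ∀ y ∈ N, ∃ u ∈ K ((extChartAt 𝓘(ℝ, E) x₀).symm y),
        IsCoordFrame 𝔤 x₀ y u (fun v => A v y) (fun w => B w y)

/-- A family, over `t ∈ J`, of fields of sets of graded frames of `H_t ⊕ TM/H_t` is continuous in
`(t, x)`: it has local sections that are continuous in `(t, x)`. -/
def IsContinuousField (𝔤 : TwoGrading L) (J : Set ℝ)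
    (H : ℝ → (x : M) → Submodule ℝ (TangentSpace 𝓘(ℝ, E) x))
    (K : (t : ℝ) → (x : M) → Set (GradedFrame 𝔤 (H t x))) : Prop :=
  ∀ t₀ ∈ J, ∀ x₀ : M, ∃ N ∈ 𝓝 ((t₀, extChartAt 𝓘(ℝ, E) x₀ x₀) : ℝ × E),
    ∃ (A : 𝔤.piece (-1) → ℝ × E → E) (B : 𝔤.piece (-2) → ℝ × E → E),
      (∀ v, ContinuousOn (A v) N) ∧ (∀ w, ContinuousOn (B w) N) ∧
      ∀ p ∈ N, ∃ u ∈ K p.1 ((extChartAt 𝓘(ℝ, E) x₀).symm p.2),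
        IsCoordFrame 𝔤 x₀ p.2 u (fun v => A v p) (fun w => B w p)

end Manifold

section Regularisation

variable {E : Type*} [NormedAddCommGroup E] [NormedSpace ℝ E]
  {M : Type*} [TopologicalSpace M] [ChartedSpace E M] [IsManifold 𝓘(ℝ, E) ∞ M]
  {EG : Type*} [NormedAddCommGroup EG] [NormedSpace ℝ EG] [FiniteDimensional ℝ EG]
  {G : Type*} [Group G] [TopologicalSpace G] [ChartedSpace EG G] [LieGroup 𝓘(ℝ, EG) ∞ G]
  [LieAlgebra.IsSemisimple ℝ (GroupLieAlgebra 𝓘(ℝ, EG) G)]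

/-- At the point `x`, the set `K` of graded frames is a partial regularisation of `H`: a reduction
to `G₀` of the structure group of `gr(T)_x`, such that `∂* (𝒦 - ℒ) = 0`. In a frame of the
reduction the algebraic bracket `𝒦` is the standard bracket `k` and `ℒ` is `l`. -/
def IsPartialRegularisationAt (𝔤 : TwoGrading (GroupLieAlgebra 𝓘(ℝ, EG) G))
    (H : (x : M) → Submodule ℝ (TangentSpace 𝓘(ℝ, E) x)) (x : M)
    (K : Set (GradedFrame 𝔤 (H x))) : Prop :=
  IsG₀Orbit 𝔤 K ∧ ∀ u ∈ K, ∃ l : 𝔤.W, IsLevi 𝔤 H x u l ∧ 𝔤.codiff₂ (𝔤.k - l) = 0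

/-- A partial regularisation of `H` at `x` is suitable: for a frame `u` in it and `l = f_ℒ(u)`, the
`S`-orbit of `l` is transverse at `l` to the kernel of `w ↦ ∂* (k - w)`. -/
def IsSuitableAt (𝔤 : TwoGrading (GroupLieAlgebra 𝓘(ℝ, EG) G))
    (H : (x : M) → Submodule ℝ (TangentSpace 𝓘(ℝ, E) x)) (x : M)
    (K : Set (GradedFrame 𝔤 (H x))) : Prop :=
  IsPartialRegularisationAt 𝔤 H x K ∧
    ∀ u ∈ K, ∃ l : 𝔤.W, IsLevi 𝔤 H x u l ∧ 𝔤.IsTransverse l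

end Regularisation

end PartialReg

/-! A graded frame `u` at a point turns the Levi bracket into `l ∈ W`. The group `S` acts simply
transitively on graded frames and, correspondingly, from the right on `W`. A suitable partial
regularisation is a `G₀`-orbit of frames for which `l` is normal, i.e. `∂*(k - l) = 0`, and
transverse. So the problem is to solve `∂*(k - l·s) = 0` for `s ∈ S` modulo `G₀` while `l` varies.

Linearise at a normal transverse `l`, writing `D_l` for the derivative of the orbit map. The Killing
form and the bracket are invariant, so `G₀` preserves normality, and hence `ad 𝔤₀` lies in the
kernel of `∂* ∘ D_l : 𝔰 → 𝔰`. By transversality this map has the same image as `∂* : W → 𝔰`, and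
`H¹(𝔤¹, 𝔤)₀ = 0` makes this image at least as large as `ker (∂* : 𝔰 → 𝔤₀)`. The kernel therefore has
dimension at most `dim 𝔤₀`; as `𝔤₀` acts faithfully on `𝔤₋`, it is exactly `𝔤₀`
(`TwoGrading.ker_codiff₂_orbitDeriv`).

Let `C` be a complement of `𝔤₀` in the space of pairs of endomorphisms. The implicit function
theorem gives, for `l` near `l₀`, a unique small `c ∈ C` such that `1 + c` normalises `l`, and the
inverse function theorem writes every `s` near `1` as the product of some `1 + c` and some `exp (ad
A)`, `A ∈ 𝔤₀` (`exists_slice_of_hasFDerivAt`). This yields existence, since nearby `l` can be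
normalised smoothly (`IsStructureGroup.exists_normaliser`), and rigidity, since an `s` near `1` that
takes a normal `l` near `l₀` to a normal element lies in the image of `G₀`
(`IsStructureGroup.eventually_mem`). The latter needs `exp (ad A) ∈ Ad G`, which comes from integral
curves of left-invariant vector fields (`exists_adCLM_eq_exp`).

On the manifold, local reference frames make the Levi form a `W`-valued function that is continuous
in `(t, x)`, because it involves only first derivatives of the frames, and smooth in `x`.
Normalising it near `(τ, x₀)` extends the given regularisation locally
(`LocalModel.exists_extension`). Rigidity makes agreement of two continuous families a locally
constant condition (`LocalModel.eventually_eq_of_eq`), so they agree on whole time intervals. This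
uniqueness glues the local extensions. Compactness of `M'` supplies a common time interval, and
outside `M'` the initial regularisation is kept unchanged. -/

namespace PartialReg

/-! ### Graded automorphisms and the codifferential -/

section GradedAut

section LinearAlgebra

variable {V U : Type*} [AddCommGroup V] [Module ℝ V] [AddCommGroup U] [Module ℝ U]

/-- The alternating map `(x, y) ↦ s₂ (l (s₁ x, s₁ y))`. -/
def AltMaps.act (s₁ : V →ₗ[ℝ] V) (s₂ : U →ₗ[ℝ] U) (l : AltMaps V U) : AltMaps V U :=
  AltMaps.mk ((l.toBilin.compl₁₂ s₁ s₁).compr₂ s₂) fun x => by simp [l.toBilin_self]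

@[simp] theorem AltMaps.toBilin_act (s₁ : V →ₗ[ℝ] V) (s₂ : U →ₗ[ℝ] U) (l : AltMaps V U) (x y : V) :
    (l.act s₁ s₂).toBilin x y = s₂ (l.toBilin (s₁ x) (s₁ y)) := rfl

@[ext] theorem AltMaps.ext {l l' : AltMaps V U} (h : ∀ x y, l.toBilin x y = l'.toBilin x y) :
    l = l' :=
  AltMaps.toBilin_injective (LinearMap.ext fun x => LinearMap.ext fun y => h x y)

theorem AltMaps.act_sub (s₁ : V →ₗ[ℝ] V) (s₂ : U →ₗ[ℝ] U) (l l' : AltMaps V U) :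
    (l - l').act s₁ s₂ = l.act s₁ s₂ - l'.act s₁ s₂ := by
  ext x y; simp

@[simp] theorem AltMaps.act_id (l : AltMaps V U) :
    l.act LinearMap.id LinearMap.id = l := by
  ext x y; simp

end LinearAlgebra

variable {L : Type*} [LieRing L] [LieAlgebra ℝ L]

theorem TwoGrading.orbitDeriv_apply (𝔤 : TwoGrading L) (l : 𝔤.W) (t : 𝔤.𝔰)
    (x y : 𝔤.piece (-1)) : (𝔤.orbitDeriv l t).toBilin x y =
      t.2 (l.toBilin x y) + l.toBilin (t.1 x) y + l.toBilin x (t.1 y) := rfl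

variable [FiniteDimensional ℝ L]

/-- A Lie algebra automorphism that maps each graded piece into itself restricts to the pieces. -/
noncomputable def TwoGrading.restr (𝔤 : TwoGrading L) (φ : L ≃ₗ⁅ℝ⁆ L)
    (hφ : ∀ i : ℤ, ∀ x ∈ 𝔤.piece i, φ x ∈ 𝔤.piece i) (i : ℤ) :
    𝔤.piece i ≃ₗ[ℝ] 𝔤.piece i :=
  LinearEquiv.ofInjectiveEndo ((φ : L →ₗ[ℝ] L).restrict (hφ i)) fun x y h => by
    have := congrArg Subtype.val h
    exact Subtype.ext (φ.injective this)

@[simp] theorem TwoGrading.coe_restr (𝔤 : TwoGrading L) (φ : L ≃ₗ⁅ℝ⁆ L)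
    (hφ : ∀ i : ℤ, ∀ x ∈ 𝔤.piece i, φ x ∈ 𝔤.piece i) (i : ℤ) (x : 𝔤.piece i) :
    (𝔤.restr φ hφ i x : L) = φ x := rfl

variable (𝔤 : TwoGrading L) (φ : L ≃ₗ⁅ℝ⁆ L)
    (hφ : ∀ i : ℤ, ∀ x ∈ 𝔤.piece i, φ x ∈ 𝔤.piece i)

include hφ in
theorem TwoGrading.symm_mem (i : ℤ) (x : L) (hx : x ∈ 𝔤.piece i) : φ.symm x ∈ 𝔤.piece i := by
  obtain ⟨y, hy⟩ := (𝔤.restr φ hφ i).surjective ⟨x, hx⟩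
  have : φ y = x := congrArg Subtype.val hy
  rw [← this, LieEquiv.symm_apply_apply]
  exact y.2

theorem TwoGrading.coe_restr_symm (i : ℤ) (x : 𝔤.piece i) :
    ((𝔤.restr φ hφ i).symm x : L) = φ.symm x := by
  obtain ⟨y, rfl⟩ := (𝔤.restr φ hφ i).surjective x
  simp

theorem TwoGrading.br_restr (i j k : ℤ) (h : i + j = k) (x : 𝔤.piece i) (y : 𝔤.piece j) :
    𝔤.br i j k h (𝔤.restr φ hφ i x) (𝔤.restr φ hφ j y) = 𝔤.restr φ hφ k (𝔤.br i j k h x y) :=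
  Subtype.ext (LieEquiv.map_lie φ _ _).symm

/-- The right action of a graded automorphism on `W`. -/
noncomputable def TwoGrading.autAct (l : 𝔤.W) : 𝔤.W :=
  l.act (𝔤.restr φ hφ (-1)) (𝔤.restr φ hφ (-2)).symm

theorem TwoGrading.autAct_k : 𝔤.autAct φ hφ 𝔤.k = 𝔤.k := by
  ext x y : 2
  simp only [TwoGrading.autAct, TwoGrading.k, AltMaps.toBilin_act, AltMaps.toBilin_mk,
    LinearEquiv.coe_coe]
  rw [𝔤.br_restr, LinearEquiv.symm_apply_apply]

variable [LieAlgebra.IsSemisimple ℝ L]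

theorem TwoGrading.killingPairing_dualVec (i : ℤ) (l : Fin (Module.finrank ℝ (𝔤.piece (-i))))
    (y : 𝔤.piece (-i)) :
    killingForm ℝ L (𝔤.dualVec i l) y = (𝔤.negBasis i).coord l y := by
  have h : 𝔤.killingEquiv i (𝔤.dualVec i l) = (𝔤.negBasis i).coord l :=
    (𝔤.killingEquiv i).apply_symm_apply _
  exact LinearMap.congr_fun h y

theorem TwoGrading.eq_sum_dualVec (i : ℤ) (x : 𝔤.piece i) :
    x = ∑ m, killingForm ℝ L x (𝔤.negBasis i m) • 𝔤.dualVec i m := by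
  apply (𝔤.killingEquiv i).injective
  refine (𝔤.negBasis i).ext fun n => ?_
  have h : ∀ z : 𝔤.piece i, 𝔤.killingEquiv i z (𝔤.negBasis i n) =
    killingForm ℝ L z (𝔤.negBasis i n) := fun z => rfl
  rw [h, h]
  simp only [Submodule.coe_sum, Submodule.coe_smul, map_sum, map_smul, LinearMap.sum_apply,
    LinearMap.smul_apply, 𝔤.killingPairing_dualVec, Module.Basis.coord_apply,
    Module.Basis.repr_self]
  rw [Finset.sum_eq_single n]
  · simp
  · intro m _ hm; simp [hm.symm]
  · simp

/-- The canonical element `∑ z^l ⊗ z_l` is invariant under graded automorphisms. -/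
theorem TwoGrading.sum_dualVec_invariant {X : Type*} [AddCommGroup X] [Module ℝ X] (i : ℤ)
    (B : 𝔤.piece i →ₗ[ℝ] 𝔤.piece (-i) →ₗ[ℝ] X) :
    ∑ l, B (𝔤.restr φ hφ i (𝔤.dualVec i l)) (𝔤.restr φ hφ (-i) (𝔤.negBasis i l)) =
      ∑ l, B (𝔤.dualVec i l) (𝔤.negBasis i l) := by
  -- Invariance of the Killing form moves `φ` to the other argument: the coefficients of `φ z^l` in
  -- the dual basis are those of `φ⁻¹ z_m` in the basis. After exchanging the sums, `φ` and `φ⁻¹`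
  -- cancel.
  have key : ∀ l, 𝔤.restr φ hφ i (𝔤.dualVec i l) =
      ∑ m, (𝔤.negBasis i).coord l ((𝔤.restr φ hφ (-i)).symm (𝔤.negBasis i m)) •
        𝔤.dualVec i m := by
    intro l
    conv_lhs => rw [𝔤.eq_sum_dualVec i (𝔤.restr φ hφ i (𝔤.dualVec i l))]
    refine Finset.sum_congr rfl fun m _ => ?_
    rw [← 𝔤.killingPairing_dualVec, 𝔤.coe_restr_symm, 𝔤.coe_restr]
    congr 1
    conv_lhs => rw [← φ.apply_symm_apply (𝔤.negBasis i m : L)]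
    exact LieAlgebra.killingForm_of_equiv_apply φ _ _
  simp only [key, map_sum, map_smul, LinearMap.sum_apply, LinearMap.smul_apply]
  rw [Finset.sum_comm]
  refine Finset.sum_congr rfl fun m _ => ?_
  simp only [← map_smul (B (𝔤.dualVec i m)), ← map_sum]
  congr 1
  have h := congrArg (𝔤.restr φ hφ (-i))
    ((𝔤.negBasis i).sum_repr ((𝔤.restr φ hφ (-i)).symm (𝔤.negBasis i m)))
  rw [map_sum, LinearEquiv.apply_symm_apply] at h
  simpa only [map_smul, Module.Basis.coord_apply] using h

theorem TwoGrading.codiff₂_fst_apply (ψ : 𝔤.W) (x : 𝔤.piece (-1)) :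
    (𝔤.codiff₂ ψ).1 x = ∑ l, 𝔤.br 1 (-2) (-1) (by norm_num) (𝔤.dualVec 1 l)
      (ψ.toBilin x (𝔤.negBasis 1 l)) := by
  simp [TwoGrading.codiff₂]

theorem TwoGrading.codiff₂_snd_apply (ψ : 𝔤.W) (x : 𝔤.piece (-2)) :
    (𝔤.codiff₂ ψ).2 x = -(1 / 2 : ℝ) • ∑ l, ψ.toBilin
      (𝔤.br 1 (-2) (-1) (by norm_num) (𝔤.dualVec 1 l) x) (𝔤.negBasis 1 l) := by
  simp [TwoGrading.codiff₂]

/-- Here `∂*` is a contraction with the invariant element `∑ z^l ⊗ z_l`, and `φ` respects brackets;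
so this component of `∂*` is equivariant. The other component is treated in the same way. -/
theorem TwoGrading.codiff₂_autAct_fst (ψ : 𝔤.W) (x : 𝔤.piece (-1)) :
    (𝔤.codiff₂ (𝔤.autAct φ hφ ψ)).1 x =
      (𝔤.restr φ hφ (-1)).symm ((𝔤.codiff₂ ψ).1 (𝔤.restr φ hφ (-1) x)) := by
  rw [codiff₂_fst_apply, LinearEquiv.eq_symm_apply, map_sum, codiff₂_fst_apply]
  refine Eq.trans ?_ (𝔤.sum_dualVec_invariant φ hφ 1
    ((LinearMap.lcomp ℝ _ (ψ.toBilin (𝔤.restr φ hφ (-1) x))) ∘ₗ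
      (𝔤.br 1 (-2) (-1) (by norm_num))))
  refine Finset.sum_congr rfl fun l _ => ?_
  rw [← 𝔤.br_restr]
  simp [TwoGrading.autAct]

theorem TwoGrading.codiff₂_autAct_snd (ψ : 𝔤.W) (x : 𝔤.piece (-2)) :
    (𝔤.codiff₂ (𝔤.autAct φ hφ ψ)).2 x =
      (𝔤.restr φ hφ (-2)).symm ((𝔤.codiff₂ ψ).2 (𝔤.restr φ hφ (-2) x)) := by
  rw [codiff₂_snd_apply, LinearEquiv.eq_symm_apply, map_smul, map_sum, codiff₂_snd_apply]
  congr 1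
  refine Eq.trans ?_ (𝔤.sum_dualVec_invariant φ hφ 1 (ψ.toBilin ∘ₗ
      ((𝔤.br 1 (-2) (-1) (by norm_num)).flip (𝔤.restr φ hφ (-2) x))))
  refine Finset.sum_congr rfl fun l _ => ?_
  simp [TwoGrading.autAct, 𝔤.br_restr]

theorem TwoGrading.codiff₂_autAct_eq_zero {ψ : 𝔤.W} (h : 𝔤.codiff₂ ψ = 0) :
    𝔤.codiff₂ (𝔤.autAct φ hφ ψ) = 0 := by
  refine Prod.ext (LinearMap.ext fun x => ?_) (LinearMap.ext fun x => ?_)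
  · rw [codiff₂_autAct_fst, h]; simp
  · rw [codiff₂_autAct_snd, h]; simp

/-- An automorphism fixes `k`, so equivariance of `∂*` carries the affine condition `∂*(k - l) = 0`
to itself. -/
theorem TwoGrading.codiff₂_k_sub_autAct {l : 𝔤.W} (h : 𝔤.codiff₂ (𝔤.k - l) = 0) :
    𝔤.codiff₂ (𝔤.k - 𝔤.autAct φ hφ l) = 0 := by
  have := 𝔤.codiff₂_autAct_eq_zero φ hφ h
  rwa [TwoGrading.autAct, AltMaps.act_sub, ← TwoGrading.autAct, 𝔤.autAct_k] at this

omit [LieAlgebra.IsSemisimple ℝ L] in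
theorem TwoGrading.autAct_symm_autAct (l : 𝔤.W) :
    𝔤.autAct φ hφ (𝔤.autAct φ.symm (𝔤.symm_mem φ hφ) l) = l := by
  ext x y
  simp only [autAct, AltMaps.toBilin_act, LinearEquiv.coe_coe, coe_restr_symm]
  have : ∀ z : 𝔤.piece (-1), 𝔤.restr φ.symm (𝔤.symm_mem φ hφ) (-1) (𝔤.restr φ hφ (-1) z) = z :=
    fun z => Subtype.ext (by simp)
  simp only [this]
  exact φ.symm_apply_apply _

/-- Conjugating `t` by `φ` matches the tangent space of the orbit at `l` with that at `l·φ`, and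
`ker ∂*` is invariant. Hence a decomposition of `w·φ⁻¹` at `l` is carried to one of `w` at `l·φ`. -/
theorem TwoGrading.isTransverse_autAct {l : 𝔤.W} (h : 𝔤.IsTransverse l) :
    𝔤.IsTransverse (𝔤.autAct φ hφ l) := by
  rw [TwoGrading.IsTransverse, eq_top_iff]
  intro w _
  have hw : 𝔤.autAct φ.symm (𝔤.symm_mem φ hφ) w ∈
    LinearMap.range (𝔤.orbitDeriv l) ⊔ LinearMap.ker 𝔤.codiff₂ := by rw [h]; trivial
  obtain ⟨_, ⟨t, rfl⟩, z, hz, hsum⟩ := Submodule.mem_sup.1 hw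
  refine Submodule.mem_sup.2 ⟨_, ⟨((𝔤.restr φ hφ (-1)).symm.toLinearMap ∘ₗ t.1 ∘ₗ
    (𝔤.restr φ hφ (-1)).toLinearMap, (𝔤.restr φ hφ (-2)).symm.toLinearMap ∘ₗ t.2 ∘ₗ
    (𝔤.restr φ hφ (-2)).toLinearMap), rfl⟩, 𝔤.autAct φ hφ z,
    𝔤.codiff₂_autAct_eq_zero φ hφ hz, ?_⟩
  have h2 := congrArg (𝔤.autAct φ hφ) hsum
  rw [𝔤.autAct_symm_autAct] at h2
  rw [← h2]
  ext x y : 2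
  simp [orbitDeriv_apply, autAct]

end GradedAut

/-! ### The stabiliser in the Lie algebra -/

section Stabiliser

variable {L : Type*} [LieRing L] [LieAlgebra ℝ L] [FiniteDimensional ℝ L]
  [LieAlgebra.IsSemisimple ℝ L] (𝔤 : TwoGrading L)

omit [FiniteDimensional ℝ L] [LieAlgebra.IsSemisimple ℝ L] in
theorem TwoGrading.induction_piece {p : L → Prop} (h : ∀ i, ∀ x ∈ 𝔤.piece i, p x)
    (h0 : p 0) (hadd : ∀ x y, p x → p y → p (x + y)) (x : L) : p x := by
  have hx : x ∈ ⨆ i, 𝔤.piece i := by rw [𝔤.isInternal.submodule_iSup_eq_top]; trivial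
  exact Submodule.iSup_induction 𝔤.piece (motive := p) hx h h0 hadd

theorem TwoGrading.eq_zero_of_killingForm {i : ℤ} {x : L} (hx : x ∈ 𝔤.piece i)
    (h : ∀ y ∈ 𝔤.piece (-i), killingForm ℝ L x y = 0) : x = 0 := by
  have : (⟨x, hx⟩ : 𝔤.piece i) = 0 := by
    apply 𝔤.killingPairing_injective i
    rw [map_zero]
    exact LinearMap.ext fun y => h y y.2
  exact congrArg Subtype.val this

/-- The ideal of elements of `𝔤₀` that act trivially on the pieces of nonzero degree. -/
def TwoGrading.trivialIdeal : LieIdeal ℝ L where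
  carrier := {A | A ∈ 𝔤.piece 0 ∧ ∀ j : ℤ, j ≠ 0 → ∀ y ∈ 𝔤.piece j, ⁅y, A⁆ = 0}
  add_mem' := fun {A B} hA hB => ⟨add_mem hA.1 hB.1, fun j hj y hy => by
    rw [lie_add, hA.2 j hj y hy, hB.2 j hj y hy, add_zero]⟩
  zero_mem' := ⟨zero_mem _, fun j hj y hy => lie_zero y⟩
  smul_mem' := fun c A hA => ⟨Submodule.smul_mem _ c hA.1, fun j hj y hy => by
    rw [lie_smul, hA.2 j hj y hy, smul_zero]⟩
  lie_mem := by
    rintro x A ⟨hA, hA'⟩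
    change ⁅x, A⁆ ∈ 𝔤.piece 0 ∧ ∀ j : ℤ, j ≠ 0 → ∀ y ∈ 𝔤.piece j, ⁅y, ⁅x, A⁆⁆ = 0
    refine 𝔤.induction_piece (p := fun x => ⁅x, A⁆ ∈ 𝔤.piece 0 ∧
      ∀ j : ℤ, j ≠ 0 → ∀ y ∈ 𝔤.piece j, ⁅y, ⁅x, A⁆⁆ = 0) ?_ ?_ ?_ x
    · intro i x hx
      -- For `x` of degree zero the Jacobi identity applies and `[y, x]` keeps the degree of `y`;
      -- for `x` of nonzero degree `[x, A]` already vanishes.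
      by_cases hi : i = 0
      · subst hi
        refine ⟨by simpa using 𝔤.lie_mem 0 0 x A hx hA, fun j hj y hy => ?_⟩
        rw [leibniz_lie, hA' j hj y hy, lie_zero, add_zero]
        refine hA' j hj _ ?_
        simpa using 𝔤.lie_mem j 0 y x hy hx
      · rw [hA' i hi x hx]
        exact ⟨zero_mem _, fun j hj y hy => lie_zero y⟩
    · simp
    · rintro x y ⟨h1, h2⟩ ⟨h3, h4⟩
      rw [add_lie]
      exact ⟨add_mem h1 h3, fun j hj z hz => by
        rw [lie_add, h2 j hj z hz, h4 j hj z hz, add_zero]⟩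

/-- `𝔤₀` acts faithfully on `𝔤₋ = 𝔤₋₂ ⊕ 𝔤₋₁`. -/
theorem TwoGrading.eq_zero_of_lie_eq_zero {A : L} (hA : A ∈ 𝔤.piece 0)
    (h1 : ∀ x ∈ 𝔤.piece (-1), ⁅A, x⁆ = 0) (h2 : ∀ x ∈ 𝔤.piece (-2), ⁅A, x⁆ = 0) : A = 0 := by
  -- The pairing `𝔤ᵢ × 𝔤₋ᵢ → ℝ` is nondegenerate and invariant, so triviality of `ad A` on `𝔤₋ᵢ`
  -- passes to `𝔤ᵢ`.
  have hpos : ∀ i : ℤ, (∀ x ∈ 𝔤.piece (-i), ⁅A, x⁆ = 0) → ∀ x ∈ 𝔤.piece i, ⁅A, x⁆ = 0 := by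
    intro i hi x hx
    have hmem : ⁅A, x⁆ ∈ 𝔤.piece i := by simpa using 𝔤.lie_mem 0 i A x hA hx
    refine 𝔤.eq_zero_of_killingForm hmem fun y hy => ?_
    have h3 : killingForm ℝ L ⁅x, A⁆ y = killingForm ℝ L x ⁅A, y⁆ :=
      LieModule.traceForm_apply_lie_apply ℝ L L x A y
    rw [hi y hy, map_zero] at h3
    rw [← lie_skew, map_neg, LinearMap.neg_apply, h3, neg_zero]
  have hmem : A ∈ 𝔤.trivialIdeal := by
    refine ⟨hA, fun j hj y hy => ?_⟩
    rw [← lie_skew, neg_eq_zero]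
    by_cases hj2 : 2 < |j|
    · rw [𝔤.eq_bot j hj2, Submodule.mem_bot] at hy
      rw [hy, lie_zero]
    have hle := abs_le.1 (not_lt.1 hj2)
    obtain ⟨ha, hb⟩ := hle
    have : j = -2 ∨ j = -1 ∨ j = 1 ∨ j = 2 := by omega
    rcases this with rfl | rfl | rfl | rfl
    · exact h2 y hy
    · exact h1 y hy
    · exact hpos 1 h1 y hy
    · exact hpos 2 h2 y hy
  -- A nonzero ideal inside `𝔤₀` would contain an atom of the lattice of ideals, that is, a simple
  -- ideal.
  by_contra hne
  have hbot : 𝔤.trivialIdeal ≠ ⊥ := by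
    intro h
    rw [h] at hmem
    exact hne ((LieSubmodule.mem_bot A).1 hmem)
  obtain ⟨I, hI, hle⟩ := (IsAtomic.eq_bot_or_exists_atom_le 𝔤.trivialIdeal).resolve_left hbot
  exact 𝔤.no_simple_ideal I hI fun x hx => (hle hx).1

/-- The infinitesimal right action of `𝔤₀` on `𝔤₋`, in the coordinates of `𝔰` used by
`AltMaps.act`. -/
noncomputable def TwoGrading.adZero : 𝔤.piece 0 →ₗ[ℝ] 𝔤.𝔰 :=
  -- The right action on `W` applies `φ` to the arguments and `φ⁻¹` to the value; the minus sign is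
  -- the derivative of that inverse.
  LinearMap.prod (𝔤.br 0 (-1) (-1) (by norm_num)) (-(𝔤.br 0 (-2) (-2) (by norm_num)))

theorem TwoGrading.adZero_injective : Function.Injective 𝔤.adZero := by
  rw [injective_iff_map_eq_zero]
  intro A hA
  refine Subtype.ext (𝔤.eq_zero_of_lie_eq_zero A.2 (fun x hx => ?_) (fun x hx => ?_))
  · have := LinearMap.congr_fun (congrArg Prod.fst hA) ⟨x, hx⟩
    exact congrArg Subtype.val this
  · have := LinearMap.congr_fun (congrArg Prod.snd hA) ⟨x, hx⟩
    exact neg_eq_zero.1 (congrArg Subtype.val this)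

/-- If `H¹(𝔤¹, 𝔤)₀ = 0`, then at a transverse `l` whose stabiliser contains `𝔤₀` infinitesimally,
that stabiliser is `𝔤₀`. -/
theorem TwoGrading.ker_codiff₂_orbitDeriv (hcoh : Subsingleton 𝔤.H1Zero) {l : 𝔤.W}
    (hl : 𝔤.IsTransverse l)
    (hle : LinearMap.range 𝔤.adZero ≤ LinearMap.ker (𝔤.codiff₂ ∘ₗ 𝔤.orbitDeriv l)) :
    LinearMap.ker (𝔤.codiff₂ ∘ₗ 𝔤.orbitDeriv l) = LinearMap.range 𝔤.adZero := by
  refine (Submodule.eq_of_le_of_finrank_le hle ?_).symm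
  -- Transversality: `W` is the sum of the image of `D_l` and `ker ∂*`, so restricting `∂*` to the
  -- former loses nothing of its image.
  have hrange : LinearMap.range (𝔤.codiff₂ ∘ₗ 𝔤.orbitDeriv l) = LinearMap.range 𝔤.codiff₂ := by
    rw [LinearMap.range_comp, LinearMap.range_eq_map 𝔤.codiff₂, ← hl, Submodule.map_sup]
    have : Submodule.map 𝔤.codiff₂ (LinearMap.ker 𝔤.codiff₂) = ⊥ := by
      exact (Submodule.eq_bot_iff _).2 (by rintro _ ⟨y, hy, rfl⟩; exact hy)
    rw [this, sup_bot_eq]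
  have hker : LinearMap.ker 𝔤.codiff₁ ≤ LinearMap.range 𝔤.codiff₂ := by
    have := (Submodule.Quotient.subsingleton_iff).1 hcoh
    exact Submodule.submoduleOf_eq_top.1 this
  -- Dimension count: `dim ker (∂* D_l) = dim 𝔰 - rank ∂*₂ ≤ dim 𝔰 - dim ker ∂*₁ = rank ∂*₁ ≤ dim
  -- 𝔤₀`, and `dim 𝔤₀` is the rank of the injective `adZero`. Only `ker ∂*₁ ⊆ im ∂*₂` is used, not
  -- `∂* ∂* = 0`.
  have e1 := LinearMap.finrank_range_add_finrank_ker (𝔤.codiff₂ ∘ₗ 𝔤.orbitDeriv l)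
  have e2 := LinearMap.finrank_range_add_finrank_ker 𝔤.codiff₁
  have e3 := Submodule.finrank_mono hker
  have e4 := Submodule.finrank_le (LinearMap.range 𝔤.codiff₁)
  have e5 := LinearMap.finrank_range_of_inj 𝔤.adZero_injective
  rw [hrange] at e1
  omega

end Stabiliser

/-! ### The adjoint representation of a Lie group -/

section Adjoint

variable {EG : Type*} [NormedAddCommGroup EG] [NormedSpace ℝ EG]
  {G : Type*} [Group G] [TopologicalSpace G] [ChartedSpace EG G]

/-- `Ad g` as a continuous linear map of the model space. -/
noncomputable def adCLM (g : G) : EG →L[ℝ] EG :=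
  mfderiv 𝓘(ℝ, EG) 𝓘(ℝ, EG) (fun h : G => g * h * g⁻¹) 1

theorem Ad_apply (g : G) (v : GroupLieAlgebra 𝓘(ℝ, EG) G) : Ad g v = (adCLM g : EG →L[ℝ] EG) v :=
  rfl

variable [LieGroup 𝓘(ℝ, EG) ∞ G]

theorem contMDiff_conj (g : G) :
    ContMDiff 𝓘(ℝ, EG) 𝓘(ℝ, EG) ∞ (fun h : G => g * h * g⁻¹) :=
  (contMDiff_const.mul contMDiff_id).mul contMDiff_const

theorem mdifferentiableAt_mul_left' (g h : G) :
    MDifferentiableAt 𝓘(ℝ, EG) 𝓘(ℝ, EG) (fun x : G => g * x) h :=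
  (contMDiff_const.mul contMDiff_id :
    ContMDiff 𝓘(ℝ, EG) 𝓘(ℝ, EG) ∞ (fun x : G => g * x)).mdifferentiableAt (by simp)

theorem mdifferentiableAt_mul_right' (g h : G) :
    MDifferentiableAt 𝓘(ℝ, EG) 𝓘(ℝ, EG) (fun x : G => x * g) h :=
  (contMDiff_id.mul contMDiff_const :
    ContMDiff 𝓘(ℝ, EG) 𝓘(ℝ, EG) ∞ (fun x : G => x * g)).mdifferentiableAt (by simp)

theorem mdifferentiableAt_conj (g h : G) :
    MDifferentiableAt 𝓘(ℝ, EG) 𝓘(ℝ, EG) (fun h : G => g * h * g⁻¹) h :=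
  (contMDiff_conj g).mdifferentiableAt (by simp)

theorem hasMFDerivAt_conj_one (g : G) : HasMFDerivAt 𝓘(ℝ, EG) 𝓘(ℝ, EG)
    (fun h : G => g * h * g⁻¹) 1 (adCLM g : EG →L[ℝ] EG) :=
  (mdifferentiableAt_conj g 1).hasMFDerivAt

theorem hasMFDerivAt_comp_conj_one {f : G → G} (g : G) {f' : EG →L[ℝ] EG}
    (hf : HasMFDerivAt 𝓘(ℝ, EG) 𝓘(ℝ, EG) f 1 f') :
    HasMFDerivAt 𝓘(ℝ, EG) 𝓘(ℝ, EG) (f ∘ fun h : G => g * h * g⁻¹) 1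
      (f'.comp (adCLM g : EG →L[ℝ] EG)) := by
  have h1 : g * 1 * g⁻¹ = 1 := by group
  refine HasMFDerivAt.comp (1 : G) (g := f) (g' := f') ?_ (hasMFDerivAt_conj_one g)
  rw [h1]
  exact hf

theorem adCLM_mul (g h : G) :
    (adCLM (g * h) : EG →L[ℝ] EG) = (adCLM g : EG →L[ℝ] EG).comp (adCLM h) := by
  have h1 := hasMFDerivAt_comp_conj_one h (hasMFDerivAt_conj_one (EG := EG) g)
  have h2 : ((fun x : G => g * x * g⁻¹) ∘ fun x : G => h * x * h⁻¹) =
      fun x : G => (g * h) * x * (g * h)⁻¹ := by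
    funext x; simp only [Function.comp]; group
  rw [h2] at h1
  exact h1.mfderiv

omit [LieGroup 𝓘(ℝ, EG) ∞ G] in
theorem adCLM_one : (adCLM (1 : G) : EG →L[ℝ] EG) = ContinuousLinearMap.id ℝ EG := by
  have h1 : (fun x : G => 1 * x * (1 : G)⁻¹) = id := by funext x; simp
  have h2 : HasMFDerivAt 𝓘(ℝ, EG) 𝓘(ℝ, EG) (fun x : G => 1 * x * (1 : G)⁻¹) 1
    (ContinuousLinearMap.id ℝ EG) := by rw [h1]; exact hasMFDerivAt_id (1 : G)
  exact h2.mfderiv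

theorem adCLM_inv_apply (g : G) (v : EG) : (adCLM g⁻¹ : EG →L[ℝ] EG) (adCLM g v) = v := by
  have h := congrArg (fun f : EG →L[ℝ] EG => f v) (adCLM_mul (EG := EG) g⁻¹ g)
  simp only [inv_mul_cancel, adCLM_one] at h
  exact h.symm

theorem adCLM_apply_inv (g : G) (v : EG) : (adCLM g : EG →L[ℝ] EG) (adCLM g⁻¹ v) = v := by
  have := adCLM_inv_apply g⁻¹ v
  rwa [inv_inv] at this

/-- The derivative at `1` of left translation. -/
noncomputable def leftCLM (g : G) : EG →L[ℝ] EG :=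
  mfderiv 𝓘(ℝ, EG) 𝓘(ℝ, EG) (fun x : G => g * x) 1

/-- The derivative at `1` of right translation. -/
noncomputable def rightCLM (g : G) : EG →L[ℝ] EG :=
  mfderiv 𝓘(ℝ, EG) 𝓘(ℝ, EG) (fun x : G => x * g) 1

theorem hasMFDerivAt_mul_left_one (g : G) : HasMFDerivAt 𝓘(ℝ, EG) 𝓘(ℝ, EG)
    (fun x : G => g * x) 1 (leftCLM g : EG →L[ℝ] EG) :=
  (mdifferentiableAt_mul_left' g 1).hasMFDerivAt

theorem hasMFDerivAt_mul_right_one (g : G) : HasMFDerivAt 𝓘(ℝ, EG) 𝓘(ℝ, EG)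
    (fun x : G => x * g) 1 (rightCLM g : EG →L[ℝ] EG) :=
  (mdifferentiableAt_mul_right' g 1).hasMFDerivAt

/-- Right translation turns `Ad g` into left translation. -/
theorem rightCLM_comp_adCLM (g : G) :
    (rightCLM g : EG →L[ℝ] EG).comp (adCLM g) = leftCLM g := by
  have h1 := hasMFDerivAt_comp_conj_one g (hasMFDerivAt_mul_right_one (EG := EG) g)
  have h2 : ((fun x : G => x * g) ∘ fun x : G => g * x * g⁻¹) = fun x : G => g * x := by
    funext x; simp
  rw [h2] at h1
  exact h1.mfderiv.symm

/-- Differentiate at `1` the identity `c_g ∘ L_h = L_{c_g h} ∘ c_g`, which holds because conjugation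
`c_g` is a homomorphism. -/
theorem mfderiv_conj_mulInvariantVectorField (g h : G) (v : GroupLieAlgebra 𝓘(ℝ, EG) G) :
    mfderiv 𝓘(ℝ, EG) 𝓘(ℝ, EG) (fun x : G => g * x * g⁻¹) h (mulInvariantVectorField v h) =
      mulInvariantVectorField (I := 𝓘(ℝ, EG)) (G := G) (Ad g v) (g * h * g⁻¹) := by
  have h1 := hasMFDerivAt_comp_conj_one g
    (hasMFDerivAt_mul_left_one (EG := EG) (g * h * g⁻¹))
  have h2 : ((fun x : G => (g * h * g⁻¹) * x) ∘ fun x : G => g * x * g⁻¹) =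
      (fun x : G => g * x * g⁻¹) ∘ (fun x : G => h * x) := by
    funext x; simp only [Function.comp]; group
  rw [h2] at h1
  have h3 : HasMFDerivAt 𝓘(ℝ, EG) 𝓘(ℝ, EG) ((fun x : G => g * x * g⁻¹) ∘ (fun x : G => h * x)) 1
      ((mfderiv 𝓘(ℝ, EG) 𝓘(ℝ, EG) (fun x : G => g * x * g⁻¹) (h * 1)).comp
        (mfderiv 𝓘(ℝ, EG) 𝓘(ℝ, EG) (fun x : G => h * x) 1)) :=
    HasMFDerivAt.comp (1 : G) (mdifferentiableAt_conj g (h * 1)).hasMFDerivAt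
      (mdifferentiableAt_mul_left' h 1).hasMFDerivAt
  have h4 := congrArg (fun f : EG →L[ℝ] EG => f v) (h3.mfderiv.symm.trans h1.mfderiv)
  rw [mul_one] at h4
  exact h4

variable [FiniteDimensional ℝ EG]

/-- Conjugation by `g` relates the left-invariant field of `v` to that of `Ad g v`, and brackets of
vector fields are natural under pullback; evaluate at the unit, which conjugation fixes. -/
theorem Ad_lie (g : G) (v w : GroupLieAlgebra 𝓘(ℝ, EG) G) : Ad g ⁅v, w⁆ = ⁅Ad g v, Ad g w⁆ := by
  have : CompleteSpace EG := FiniteDimensional.complete ℝ EG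
  have h1 : g * 1 * g⁻¹ = 1 := by group
  -- The pullback of vector fields uses the inverse of the derivative. It exists because conjugation
  -- by `g⁻¹` inverts conjugation by `g`.
  have hinv : ∀ h : G, (mfderiv 𝓘(ℝ, EG) 𝓘(ℝ, EG) (fun x : G => g * x * g⁻¹) h).IsInvertible := by
    intro h
    have key : ∀ a b : G, b * a = 1 → ∀ h : G,
      (mfderiv 𝓘(ℝ, EG) 𝓘(ℝ, EG) (fun x : G => b * x * b⁻¹) (a * h * a⁻¹)).comp
        (mfderiv 𝓘(ℝ, EG) 𝓘(ℝ, EG) (fun x : G => a * x * a⁻¹) h) =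
          ContinuousLinearMap.id ℝ EG := by
      intro a b hab h
      have h3 := HasMFDerivAt.comp h (mdifferentiableAt_conj (EG := EG) b (a * h * a⁻¹)).hasMFDerivAt
        (mdifferentiableAt_conj a h).hasMFDerivAt
      have h2 : ((fun x : G => b * x * b⁻¹) ∘ fun x : G => a * x * a⁻¹) = id := by
        funext x
        have : b * (a * x * a⁻¹) * b⁻¹ = (b * a) * x * (b * a)⁻¹ := by group
        simp only [Function.comp, this, hab]; simp
      rw [h2] at h3
      exact h3.mfderiv.symm.trans (hasMFDerivAt_id h).mfderiv
    refine ContinuousLinearMap.IsInvertible.of_inverse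
      (g := (mfderiv 𝓘(ℝ, EG) 𝓘(ℝ, EG) (fun x : G => g⁻¹ * x * g⁻¹⁻¹) (g * h * g⁻¹) :
        EG →L[ℝ] EG)) ?_ ?_
    · have := key g⁻¹ g (by simp) (g * h * g⁻¹)
      have h5 : g⁻¹ * (g * h * g⁻¹) * g⁻¹⁻¹ = h := by group
      rw [h5] at this
      exact this
    · exact key g g⁻¹ (by simp) h
  have hpull : ∀ v : GroupLieAlgebra 𝓘(ℝ, EG) G,
      VectorField.mpullback 𝓘(ℝ, EG) 𝓘(ℝ, EG) (fun x : G => g * x * g⁻¹)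
        (mulInvariantVectorField (Ad g v)) = mulInvariantVectorField v := by
    intro v
    funext h
    rw [VectorField.mpullback_apply, ← mfderiv_conj_mulInvariantVectorField]
    obtain ⟨e, he⟩ := hinv h
    rw [← he, ContinuousLinearMap.inverse_equiv]
    exact e.symm_apply_apply _
  have h := VectorField.mpullback_mlieBracket (I := 𝓘(ℝ, EG)) (I' := 𝓘(ℝ, EG)) (n := ∞)
    (f := fun x : G => g * x * g⁻¹) (x₀ := 1)
    (V := mulInvariantVectorField (Ad g v)) (W := mulInvariantVectorField (Ad g w))
    (mdifferentiableAt_mulInvariantVectorField _) (mdifferentiableAt_mulInvariantVectorField _)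
    (contMDiff_conj g).contMDiffAt
    (by rw [minSmoothness_of_isRCLikeNormedField]; exact ENat.LEInfty.out)
  rw [hpull, hpull, VectorField.mpullback_apply] at h
  obtain ⟨e, he⟩ := hinv 1
  rw [GroupLieAlgebra.bracket_def, GroupLieAlgebra.bracket_def, ← h, ← he,
    ContinuousLinearMap.inverse_equiv]
  have h6 : ∀ z, Ad g z = e z := fun z => by
    rw [Ad_apply]; exact congrArg (fun f : EG →L[ℝ] EG => f z) he.symm
  rw [h6]
  refine (e.apply_symm_apply _).trans ?_
  rw [h1]

/-- `Ad g` as an automorphism of the Lie algebra. -/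
noncomputable def adEquiv (g : G) :
    GroupLieAlgebra 𝓘(ℝ, EG) G ≃ₗ⁅ℝ⁆ GroupLieAlgebra 𝓘(ℝ, EG) G where
  toFun := Ad g
  map_add' := map_add _
  map_smul' := map_smul _
  map_lie' := Ad_lie g _ _
  invFun := Ad g⁻¹
  left_inv v := adCLM_inv_apply (EG := EG) g v
  right_inv v := adCLM_apply_inv (EG := EG) g v

end Adjoint

/-! ### The differential of `Ad` at the unit is `ad`. -/

section AdjointDeriv

variable {EG : Type*} [NormedAddCommGroup EG] [NormedSpace ℝ EG]
  {G : Type*} [Group G] [TopologicalSpace G] [ChartedSpace EG G]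

variable (EG G) in
/-- The multiplication of `G` in the chart around `1`. -/
noncomputable def chartMul (p : EG × EG) : EG :=
  extChartAt 𝓘(ℝ, EG) (1 : G)
    ((extChartAt 𝓘(ℝ, EG) (1 : G)).symm p.1 * (extChartAt 𝓘(ℝ, EG) (1 : G)).symm p.2)

variable (EG G) in
/-- The unit of `G` in the chart around `1`. -/
noncomputable def chartOne : EG := extChartAt 𝓘(ℝ, EG) (1 : G) 1

theorem extChartAt_symm_chartOne : (extChartAt 𝓘(ℝ, EG) (1 : G)).symm (chartOne EG G) = 1 :=
  extChartAt_to_inv 1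

variable [LieGroup 𝓘(ℝ, EG) ∞ G]

theorem contDiffAt_chartMul :
    ContDiffAt ℝ ∞ (chartMul EG G) (chartOne EG G, chartOne EG G) := by
  rw [← contMDiffAt_iff_contDiffAt]
  have hs : ContMDiffAt 𝓘(ℝ, EG) 𝓘(ℝ, EG) ∞ (extChartAt 𝓘(ℝ, EG) (1 : G)).symm
      (chartOne EG G) :=
    (contMDiffOn_extChartAt_symm (1 : G)).contMDiffAt (extChartAt_target_mem_nhds (1 : G))
  have h1 : ContMDiffAt 𝓘(ℝ, EG × EG) 𝓘(ℝ, EG) ∞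
      (fun p : EG × EG => (extChartAt 𝓘(ℝ, EG) (1 : G)).symm p.1) (chartOne EG G, chartOne EG G) :=
    hs.comp (chartOne EG G, chartOne EG G) contDiffAt_fst.contMDiffAt
  have h2 : ContMDiffAt 𝓘(ℝ, EG × EG) 𝓘(ℝ, EG) ∞
      (fun p : EG × EG => (extChartAt 𝓘(ℝ, EG) (1 : G)).symm p.2) (chartOne EG G, chartOne EG G) :=
    hs.comp (chartOne EG G, chartOne EG G) contDiffAt_snd.contMDiffAt
  have h3 := h1.mul h2
  refine ContMDiffAt.comp (chartOne EG G, chartOne EG G) (I' := 𝓘(ℝ, EG))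
    (g := extChartAt 𝓘(ℝ, EG) (1 : G)) ?_ h3
  simp only [extChartAt_symm_chartOne, mul_one]
  exact contMDiffAt_extChartAt

omit [LieGroup 𝓘(ℝ, EG) ∞ G] in
theorem eventually_mem_target : ∀ᶠ x in 𝓝 (chartOne EG G),
    x ∈ (extChartAt 𝓘(ℝ, EG) (1 : G)).target :=
  extChartAt_target_mem_nhds (1 : G)

theorem hasMFDerivAt_extChartAt_symm_one : HasMFDerivAt 𝓘(ℝ, EG) 𝓘(ℝ, EG)
    (extChartAt 𝓘(ℝ, EG) (1 : G)).symm (chartOne EG G) (ContinuousLinearMap.id ℝ EG) := by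
  have : IsManifold 𝓘(ℝ, EG) 1 G := IsManifold.of_le (n := ∞) (by simp)
  have h1 := (mdifferentiableWithinAt_extChartAt_symm (I := 𝓘(ℝ, EG))
    (mem_extChartAt_target (1 : G))).hasMFDerivWithinAt
  rw [mfderivWithin_range_extChartAt_symm, show range 𝓘(ℝ, EG) = univ by simp] at h1
  exact hasMFDerivWithinAt_univ.1 h1

variable (EG) in
/-- The derivative of the chart around `1`. -/
noncomputable def chartDeriv (g : G) : EG →L[ℝ] EG :=
  mfderiv 𝓘(ℝ, EG) 𝓘(ℝ, EG) (extChartAt 𝓘(ℝ, EG) (1 : G)) g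

theorem chartDeriv_one : chartDeriv EG (1 : G) = ContinuousLinearMap.id ℝ EG := by
  have : IsManifold 𝓘(ℝ, EG) 1 G := IsManifold.of_le (n := ∞) (by simp)
  exact mfderiv_extChartAt_self

/-- Translations in the chart around `1`. -/
theorem fderiv_chart_of_hasMFDerivAt {f : G → G} {f' : EG →L[ℝ] EG}
    (hf : HasMFDerivAt 𝓘(ℝ, EG) 𝓘(ℝ, EG) f 1 f')
    (hmem : f 1 ∈ (extChartAt 𝓘(ℝ, EG) (1 : G)).source) :
    fderiv ℝ (fun y => extChartAt 𝓘(ℝ, EG) (1 : G) (f ((extChartAt 𝓘(ℝ, EG) (1 : G)).symm y)))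
      (chartOne EG G) =
      (chartDeriv EG (f 1)).comp f' := by
  have : IsManifold 𝓘(ℝ, EG) 1 G := IsManifold.of_le (n := ∞) (by simp)
  have h1 : HasMFDerivAt 𝓘(ℝ, EG) 𝓘(ℝ, EG)
      (f ∘ (extChartAt 𝓘(ℝ, EG) (1 : G)).symm) (chartOne EG G) f' := by
    refine HasMFDerivAt.comp (g' := f') (chartOne EG G) ?_ hasMFDerivAt_extChartAt_symm_one
    rw [extChartAt_symm_chartOne]
    exact hf
  have h2 : HasMFDerivAt 𝓘(ℝ, EG) 𝓘(ℝ, EG) (extChartAt 𝓘(ℝ, EG) (1 : G)) (f 1)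
      (chartDeriv EG (f 1)) :=
    (mdifferentiableAt_extChartAt (by rwa [extChartAt_source] at hmem)).hasMFDerivAt
  have h3 : HasMFDerivAt 𝓘(ℝ, EG) 𝓘(ℝ, EG) ((extChartAt 𝓘(ℝ, EG) (1 : G)) ∘
      (f ∘ (extChartAt 𝓘(ℝ, EG) (1 : G)).symm)) (chartOne EG G)
      ((chartDeriv EG (f 1)).comp f') := by
    refine HasMFDerivAt.comp (chartOne EG G) (g' := chartDeriv EG (f 1)) ?_ h1
    rw [Function.comp_apply, extChartAt_symm_chartOne]
    exact h2
  have h4 : HasFDerivAt (𝕜 := ℝ) ((extChartAt 𝓘(ℝ, EG) (1 : G)) ∘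
      (f ∘ (extChartAt 𝓘(ℝ, EG) (1 : G)).symm)) ((chartDeriv EG (f 1)).comp f')
      (chartOne EG G) := hasMFDerivAt_iff_hasFDerivAt.1 h3
  exact h4.fderiv

variable (EG G) in
/-- The derivative at the unit of left translations in the chart around `1`. -/
noncomputable def chartLeft (x : EG) : EG →L[ℝ] EG :=
  fderiv ℝ (fun y => chartMul EG G (x, y)) (chartOne EG G)

variable (EG G) in
/-- The derivative at the unit of right translations in the chart around `1`. -/
noncomputable def chartRight (x : EG) : EG →L[ℝ] EG :=
  fderiv ℝ (fun y => chartMul EG G (y, x)) (chartOne EG G)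

theorem chartLeft_eq {x : EG} (hx : x ∈ (extChartAt 𝓘(ℝ, EG) (1 : G)).target) :
    chartLeft EG G x = (chartDeriv EG ((extChartAt 𝓘(ℝ, EG) (1 : G)).symm x)).comp
      (leftCLM ((extChartAt 𝓘(ℝ, EG) (1 : G)).symm x)) := by
  have h := fderiv_chart_of_hasMFDerivAt
    (hasMFDerivAt_mul_left_one (EG := EG) ((extChartAt 𝓘(ℝ, EG) (1 : G)).symm x))
    (by simpa using (extChartAt 𝓘(ℝ, EG) (1 : G)).map_target hx)
  simp only [mul_one] at h
  exact h

theorem chartRight_eq {x : EG} (hx : x ∈ (extChartAt 𝓘(ℝ, EG) (1 : G)).target) :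
    chartRight EG G x = (chartDeriv EG ((extChartAt 𝓘(ℝ, EG) (1 : G)).symm x)).comp
      (rightCLM ((extChartAt 𝓘(ℝ, EG) (1 : G)).symm x)) := by
  have h := fderiv_chart_of_hasMFDerivAt
    (hasMFDerivAt_mul_right_one (EG := EG) ((extChartAt 𝓘(ℝ, EG) (1 : G)).symm x))
    (by simpa using (extChartAt 𝓘(ℝ, EG) (1 : G)).map_target hx)
  simp only [one_mul] at h
  exact h

/-- The chart contributes the same factor to both translations, so `R_g ∘ Ad g = L_g` survives in
coordinates. It expresses `Ad` through the derivatives of the multiplication, as `R⁻¹ L`. -/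
theorem chartRight_comp_adCLM {x : EG} (hx : x ∈ (extChartAt 𝓘(ℝ, EG) (1 : G)).target) :
    (chartRight EG G x).comp (adCLM ((extChartAt 𝓘(ℝ, EG) (1 : G)).symm x)) =
      chartLeft EG G x := by
  rw [chartRight_eq hx, chartLeft_eq hx, ← rightCLM_comp_adCLM, ContinuousLinearMap.comp_assoc]

theorem eventually_differentiableAt_chartMul : ∀ᶠ p in 𝓝 (chartOne EG G, chartOne EG G),
    DifferentiableAt ℝ (chartMul EG G) p :=
  ((contDiffAt_chartMul (EG := EG) (G := G)).of_le (m := 1) (by simp)).eventually (by simp) |>.mono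
    fun _ h => h.differentiableAt (by simp)

theorem chartLeft_eventuallyEq : chartLeft EG G =ᶠ[𝓝 (chartOne EG G)] fun x =>
    (fderiv ℝ (chartMul EG G) (x, chartOne EG G)).comp (ContinuousLinearMap.inr ℝ EG EG) := by
  have hc : Tendsto (fun x : EG => (x, chartOne EG G)) (𝓝 (chartOne EG G))
    (𝓝 (chartOne EG G, chartOne EG G)) := (Continuous.prodMk_left _).tendsto _
  filter_upwards [hc.eventually eventually_differentiableAt_chartMul] with x hx
  exact (hx.hasFDerivAt.comp (chartOne EG G) (hasFDerivAt_prodMk_right x (chartOne EG G))).fderiv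

theorem chartRight_eventuallyEq : chartRight EG G =ᶠ[𝓝 (chartOne EG G)] fun x =>
    (fderiv ℝ (chartMul EG G) (chartOne EG G, x)).comp (ContinuousLinearMap.inl ℝ EG EG) := by
  have hc : Tendsto (fun x : EG => (chartOne EG G, x)) (𝓝 (chartOne EG G))
    (𝓝 (chartOne EG G, chartOne EG G)) := (Continuous.prodMk_right _).tendsto _
  filter_upwards [hc.eventually eventually_differentiableAt_chartMul] with x hx
  exact (hx.hasFDerivAt.comp (chartOne EG G) (hasFDerivAt_prodMk_left (𝕜 := ℝ) (chartOne EG G) x)).fderiv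

theorem chartLeft_one : chartLeft EG G (chartOne EG G) = ContinuousLinearMap.id ℝ EG := by
  rw [chartLeft_eq eventually_mem_target.self_of_nhds, extChartAt_symm_chartOne,
    chartDeriv_one]
  have h : (fun x : G => 1 * x) = id := by funext x; simp
  have h2 : HasMFDerivAt 𝓘(ℝ, EG) 𝓘(ℝ, EG) (fun x : G => 1 * x) 1
    (ContinuousLinearMap.id ℝ EG) := by rw [h]; exact hasMFDerivAt_id (1 : G)
  exact h2.mfderiv

theorem chartRight_one : chartRight EG G (chartOne EG G) = ContinuousLinearMap.id ℝ EG := by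
  rw [chartRight_eq eventually_mem_target.self_of_nhds, extChartAt_symm_chartOne,
    chartDeriv_one]
  have h : (fun x : G => x * 1) = id := by funext x; simp
  have h2 : HasMFDerivAt 𝓘(ℝ, EG) 𝓘(ℝ, EG) (fun x : G => x * 1) 1
    (ContinuousLinearMap.id ℝ EG) := by rw [h]; exact hasMFDerivAt_id (1 : G)
  exact h2.mfderiv

theorem hasFDerivAt_fderiv_chartMul : HasFDerivAt (fderiv ℝ (chartMul EG G))
    (fderiv ℝ (fderiv ℝ (chartMul EG G)) (chartOne EG G, chartOne EG G))
    (chartOne EG G, chartOne EG G) := by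
  have h := (contDiffAt_chartMul (EG := EG) (G := G)).fderiv_right (m := 1) (by
    rw [one_add_one_eq_two]; exact ENat.LEInfty.out)
  exact (h.differentiableAt (by simp)).hasFDerivAt

theorem differentiableAt_chartLeft : DifferentiableAt ℝ (chartLeft EG G) (chartOne EG G) := by
  refine DifferentiableAt.congr_of_eventuallyEq ?_ chartLeft_eventuallyEq
  refine DifferentiableAt.clm_comp ?_ (differentiableAt_const _)
  exact (hasFDerivAt_fderiv_chartMul.comp (chartOne EG G)
    (hasFDerivAt_prodMk_left (chartOne EG G) (chartOne EG G))).differentiableAt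

theorem differentiableAt_chartRight : DifferentiableAt ℝ (chartRight EG G) (chartOne EG G) := by
  refine DifferentiableAt.congr_of_eventuallyEq ?_ chartRight_eventuallyEq
  refine DifferentiableAt.clm_comp ?_ (differentiableAt_const _)
  exact (hasFDerivAt_fderiv_chartMul.comp (chartOne EG G)
    (hasFDerivAt_prodMk_right (chartOne EG G) (chartOne EG G))).differentiableAt

theorem fderiv_chartLeft_apply (v w : EG) : fderiv ℝ (chartLeft EG G) (chartOne EG G) v w =
    fderiv ℝ (fderiv ℝ (chartMul EG G)) (chartOne EG G, chartOne EG G) (v, 0) (0, w) := by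
  have h := (hasFDerivAt_fderiv_chartMul.comp (chartOne EG G)
    (hasFDerivAt_prodMk_left (𝕜 := ℝ) (chartOne EG G) (chartOne EG G))).clm_comp
      (hasFDerivAt_const (ContinuousLinearMap.inr ℝ EG EG) (chartOne EG G))
  have h' := (h.congr_of_eventuallyEq chartLeft_eventuallyEq).fderiv
  rw [h']
  simp

theorem fderiv_chartRight_apply (v w : EG) : fderiv ℝ (chartRight EG G) (chartOne EG G) v w =
    fderiv ℝ (fderiv ℝ (chartMul EG G)) (chartOne EG G, chartOne EG G) (0, v) (w, 0) := by
  have h := (hasFDerivAt_fderiv_chartMul.comp (chartOne EG G)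
    (hasFDerivAt_prodMk_right (𝕜 := ℝ) (chartOne EG G) (chartOne EG G))).clm_comp
      (hasFDerivAt_const (ContinuousLinearMap.inl ℝ EG EG) (chartOne EG G))
  have h' := (h.congr_of_eventuallyEq chartRight_eventuallyEq).fderiv
  rw [h']
  simp

/-- Both sides are mixed second derivatives of the multiplication at the unit, and second
derivatives are symmetric. -/
theorem fderiv_chartRight_apply_eq (v w : EG) :
    fderiv ℝ (chartRight EG G) (chartOne EG G) v w =
      fderiv ℝ (chartLeft EG G) (chartOne EG G) w v := by
  rw [fderiv_chartRight_apply, fderiv_chartLeft_apply]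
  exact ((contDiffAt_chartMul (EG := EG) (G := G)).isSymmSndFDerivAt
    (by rw [minSmoothness_of_isRCLikeNormedField]; exact ENat.LEInfty.out)).eq _ _

/-- In the chart the left-invariant field of `v` is `x ↦ L(x) v`, with `L = 1` at the unit; the
coordinate formula for the bracket of two such fields is the right-hand side. -/
theorem lie_eq_fderiv_chartLeft (v w : GroupLieAlgebra 𝓘(ℝ, EG) G) :
    ⁅v, w⁆ = (fderiv ℝ (chartLeft EG G) (chartOne EG G) v w -
      fderiv ℝ (chartLeft EG G) (chartOne EG G) w v : EG) := by
  have : IsManifold 𝓘(ℝ, EG) 1 G := IsManifold.of_le (n := ∞) (by simp)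
  have hloc : ∀ v : GroupLieAlgebra 𝓘(ℝ, EG) G,
      (VectorField.mpullbackWithin 𝓘(ℝ, EG) 𝓘(ℝ, EG) (extChartAt 𝓘(ℝ, EG) (1 : G)).symm
        (mulInvariantVectorField v) (range 𝓘(ℝ, EG)) : EG → EG) =ᶠ[𝓝 (chartOne EG G)]
      fun x => chartLeft EG G x v := by
    intro v
    filter_upwards [eventually_mem_target] with x hx
    have h1 := mfderiv_extChartAt_comp_mfderivWithin_extChartAt_symm (I := 𝓘(ℝ, EG)) hx
    have h2 := mfderivWithin_extChartAt_symm_comp_mfderiv_extChartAt (I := 𝓘(ℝ, EG)) hx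
    rw [VectorField.mpullbackWithin_apply, ContinuousLinearMap.inverse_eq h2 h1, chartLeft_eq hx]
    rfl
  have hd : ∀ v : EG, HasFDerivAt (fun x => chartLeft EG G x v)
      ((fderiv ℝ (chartLeft EG G) (chartOne EG G)).flip v) (chartOne EG G) := fun v => by
    have := (differentiableAt_chartLeft (EG := EG) (G := G)).hasFDerivAt.clm_apply
      (hasFDerivAt_const v (chartOne EG G))
    refine this.congr_fderiv ?_
    ext z; simp
  rw [GroupLieAlgebra.bracket_def, ← VectorField.mlieBracketWithin_univ,
    VectorField.mlieBracketWithin_apply, mfderiv_extChartAt_self]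
  rw [preimage_univ, univ_inter]
  have hr : range 𝓘(ℝ, EG) = univ := by simp
  refine (congrArg (fun f : EG →L[ℝ] EG => f _) ContinuousLinearMap.inverse_id).trans ?_
  have key : ∀ V W : EG → EG, V =ᶠ[𝓝 (chartOne EG G)] (fun x => chartLeft EG G x v) →
      W =ᶠ[𝓝 (chartOne EG G)] (fun x => chartLeft EG G x w) →
      VectorField.lieBracketWithin ℝ V W (range 𝓘(ℝ, EG)) (chartOne EG G) =
      fderiv ℝ (chartLeft EG G) (chartOne EG G) v w -
        fderiv ℝ (chartLeft EG G) (chartOne EG G) w v := by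
    intro V W hV hW
    rw [hr, VectorField.lieBracketWithin_univ, hV.lieBracket_vectorField_eq hW,
      VectorField.lieBracket_eq]
    simp only [(hd v).fderiv, (hd w).fderiv, chartLeft_one]
    rfl
  exact key _ _ (hloc v) (hloc w)

variable [FiniteDimensional ℝ EG]

/-- The derivative at `1` of the adjoint representation is the adjoint representation of the Lie
algebra. -/
theorem exists_hasFDerivAt_adCLM : ∃ D : EG →L[ℝ] EG →L[ℝ] EG,
    HasFDerivAt (fun x => (adCLM ((extChartAt 𝓘(ℝ, EG) (1 : G)).symm x) : EG →L[ℝ] EG)) D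
      (chartOne EG G) ∧
    ∀ v w : GroupLieAlgebra 𝓘(ℝ, EG) G, D v w = (⁅v, w⁆ : GroupLieAlgebra 𝓘(ℝ, EG) G) := by
  have : CompleteSpace EG := FiniteDimensional.complete ℝ EG
  -- Near the unit `Ad = R⁻¹ L` with `R = L = 1` at the unit, so its derivative there is `L' - R'`.
  -- Since `R'(v) w = L'(w) v`, this is the bracket.
  have hinv : HasFDerivAt (fun x => Ring.inverse (chartRight EG G x))
      (-(fderiv ℝ (chartRight EG G) (chartOne EG G))) (chartOne EG G) := by
    have h1 := (hasFDerivAt_ringInverse (𝕜 := ℝ) (1 : (EG →L[ℝ] EG)ˣ))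
    have h2 : HasFDerivAt (𝕜 := ℝ) Ring.inverse
        (-(ContinuousLinearMap.mulLeftRight ℝ (EG →L[ℝ] EG) ↑(1 : (EG →L[ℝ] EG)ˣ)⁻¹
          ↑(1 : (EG →L[ℝ] EG)ˣ)⁻¹)) (chartRight EG G (chartOne EG G)) := by
      rw [chartRight_one]; exact h1
    refine (h2.comp (chartOne EG G)
      (differentiableAt_chartRight (EG := EG) (G := G)).hasFDerivAt).congr_fderiv ?_
    ext v w
    simp
  have hprod := hinv.clm_comp (differentiableAt_chartLeft (EG := EG) (G := G)).hasFDerivAt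
  have hunit : ∀ᶠ x in 𝓝 (chartOne EG G), IsUnit (chartRight EG G x) := by
    have hc := (differentiableAt_chartRight (EG := EG) (G := G)).continuousAt
    refine hc.eventually (p := fun z => IsUnit z) ?_
    rw [chartRight_one]
    exact Units.isOpen.mem_nhds isUnit_one
  have e1 : Ring.inverse (ContinuousLinearMap.id ℝ EG) = 1 := Ring.inverse_one (EG →L[ℝ] EG)
  have hprod' := hprod.congr_fderiv (g' := fderiv ℝ (chartLeft EG G) (chartOne EG G) -
      fderiv ℝ (chartRight EG G) (chartOne EG G)) (by
    rw [chartLeft_one, chartRight_one, e1]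
    ext v w
    exact (sub_eq_add_neg _ _).symm)
  refine ⟨_, hprod'.congr_of_eventuallyEq ?_, fun v w => ?_⟩
  · filter_upwards [hunit, eventually_mem_target] with x hx hx'
    have h := chartRight_comp_adCLM hx'
    change _ = Ring.inverse (chartRight EG G x) * chartLeft EG G x
    rw [← h]
    change _ = Ring.inverse (chartRight EG G x) * (chartRight EG G x * adCLM _)
    rw [← mul_assoc, Ring.inverse_mul_cancel _ hx, one_mul]
  · have h : ∀ v w : EG, (fderiv ℝ (chartLeft EG G) (chartOne EG G) -
        fderiv ℝ (chartRight EG G) (chartOne EG G)) v w =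
        fderiv ℝ (chartLeft EG G) (chartOne EG G) v w -
          fderiv ℝ (chartLeft EG G) (chartOne EG G) w v := fun v w => by
      rw [← fderiv_chartRight_apply_eq v w]; rfl
    exact (h v w).trans (lie_eq_fderiv_chartLeft v w).symm

end AdjointDeriv

/-! ### Exponentials of `ad A` in the adjoint group. -/

section AdjointExp

/-- The exponential series is natural with respect to intertwining maps. -/
theorem exp_intertwine {V U : Type*} [NormedAddCommGroup V] [NormedSpace ℝ V] [CompleteSpace V]
    [NormedAddCommGroup U] [NormedSpace ℝ U] [CompleteSpace U] {a : V →L[ℝ] V} {b : U →L[ℝ] U}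
    (f : V →L[ℝ] U) (h : ∀ x, f (a x) = b (f x)) (x : V) :
    f (NormedSpace.exp a x) = NormedSpace.exp b (f x) := by
  have hpow : ∀ (n : ℕ) (x : V), f ((a ^ n) x) = (b ^ n) (f x) := by
    intro n
    induction n with
    | zero => intro x; simp
    | succ n ih =>
      intro x
      rw [pow_succ, pow_succ, mul_apply_eq_comp, mul_apply_eq_comp, ih, h]
  have h1 := ((NormedSpace.exp_series_hasSum_exp' (𝕂 := ℝ) a).mapL
    (ContinuousLinearMap.apply ℝ V x)).mapL f
  have h2 := (NormedSpace.exp_series_hasSum_exp' (𝕂 := ℝ) b).mapL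
    (ContinuousLinearMap.apply ℝ U (f x))
  refine h1.unique ?_
  have h3 : (fun n : ℕ => f (ContinuousLinearMap.apply ℝ V x ((n.factorial⁻¹ : ℝ) • a ^ n))) =
      fun n : ℕ => ContinuousLinearMap.apply ℝ U (f x) ((n.factorial⁻¹ : ℝ) • b ^ n) := by
    funext n
    rw [map_smul, map_smul, map_smul]
    exact congrArg _ (hpow n x)
  rw [h3]
  exact h2

variable {EG : Type*} [NormedAddCommGroup EG] [NormedSpace ℝ EG]
  {G : Type*} [Group G] [TopologicalSpace G] [ChartedSpace EG G] [LieGroup 𝓘(ℝ, EG) ∞ G]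
  [FiniteDimensional ℝ EG]

/-- Along integral curves of the left-invariant vector field of `A`, the adjoint representation
solves `f' = f ∘ ad A`. -/
theorem hasDerivAt_adCLM_comp {γ : ℝ → G} {A : GroupLieAlgebra 𝓘(ℝ, EG) G} {t : ℝ}
    {a : EG →L[ℝ] EG} (ha : ∀ w : GroupLieAlgebra 𝓘(ℝ, EG) G,
      a w = (⁅A, w⁆ : GroupLieAlgebra 𝓘(ℝ, EG) G))
    (hγ : HasMFDerivAt 𝓘(ℝ, ℝ) 𝓘(ℝ, EG) γ t
      ((1 : ℝ →L[ℝ] ℝ).smulRight (mulInvariantVectorField A (γ t)))) :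
    HasDerivAt (fun s => (adCLM (γ s) : EG →L[ℝ] EG)) (adCLM (γ t) * a) t := by
  have : IsManifold 𝓘(ℝ, EG) 1 G := IsManifold.of_le (n := ∞) (by simp)
  obtain ⟨D, hD, hD'⟩ := exists_hasFDerivAt_adCLM (EG := EG) (G := G)
  have hDa : D A = a := by
    ext w; exact (hD' A w).trans (ha w).symm
  -- Translating back by `γ(t)⁻¹` makes the curve pass through `1` with velocity `A`, where the
  -- derivative of `Ad` is known.
  have hinv : mfderiv 𝓘(ℝ, EG) 𝓘(ℝ, EG) (fun x : G => (γ t)⁻¹ * x) (γ t)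
      (mulInvariantVectorField A (γ t)) = (A : EG) := by
    have h3 := HasMFDerivAt.comp (1 : G)
      (mdifferentiableAt_mul_left' (EG := EG) (γ t)⁻¹ (γ t * 1)).hasMFDerivAt
      (mdifferentiableAt_mul_left' (γ t) 1).hasMFDerivAt
    have h2 : (fun x : G => (γ t)⁻¹ * x) ∘ (fun x : G => γ t * x) = id := by
      funext x; simp
    rw [h2] at h3
    have h4 := congrArg (fun f : EG →L[ℝ] EG => f A)
      (h3.mfderiv.symm.trans (hasMFDerivAt_id (1 : G)).mfderiv)
    rw [mul_one] at h4
    exact h4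
  have hσ : HasMFDerivAt 𝓘(ℝ, ℝ) 𝓘(ℝ, EG) (fun s => (γ t)⁻¹ * γ s) t
      ((1 : ℝ →L[ℝ] ℝ).smulRight (A : EG)) := by
    have h3 := HasMFDerivAt.comp t
      (mdifferentiableAt_mul_left' (EG := EG) (γ t)⁻¹ (γ t)).hasMFDerivAt hγ
    refine h3.congr_mfderiv ?_
    refine ContinuousLinearMap.ext fun r => ?_
    refine (map_smul (mfderiv 𝓘(ℝ, EG) 𝓘(ℝ, EG) (fun x : G => (γ t)⁻¹ * x) (γ t)) _ _).trans ?_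
    rw [hinv]
    rfl
  have hchart : HasMFDerivAt 𝓘(ℝ, EG) 𝓘(ℝ, EG) (extChartAt 𝓘(ℝ, EG) (1 : G)) 1
      (ContinuousLinearMap.id ℝ EG) := by
    rw [← chartDeriv_one (G := G)]
    exact (mdifferentiableAt_extChartAt (mem_chart_source EG (1 : G))).hasMFDerivAt
  have hφσ : HasDerivAt (fun s => extChartAt 𝓘(ℝ, EG) (1 : G) ((γ t)⁻¹ * γ s)) (A : EG) t := by
    have h3 : HasMFDerivAt 𝓘(ℝ, ℝ) 𝓘(ℝ, EG)
        (extChartAt 𝓘(ℝ, EG) (1 : G) ∘ fun s => (γ t)⁻¹ * γ s) t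
        ((ContinuousLinearMap.id ℝ EG).comp ((1 : ℝ →L[ℝ] ℝ).smulRight (A : EG))) := by
      refine HasMFDerivAt.comp t (g' := ContinuousLinearMap.id ℝ EG) ?_ hσ
      rw [inv_mul_cancel]
      exact hchart
    have h4 : HasFDerivAt (𝕜 := ℝ) (extChartAt 𝓘(ℝ, EG) (1 : G) ∘ fun s => (γ t)⁻¹ * γ s)
      ((ContinuousLinearMap.id ℝ EG).comp ((1 : ℝ →L[ℝ] ℝ).smulRight (A : EG))) t :=
      hasMFDerivAt_iff_hasFDerivAt.1 h3
    have h5 := h4.hasDerivAt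
    refine h5.congr_deriv ?_
    exact one_smul ℝ (A : EG)
  have hmem : ∀ᶠ s in 𝓝 t, (γ t)⁻¹ * γ s ∈ (extChartAt 𝓘(ℝ, EG) (1 : G)).source := by
    refine hσ.continuousAt.eventually (p := fun z => z ∈ (extChartAt 𝓘(ℝ, EG) (1 : G)).source) ?_
    simp only [inv_mul_cancel]
    exact extChartAt_source_mem_nhds (1 : G)
  have hcomp : HasDerivAt (fun s => (adCLM ((γ t)⁻¹ * γ s) : EG →L[ℝ] EG)) a t := by
    have h0 : HasFDerivAt (fun x => (adCLM ((extChartAt 𝓘(ℝ, EG) (1 : G)).symm x) : EG →L[ℝ] EG)) D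
        (extChartAt 𝓘(ℝ, EG) (1 : G) ((γ t)⁻¹ * γ t)) := by
      rw [inv_mul_cancel]; exact hD
    have h1 := h0.comp_hasDerivAt t hφσ
    rw [hDa] at h1
    refine h1.congr_of_eventuallyEq ?_
    filter_upwards [hmem] with s hs
    simp only [Function.comp_apply]
    rw [(extChartAt 𝓘(ℝ, EG) (1 : G)).left_inv hs]
  have h := hcomp.const_mul (adCLM (γ t) : EG →L[ℝ] EG)
  refine h.congr_of_eventuallyEq (Eventually.of_forall fun s => ?_)
  -- Restores the translation: `Ad γ(s) = Ad γ(t) ∘ Ad (γ(t)⁻¹ γ(s))`.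
  have e := adCLM_mul (EG := EG) (γ t) ((γ t)⁻¹ * γ s)
  rw [mul_inv_cancel_left] at e
  exact e

/-- `exp (ad A)` belongs to the adjoint group. -/
theorem exists_adCLM_eq_exp (A : GroupLieAlgebra 𝓘(ℝ, EG) G)
    {a : EG →L[ℝ] EG} (ha : ∀ w : GroupLieAlgebra 𝓘(ℝ, EG) G,
      a w = (⁅A, w⁆ : GroupLieAlgebra 𝓘(ℝ, EG) G)) :
    ∃ g : G, (adCLM g : EG →L[ℝ] EG) = NormedSpace.exp a := by
  have : IsManifold 𝓘(ℝ, EG) 1 G := IsManifold.of_le (n := ∞) (by simp)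
  have : CompleteSpace EG := FiniteDimensional.complete ℝ EG
  let _ : NormedAlgebra ℚ (EG →L[ℝ] EG) := NormedAlgebra.restrictScalars ℚ ℝ _
  -- An integral curve through `1` for small times is enough; the passage to time `1` is made by
  -- powers in `G`.
  obtain ⟨γ, hγ0, hγ⟩ := exists_isMIntegralCurveAt_of_contMDiffAt_boundaryless
    (I := 𝓘(ℝ, EG)) (v := mulInvariantVectorField A) (x₀ := (1 : G)) 0
    ((contMDiffAt_mulInvariantVectorField A).of_le (by
      rw [minSmoothness_of_isRCLikeNormedField]; norm_num))
  obtain ⟨ε, hε, hball⟩ := Metric.eventually_nhds_iff_ball.1 hγ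
  -- The two terms of the product rule, `Ad γ · a · exp(-ta)` and its negative, cancel, so `Ad γ(t)
  -- = exp(ta)` on the ball.
  have hder : ∀ t ∈ Metric.ball (0 : ℝ) ε,
      HasDerivAt (fun s => (adCLM (γ s) : EG →L[ℝ] EG) * NormedSpace.exp (s • (-a))) 0 t := by
    intro t ht
    have h1 := (hasDerivAt_adCLM_comp ha (hball t ht)).mul
      (hasDerivAt_exp_smul_const' (𝕂 := ℝ) (-a) t)
    refine h1.congr_deriv ?_
    simp [mul_assoc]
  have hconst : ∀ t ∈ Metric.ball (0 : ℝ) ε, (adCLM (γ t) : EG →L[ℝ] EG) =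
      NormedSpace.exp (t • a) := by
    intro t ht
    have h1 := (convex_ball (0 : ℝ) ε).is_const_of_fderivWithin_eq_zero (𝕜 := ℝ)
      (f := fun s => (adCLM (γ s) : EG →L[ℝ] EG) * NormedSpace.exp (s • (-a)))
      (fun s hs => (hder s hs).differentiableAt.differentiableWithinAt)
      (fun s hs => by
        rw [fderivWithin_of_isOpen Metric.isOpen_ball hs]
        have := (hder s hs).hasFDerivAt.fderiv
        rw [this]; ext; simp) ht (Metric.mem_ball_self hε)
    simp only [hγ0, adCLM_one, zero_smul, NormedSpace.exp_zero] at h1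
    have h2 : NormedSpace.exp (t • -a) * NormedSpace.exp (t • a) = 1 := by
      have h := NormedSpace.exp_add_of_commute (x := -(t • a)) (y := t • a)
        (Commute.neg_left (Commute.refl _))
      rw [neg_add_cancel, NormedSpace.exp_zero] at h
      rw [smul_neg]
      exact h.symm
    have h3 := congrArg (· * NormedSpace.exp (t • a)) h1
    simp only [mul_assoc, h2, mul_one] at h3
    rw [h3]
    exact one_mul _
  -- With `1/(n+1) < ε`, the `(n+1)`-st power of `exp(a/(n+1)) = Ad γ(1/(n+1))` is `exp a`.
  obtain ⟨n, hn⟩ := exists_nat_one_div_lt hε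
  refine ⟨γ (1 / (n + 1 : ℝ)) ^ (n + 1), ?_⟩
  have hpow : ∀ (g : G) (m : ℕ), (adCLM (g ^ m) : EG →L[ℝ] EG) = (adCLM g) ^ m := by
    intro g m
    induction m with
    | zero => rw [pow_zero, pow_zero]; exact adCLM_one
    | succ m ih => rw [pow_succ, pow_succ, adCLM_mul, ih]; rfl
  rw [hpow, hconst _ (by
    rw [Metric.mem_ball, dist_zero_right, Real.norm_of_nonneg (by positivity)]; exact hn),
    ← NormedSpace.exp_nsmul, ← Nat.cast_smul_eq_nsmul ℝ, smul_smul]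
  congr 1
  push_cast
  rw [mul_one_div_cancel (by positivity), one_smul]

end AdjointExp

/-! ### The action of `S` on `W`: analysis -/

section Norms

variable (V : Type*) [AddCommGroup V] [Module ℝ V] [FiniteDimensional ℝ V]

/-- The sup norm in the coordinates of some basis. -/
noncomputable abbrev finNormedAddCommGroup : NormedAddCommGroup V :=
  NormedAddCommGroup.induced V (Fin (Module.finrank ℝ V) → ℝ) (Module.finBasis ℝ V).equivFun
    (Module.finBasis ℝ V).equivFun.injective

/-- The sup norm in the coordinates of some basis makes `V` a normed space. -/
noncomputable abbrev finNormedSpace :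
    @NormedSpace ℝ V _ (finNormedAddCommGroup V).toSeminormedAddCommGroup :=
  @NormedSpace.induced _ ℝ V (Fin (Module.finrank ℝ V) → ℝ) _ _ _ _ _ _ _
    (Module.finBasis ℝ V).equivFun

end Norms

namespace FinNorm

variable {L : Type*} [LieRing L] [LieAlgebra ℝ L] [FiniteDimensional ℝ L]

-- Auxiliary norms: the spaces are finite-dimensional, so the choice does not affect continuity or
-- smoothness.
noncomputable scoped instance instNormedPiece (𝔤 : TwoGrading L) (i : ℤ) :
    NormedAddCommGroup (𝔤.piece i) := finNormedAddCommGroup _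

noncomputable scoped instance instNormedSpacePiece (𝔤 : TwoGrading L) (i : ℤ) :
    NormedSpace ℝ (𝔤.piece i) := finNormedSpace _

scoped instance instFiniteDimensionalAltMaps {V U : Type*} [AddCommGroup V] [Module ℝ V]
    [FiniteDimensional ℝ V] [AddCommGroup U] [Module ℝ U] [FiniteDimensional ℝ U] :
    FiniteDimensional ℝ (AltMaps V U) :=
  inferInstanceAs (FiniteDimensional ℝ (altSubmodule V U))

noncomputable scoped instance instNormedAltMaps {V U : Type*} [AddCommGroup V] [Module ℝ V]
    [FiniteDimensional ℝ V] [AddCommGroup U] [Module ℝ U] [FiniteDimensional ℝ U] :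
    NormedAddCommGroup (AltMaps V U) := finNormedAddCommGroup _

noncomputable scoped instance instNormedSpaceAltMaps {V U : Type*} [AddCommGroup V] [Module ℝ V]
    [FiniteDimensional ℝ V] [AddCommGroup U] [Module ℝ U] [FiniteDimensional ℝ U] :
    NormedSpace ℝ (AltMaps V U) := finNormedSpace _

end FinNorm

open FinNorm

section ActSmooth

variable {V U : Type*} [NormedAddCommGroup V] [NormedSpace ℝ V] [FiniteDimensional ℝ V]
  [NormedAddCommGroup U] [NormedSpace ℝ U] [FiniteDimensional ℝ U]

/-- An alternating map as a continuous bilinear map. -/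
noncomputable def AltMaps.toCLM : AltMaps V U →L[ℝ] V →L[ℝ] V →L[ℝ] U :=
  LinearMap.toContinuousLinearMap
    (((LinearMap.toContinuousLinearMap.toLinearMap.comp
      (LinearMap.compRight ℝ (M := V)
        (LinearMap.toContinuousLinearMap (E := V) (F' := U) (𝕜 := ℝ)).toLinearMap))).comp
      AltMaps.toBilin)

/-- The alternating part of a bilinear map. -/
noncomputable def AltMaps.alternate : (V →L[ℝ] V →L[ℝ] U) →L[ℝ] AltMaps V U :=
  LinearMap.toContinuousLinearMap
    { toFun := fun B => AltMaps.mk (LinearMap.mk₂ ℝ (fun x y => (1 / 2 : ℝ) • (B x y - B y x))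
        (fun x x' y => by simp only [map_add, add_apply]; module)
        (fun c x y => by simp only [map_smul, smul_apply]; module)
        (fun x y y' => by simp only [map_add, add_apply]; module)
        (fun c x y => by simp only [map_smul, smul_apply]; module))
        (fun x => by simp)
      map_add' := fun B B' => by ext x y; simp; module
      map_smul' := fun c B => by ext x y; simp; module }

/-- Alternation is a continuous linear left inverse of the inclusion into bilinear maps, so
regularity of a map into `AltMaps` can be checked after that inclusion. -/
theorem AltMaps.alternate_eq {B : V →L[ℝ] V →L[ℝ] U} {l : AltMaps V U}
    (h : ∀ x y, B x y = l.toBilin x y) : AltMaps.alternate B = l := by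
  ext x y
  have h1 : l.toBilin y x = - l.toBilin x y := by
    have := l.toBilin_self (x + y)
    simp only [map_add, LinearMap.add_apply, l.toBilin_self, zero_add, add_zero] at this
    exact eq_neg_of_add_eq_zero_left this
  change (1 / 2 : ℝ) • (B x y - B y x) = _
  rw [h, h, h1]
  module

/-- The action of pairs of endomorphisms on alternating maps. -/
noncomputable def AltMaps.actCLM (s : (V →L[ℝ] V) × (U →L[ℝ] U)) (l : AltMaps V U) : AltMaps V U :=
  l.act (s.1 : V →ₗ[ℝ] V) (s.2 : U →ₗ[ℝ] U)

/-- The action is built from compositions of continuous linear maps, which are polynomial in all the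
data; alternation brings the result back to `AltMaps`. In particular it is analytic. -/
theorem AltMaps.contDiff_actCLM {n : WithTop ℕ∞} :
    ContDiff ℝ n (fun p : ((V →L[ℝ] V) × (U →L[ℝ] U)) × AltMaps V U => AltMaps.actCLM p.1 p.2) := by
  have h : (fun p : ((V →L[ℝ] V) × (U →L[ℝ] U)) × AltMaps V U => AltMaps.actCLM p.1 p.2) =
      fun p => AltMaps.alternate
        (((ContinuousLinearMap.compL ℝ V U U p.1.2).comp
          ((ContinuousLinearMap.compL ℝ V V U).flip p.1.1)).comp
          ((AltMaps.toCLM p.2).comp p.1.1)) := by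
    funext p
    exact (AltMaps.alternate_eq fun x y => rfl).symm
  rw [h]
  refine ContDiff.comp (g := AltMaps.alternate (V := V) (U := U)) (by fun_prop) ?_
  fun_prop

end ActSmooth

/-! ### Local slices from the implicit function theorem. -/

section Slice

/-- Replaces `∂*`, which need not be onto `𝔰`, by a surjection onto a coordinate space with the same
kernel, so that the implicit function theorem meets an invertible partial derivative. -/
theorem exists_surjective_ker_eq {A B : Type*} [AddCommGroup A] [Module ℝ A]
    [FiniteDimensional ℝ A] [AddCommGroup B] [Module ℝ B] (f : A →ₗ[ℝ] B) :
    ∃ (m : ℕ) (g : A →ₗ[ℝ] (Fin m → ℝ)), Function.Surjective g ∧ ∀ x, g x = 0 ↔ f x = 0 := by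
  refine ⟨_, (Module.finBasis ℝ (LinearMap.range f)).equivFun.toLinearMap ∘ₗ f.rangeRestrict,
    (Module.finBasis ℝ (LinearMap.range f)).equivFun.surjective.comp f.surjective_rangeRestrict, fun x => ?_⟩
  simp only [LinearMap.comp_apply, LinearEquiv.coe_coe, LinearEquiv.map_eq_zero_iff]
  exact ⟨fun h => congrArg Subtype.val h, fun h => Subtype.ext h⟩

/-- A local slice: near a base point `l₀` whose infinitesimal stabiliser is the range of `δ`, the
equation `d (k - act s l) = 0` is solved by a function of `l` with values in a complement `C` of
the range of `δ`. -/
theorem exists_slice_of_hasFDerivAt {W Z A Y : Type*}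
    [NormedAddCommGroup W] [NormedSpace ℝ W] [FiniteDimensional ℝ W]
    [NormedAddCommGroup Z] [NormedSpace ℝ Z] [FiniteDimensional ℝ Z]
    [NormedAddCommGroup A] [NormedSpace ℝ A] [FiniteDimensional ℝ A]
    [NormedAddCommGroup Y] [NormedSpace ℝ Y] [FiniteDimensional ℝ Y]
    {e : Z} {l₀ k : W} {act : Z → W → W} (hact : ContDiff ℝ ω (fun p : Z × W => act p.1 p.2))
    (he : act e l₀ = l₀) {T : Z →L[ℝ] W} (hT : HasFDerivAt (fun s => act s l₀) T e)
    {d : W →L[ℝ] Y} (hn : d (k - l₀) = 0) {δ : A →L[ℝ] Z}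
    (hker : ∀ t, d (T t) = 0 ↔ ∃ a, δ a = t) (hsurj : ∀ y, ∃ t, d (T t) = y)
    {Φ : A → Z → Z} (hΦe : Φ 0 e = e)
    (hΦ : HasStrictFDerivAt (fun q : A × Z => Φ q.1 q.2)
      (δ.comp (ContinuousLinearMap.fst ℝ A Z) + ContinuousLinearMap.snd ℝ A Z) (0, e)) :
    ∃ (C : Submodule ℝ Z) (ψ : W → C), ψ l₀ = 0 ∧ ContDiffAt ℝ ω ψ l₀ ∧
      (∀ᶠ p : W × C in 𝓝 (l₀, 0), d (k - act (e + (p.2 : Z)) p.1) = 0 ↔ ψ p.1 = p.2) ∧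
      ∀ U ∈ 𝓝 (0 : C), ∀ᶠ s in 𝓝 e, ∃ c ∈ U, ∃ a, s = Φ a (e + (c : Z)) := by
  have := FiniteDimensional.complete ℝ W
  have := FiniteDimensional.complete ℝ Z
  have := FiniteDimensional.complete ℝ A
  have := FiniteDimensional.complete ℝ Y
  let D : Z →L[ℝ] Y := d.comp T
  -- `ker D` is the range of `δ`, so `C` consists of the directions transverse to the infinitesimal
  -- stabiliser, and `D` restricts to an isomorphism of `C` onto `Y`.
  obtain ⟨C, hC⟩ := Submodule.exists_isCompl (LinearMap.ker (D : Z →ₗ[ℝ] Y))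
  have hsup : ∀ t : Z, ∃ a, ∃ c ∈ C, δ a + c = t := by
    intro t
    obtain ⟨u, hu, c, hc, rfl⟩ := Submodule.mem_sup.1
      (by rw [hC.sup_eq_top]; trivial : t ∈ LinearMap.ker (D : Z →ₗ[ℝ] Y) ⊔ C)
    obtain ⟨a, rfl⟩ := (hker u).1 hu
    exact ⟨a, c, hc, rfl⟩
  let f : W × C → Y := fun p => d (k - act (e + (p.2 : Z)) p.1)
  have hfsmooth : ContDiff ℝ ω f := by
    refine d.contDiff.comp (contDiff_const.sub ?_)
    refine hact.comp ((contDiff_const.add ?_).prodMk contDiff_fst)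
    exact C.subtypeL.contDiff.comp contDiff_snd
  have hf0 : f (l₀, 0) = 0 := by
    simp only [f, ZeroMemClass.coe_zero, add_zero, he, hn]
  -- The partial derivative of `f` along `C` is `-D`, hence invertible.
  have hfC : ∀ c : C, (fderiv ℝ f (l₀, 0) ∘L .inr ℝ W C) c = - D c := by
    intro c
    have h1 : HasFDerivAt (fun c : C => f (l₀, c)) (fderiv ℝ f (l₀, 0) ∘L .inr ℝ W C) 0 :=
      ((hfsmooth.differentiable (by simp)) (l₀, 0)).hasFDerivAt.comp (0 : C)
        (hasFDerivAt_prodMk_right l₀ (0 : C))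
    have h2 : HasFDerivAt (fun c : C => act (e + (c : Z)) l₀) (T.comp C.subtypeL) 0 := by
      have h3 : HasFDerivAt (fun c : C => e + (c : Z)) C.subtypeL 0 :=
        C.subtypeL.hasFDerivAt.const_add e
      rw [← add_zero e] at hT
      exact HasFDerivAt.comp (0 : C) (f := fun c : C => e + (c : Z)) hT h3
    have h5 : HasFDerivAt (fun c : C => f (l₀, c)) (d.comp (-(T.comp C.subtypeL))) 0 :=
      d.hasFDerivAt.comp (0 : C) (h2.const_sub k)
    rw [h1.unique h5]
    exact map_neg d _
  have hinv : (fderiv ℝ f (l₀, 0) ∘L .inr ℝ W C).IsInvertible := by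
    refine ⟨ContinuousLinearEquiv.ofBijective (fderiv ℝ f (l₀, 0) ∘L .inr ℝ W C) ?_ ?_, rfl⟩
    · refine (Submodule.eq_bot_iff _).2 fun c hc => ?_
      have h1 : (fderiv ℝ f (l₀, 0) ∘L .inr ℝ W C) c = 0 := hc
      rw [hfC, neg_eq_zero] at h1
      exact Subtype.ext (Submodule.disjoint_def.1 hC.disjoint _ h1 c.2)
    · refine (Submodule.eq_top_iff').2 fun y => ?_
      obtain ⟨t, ht⟩ := hsurj (-y)
      obtain ⟨a, c, hc, rfl⟩ := hsup t
      refine ⟨⟨c, hc⟩, (hfC ⟨c, hc⟩).trans ?_⟩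
      rw [map_add, map_add, (hker _).2 ⟨a, rfl⟩, zero_add] at ht
      change - d (T c) = y
      rw [ht, neg_neg]
  have hcd : ContDiffAt ℝ ω f (l₀, 0) := hfsmooth.contDiffAt
  refine ⟨C, hcd.implicitFunction (by simp) hinv, hcd.implicitFunction_apply_self (by simp) hinv,
    hcd.contDiffAt_implicitFunction (by simp) hinv, ?_, ?_⟩
  · filter_upwards [hcd.eventually_apply_eq_iff_implicitFunction (by simp) hinv] with p hp
    rw [← hp, hf0]
  · intro U hU
    -- The derivative `(a, c) ↦ δ a + c` of `Ψ` at the origin is onto, so `Ψ` maps neighbourhoods of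
    -- the origin onto neighbourhoods of `e`; this keeps `c` in the prescribed `U`.
    let Ψ : A × C → Z := fun q => Φ q.1 (e + (q.2 : Z))
    have hΨ : HasStrictFDerivAt Ψ (δ.comp (ContinuousLinearMap.fst ℝ A C) +
        C.subtypeL.comp (ContinuousLinearMap.snd ℝ A C)) 0 := by
      have h1 : HasStrictFDerivAt (fun q : A × C => (q.1, e + (q.2 : Z)))
          ((ContinuousLinearMap.fst ℝ A C).prod
            (C.subtypeL.comp (ContinuousLinearMap.snd ℝ A C))) 0 :=
        hasStrictFDerivAt_fst.prodMk
          ((C.subtypeL.comp (ContinuousLinearMap.snd ℝ A C)).hasStrictFDerivAt.const_add e)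
      have h2 : ((0 : A), e) = (fun q : A × C => (q.1, e + (q.2 : Z))) 0 := by simp
      rw [h2] at hΦ
      exact hΦ.comp (0 : A × C) h1
    have hΨ0 : Ψ 0 = e := by
      simp only [Ψ, Prod.fst_zero, Prod.snd_zero, ZeroMemClass.coe_zero, add_zero, hΦe]
    have hmap := hΨ.map_nhds_eq_of_surj (by
      refine LinearMap.range_eq_top.2 fun t => ?_
      obtain ⟨a, c, hc, rfl⟩ := hsup t
      exact ⟨(a, ⟨c, hc⟩), rfl⟩)
    rw [hΨ0] at hmap
    rw [← hmap, eventually_map]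
    have : ∀ᶠ q : A × C in 𝓝 0, q.2 ∈ U := continuous_snd.tendsto (0 : A × C) hU
    filter_upwards [this] with q hq
    exact ⟨q.2, hq, q.1, rfl⟩

variable {L : Type*} [LieRing L] [LieAlgebra ℝ L] [FiniteDimensional ℝ L] (𝔤 : TwoGrading L)

/-- Pairs of continuous endomorphisms of `𝔤₋₁` and `𝔤₋₂`. -/
abbrev TwoGrading.EndPair : Type _ :=
  (𝔤.piece (-1) →L[ℝ] 𝔤.piece (-1)) × (𝔤.piece (-2) →L[ℝ] 𝔤.piece (-2))

/-- The pair of linear maps underlying a pair of continuous linear maps. -/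
noncomputable def TwoGrading.toLin : 𝔤.EndPair ≃ₗ[ℝ] 𝔤.𝔰 :=
  LinearEquiv.prodCongr (LinearMap.toContinuousLinearMap (𝕜 := ℝ) (E := 𝔤.piece (-1))).symm
    (LinearMap.toContinuousLinearMap (𝕜 := ℝ) (E := 𝔤.piece (-2))).symm

/-- The action of `𝔤₀` on `𝔤ᵢ`. -/
noncomputable def TwoGrading.adPiece (i : ℤ) : 𝔤.piece 0 →L[ℝ] 𝔤.piece i →L[ℝ] 𝔤.piece i :=
  LinearMap.toContinuousLinearMap
    ((LinearMap.toContinuousLinearMap (𝕜 := ℝ) (E := 𝔤.piece i)).toLinearMap ∘ₗ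
      𝔤.br 0 i i (zero_add i))

/-- The action is quadratic in `s₁` and linear in `s₂`, so the expansion along a line stops at order
three; only its linear coefficient matters later. -/
theorem TwoGrading.actCLM_one_add_smul (l : 𝔤.W) (t : 𝔤.EndPair) (r : ℝ) :
    AltMaps.actCLM (1 + r • t) l = l + r • 𝔤.orbitDeriv l (𝔤.toLin t) +
      r ^ 2 • (l.act (𝔤.toLin t).1 LinearMap.id +
        (𝔤.orbitDeriv l ((𝔤.toLin t).1, 0)).act LinearMap.id (𝔤.toLin t).2) +
      r ^ 3 • AltMaps.actCLM t l := by
  refine AltMaps.ext fun x y => ?_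
  have h1 : ∀ z, (𝔤.toLin t).1 z = t.1 z := fun z => rfl
  have h2 : ∀ z, (𝔤.toLin t).2 z = t.2 z := fun z => rfl
  have h3 : ∀ z, (1 + r • t).1 z = z + r • t.1 z := fun z => rfl
  have h4 : ∀ z, (1 + r • t).2 z = z + r • t.2 z := fun z => rfl
  simp only [AltMaps.actCLM, map_add, map_smul, LinearMap.add_apply, LinearMap.smul_apply,
    AltMaps.toBilin_act, TwoGrading.orbitDeriv_apply, ContinuousLinearMap.coe_coe, h1, h2, h3, h4,
    LinearMap.id_apply, LinearMap.zero_apply, zero_add, smul_add]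
  module

/-- Differentiability is known from smoothness, so the derivative can be read off along lines
through `1`. -/
theorem TwoGrading.hasFDerivAt_actCLM (l : 𝔤.W) : HasFDerivAt
    (fun s : 𝔤.EndPair => AltMaps.actCLM s l)
    (LinearMap.toContinuousLinearMap (𝔤.orbitDeriv l ∘ₗ 𝔤.toLin.toLinearMap)) 1 := by
  have hd : DifferentiableAt ℝ (fun s : 𝔤.EndPair => AltMaps.actCLM s l) 1 := by
    have h := (AltMaps.contDiff_actCLM (n := 1) (V := 𝔤.piece (-1)) (U := 𝔤.piece (-2))).comp
      (contDiff_id.prodMk (contDiff_const (c := l)))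
    exact (h.differentiable (by simp)) 1
  refine hd.hasFDerivAt.congr_fderiv (ContinuousLinearMap.ext fun t => ?_)
  have h1 : HasDerivAt (fun r : ℝ => (1 : 𝔤.EndPair) + r • t) t 0 := by
    simpa using ((hasDerivAt_id (0 : ℝ)).smul_const t).const_add (1 : 𝔤.EndPair)
  have h0 : HasFDerivAt (fun s : 𝔤.EndPair => AltMaps.actCLM s l)
      (fderiv ℝ (fun s : 𝔤.EndPair => AltMaps.actCLM s l) 1) ((1 : 𝔤.EndPair) + (0 : ℝ) • t) := by
    rw [zero_smul, add_zero]; exact hd.hasFDerivAt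
  have h2 := h0.comp_hasDerivAt (0 : ℝ) h1
  have h3 : HasDerivAt (fun r : ℝ => AltMaps.actCLM (1 + r • t) l)
      (𝔤.orbitDeriv l (𝔤.toLin t)) 0 := by
    simp only [𝔤.actCLM_one_add_smul]
    have e1 := ((hasDerivAt_id (0 : ℝ)).smul_const (𝔤.orbitDeriv l (𝔤.toLin t))).const_add l
    have e2 := (hasDerivAt_pow 2 (0 : ℝ)).smul_const (l.act (𝔤.toLin t).1 LinearMap.id +
        (𝔤.orbitDeriv l ((𝔤.toLin t).1, 0)).act LinearMap.id (𝔤.toLin t).2)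
    have e3 := (hasDerivAt_pow 3 (0 : ℝ)).smul_const (AltMaps.actCLM t l)
    refine ((e1.add e2).add e3).congr_deriv ?_
    simp
  exact h2.unique h3

variable [LieAlgebra.IsSemisimple ℝ L]

end Slice

/-! ### The infinitesimal and local action of `exp 𝔤₀`. -/

section Rigidity

variable {L : Type*} [LieRing L] [LieAlgebra ℝ L] [FiniteDimensional ℝ L] (𝔤 : TwoGrading L)

/-- The right multiplication of a pair of endomorphisms by `exp (ad A)`. -/
noncomputable def TwoGrading.expMul (A : 𝔤.piece 0) (s : 𝔤.EndPair) : 𝔤.EndPair :=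
  (s.1 * NormedSpace.exp (𝔤.adPiece (-1) A), NormedSpace.exp (-(𝔤.adPiece (-2) A)) * s.2)

theorem hasStrictFDerivAt_exp_comp {A R : Type*} [NormedAddCommGroup A] [NormedSpace ℝ A]
    [NormedRing R] [NormedAlgebra ℝ R] [CompleteSpace R] (g : A →L[ℝ] R) :
    HasStrictFDerivAt (fun a => NormedSpace.exp (g a)) g 0 := by
  have h2 : HasStrictFDerivAt (NormedSpace.exp : R → R) (1 : R →L[ℝ] R) (g 0) := by
    rw [map_zero]
    exact hasStrictFDerivAt_exp_zero
  exact h2.comp (0 : A) g.hasStrictFDerivAt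

theorem hasStrictFDerivAt_mul_exp {A R : Type*} [NormedAddCommGroup A] [NormedSpace ℝ A]
    [NormedRing R] [NormedAlgebra ℝ R] [CompleteSpace R] (g : A →L[ℝ] R) :
    HasStrictFDerivAt (fun q : A × R => q.2 * NormedSpace.exp (g q.1))
      (g.comp (ContinuousLinearMap.fst ℝ A R) + ContinuousLinearMap.snd ℝ A R) (0, 1) := by
  have h1 : HasStrictFDerivAt (fun q : A × R => NormedSpace.exp (g q.1))
      (g.comp (ContinuousLinearMap.fst ℝ A R)) (0, 1) :=
    HasStrictFDerivAt.comp (f := Prod.fst) ((0 : A), (1 : R)) (hasStrictFDerivAt_exp_comp g)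
      hasStrictFDerivAt_fst
  have h2 := (hasStrictFDerivAt_snd (𝕜 := ℝ) (p := ((0 : A), (1 : R)))).mul' h1
  refine h2.congr_fderiv (ContinuousLinearMap.ext fun q => ?_)
  simp

theorem hasStrictFDerivAt_exp_mul {A R : Type*} [NormedAddCommGroup A] [NormedSpace ℝ A]
    [NormedRing R] [NormedAlgebra ℝ R] [CompleteSpace R] (g : A →L[ℝ] R) :
    HasStrictFDerivAt (fun q : A × R => NormedSpace.exp (g q.1) * q.2)
      (g.comp (ContinuousLinearMap.fst ℝ A R) + ContinuousLinearMap.snd ℝ A R) (0, 1) := by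
  have h1 : HasStrictFDerivAt (fun q : A × R => NormedSpace.exp (g q.1))
      (g.comp (ContinuousLinearMap.fst ℝ A R)) (0, 1) :=
    HasStrictFDerivAt.comp (f := Prod.fst) ((0 : A), (1 : R)) (hasStrictFDerivAt_exp_comp g)
      hasStrictFDerivAt_fst
  have h2 := h1.mul' (hasStrictFDerivAt_snd (𝕜 := ℝ) (p := ((0 : A), (1 : R))))
  refine h2.congr_fderiv (ContinuousLinearMap.ext fun q => ?_)
  simp [add_comm]

/-- The infinitesimal action of `𝔤₀` on `𝔤₋₁ ⊕ 𝔤₋₂`, as a continuous linear map. -/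
noncomputable def TwoGrading.adEndPair : 𝔤.piece 0 →L[ℝ] 𝔤.EndPair :=
  (𝔤.adPiece (-1)).prod (-(𝔤.adPiece (-2)))

theorem TwoGrading.hasStrictFDerivAt_expMul : HasStrictFDerivAt
    (fun q : 𝔤.piece 0 × 𝔤.EndPair => 𝔤.expMul q.1 q.2)
    (𝔤.adEndPair.comp (ContinuousLinearMap.fst ℝ (𝔤.piece 0) 𝔤.EndPair) +
      ContinuousLinearMap.snd ℝ (𝔤.piece 0) 𝔤.EndPair) (0, 1) := by
  have h1 := HasStrictFDerivAt.comp
    (f := fun q : 𝔤.piece 0 × 𝔤.EndPair => (q.1, q.2.1)) ((0 : 𝔤.piece 0), (1 : 𝔤.EndPair))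
    (hasStrictFDerivAt_mul_exp (𝔤.adPiece (-1)))
    (hasStrictFDerivAt_fst.prodMk (hasStrictFDerivAt_snd.fst))
  have h2 := HasStrictFDerivAt.comp
    (f := fun q : 𝔤.piece 0 × 𝔤.EndPair => (q.1, q.2.2)) ((0 : 𝔤.piece 0), (1 : 𝔤.EndPair))
    (hasStrictFDerivAt_exp_mul (-(𝔤.adPiece (-2))))
    (hasStrictFDerivAt_fst.prodMk (hasStrictFDerivAt_snd.snd))
  exact (h1.prodMk h2).congr_fderiv (ContinuousLinearMap.ext fun q => rfl)

theorem TwoGrading.expMul_zero (s : 𝔤.EndPair) : 𝔤.expMul 0 s = s := by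
  simp only [TwoGrading.expMul, map_zero, neg_zero, NormedSpace.exp_zero, mul_one, one_mul]

theorem TwoGrading.actCLM_expMul (A : 𝔤.piece 0) (s : 𝔤.EndPair) (l : 𝔤.W) :
    AltMaps.actCLM (𝔤.expMul A s) l =
      AltMaps.actCLM (𝔤.expMul A 1) (AltMaps.actCLM s l) := by
  refine AltMaps.ext fun x y => ?_
  rfl

variable [LieAlgebra.IsSemisimple ℝ L]

/-- The normalisation condition `∂* (k - l) = 0`. -/
def TwoGrading.IsNormal (l : 𝔤.W) : Prop := 𝔤.codiff₂ (𝔤.k - l) = 0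

/-- If `exp (ad A)` preserves the normalisation condition for all `A ∈ 𝔤₀`, then `𝔤₀` lies in the
infinitesimal stabiliser. -/
theorem TwoGrading.range_adZero_le
    (hinvt : ∀ (A : 𝔤.piece 0) (l : 𝔤.W), 𝔤.IsNormal l →
      𝔤.IsNormal (AltMaps.actCLM (𝔤.expMul A 1) l)) {l : 𝔤.W} (hn : 𝔤.IsNormal l) :
    LinearMap.range 𝔤.adZero ≤ LinearMap.ker (𝔤.codiff₂ ∘ₗ 𝔤.orbitDeriv l) := by
  rintro _ ⟨A, rfl⟩
  obtain ⟨m, d, -, hdker⟩ := exists_surjective_ker_eq 𝔤.codiff₂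
  have h1 : HasFDerivAt (fun A : 𝔤.piece 0 => 𝔤.expMul A 1) 𝔤.adEndPair 0 := by
    have h := 𝔤.hasStrictFDerivAt_expMul.hasFDerivAt.comp (0 : 𝔤.piece 0)
      (hasFDerivAt_prodMk_left (𝕜 := ℝ) (0 : 𝔤.piece 0) (1 : 𝔤.EndPair))
    refine h.congr_fderiv (ContinuousLinearMap.ext fun a => ?_)
    simp
  have h2 : HasFDerivAt (fun A : 𝔤.piece 0 => AltMaps.actCLM (𝔤.expMul A 1) l)
      ((LinearMap.toContinuousLinearMap (𝔤.orbitDeriv l ∘ₗ 𝔤.toLin.toLinearMap)).comp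
        𝔤.adEndPair) 0 := by
    have h := 𝔤.hasFDerivAt_actCLM l
    rw [← 𝔤.expMul_zero 1] at h
    exact HasFDerivAt.comp (0 : 𝔤.piece 0) (f := fun A : 𝔤.piece 0 => 𝔤.expMul A 1) h h1
  have h3 := (LinearMap.toContinuousLinearMap d).hasFDerivAt.comp (0 : 𝔤.piece 0) h2
  -- Normality of all translates of `l` by `exp (ad B)` makes this function of `B` constant, so its
  -- derivative at `0`, which is `d ∘ D_l ∘ ad`, vanishes.
  have h4 : (LinearMap.toContinuousLinearMap d ∘
      fun A : 𝔤.piece 0 => AltMaps.actCLM (𝔤.expMul A 1) l) = fun _ => d 𝔤.k := by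
    funext B
    have := (hdker _).2 (hinvt B l hn)
    rw [map_sub, sub_eq_zero] at this
    exact this.symm
  rw [h4] at h3
  have h5 := congrArg (fun f : 𝔤.piece 0 →L[ℝ] _ => f A)
    (h3.unique (hasFDerivAt_const (d 𝔤.k) (0 : 𝔤.piece 0)))
  exact (hdker _).1 h5

/-- The local slice for the action of `𝔤₀`. -/
theorem TwoGrading.exists_slice (hcoh : Subsingleton 𝔤.H1Zero)
    (hinvt : ∀ (A : 𝔤.piece 0) (l : 𝔤.W), 𝔤.IsNormal l →
      𝔤.IsNormal (AltMaps.actCLM (𝔤.expMul A 1) l)) {l₀ : 𝔤.W}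
    (hn : 𝔤.IsNormal l₀) (ht : 𝔤.IsTransverse l₀) :
    ∃ (C : Submodule ℝ 𝔤.EndPair) (ψ : 𝔤.W → C), ψ l₀ = 0 ∧ ContDiffAt ℝ ω ψ l₀ ∧
      (∀ᶠ p : 𝔤.W × C in 𝓝 (l₀, 0),
        𝔤.IsNormal (AltMaps.actCLM (1 + (p.2 : 𝔤.EndPair)) p.1) ↔ ψ p.1 = p.2) ∧
      ∀ U ∈ 𝓝 (0 : C), ∀ᶠ s in 𝓝 (1 : 𝔤.EndPair), ∃ c ∈ U, ∃ A : 𝔤.piece 0,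
        s = 𝔤.expMul A (1 + (c : 𝔤.EndPair)) := by
  obtain ⟨m, d, hd, hdker⟩ := exists_surjective_ker_eq 𝔤.codiff₂
  obtain ⟨C, ψ, h1, h2, h3, h4⟩ := exists_slice_of_hasFDerivAt
    (W := 𝔤.W) (Z := 𝔤.EndPair) (A := 𝔤.piece 0) (e := 1) (l₀ := l₀) (k := 𝔤.k)
    (act := AltMaps.actCLM) AltMaps.contDiff_actCLM (AltMaps.act_id l₀)
    (𝔤.hasFDerivAt_actCLM l₀) (d := LinearMap.toContinuousLinearMap d) ((hdker _).2 hn)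
    -- The cohomological hypothesis enters here: the infinitesimal stabiliser of the normalisation
    -- is exactly `𝔤₀`.
    (δ := 𝔤.adEndPair) (fun t => by
      refine (hdker _).trans ?_
      have h := 𝔤.ker_codiff₂_orbitDeriv hcoh ht (𝔤.range_adZero_le hinvt hn)
      change 𝔤.toLin t ∈ LinearMap.ker (𝔤.codiff₂ ∘ₗ 𝔤.orbitDeriv l₀) ↔ _
      rw [h]
      constructor
      · rintro ⟨A, hA⟩
        exact ⟨A, 𝔤.toLin.injective hA⟩
      · rintro ⟨A, rfl⟩
        exact ⟨A, rfl⟩)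
    -- Surjectivity is transversality: modulo `ker ∂*` every element of `W` is tangent to the orbit.
    (fun y => by
      obtain ⟨w, rfl⟩ := hd y
      obtain ⟨_, ⟨t, rfl⟩, z, hz, rfl⟩ := Submodule.mem_sup.1
        (by rw [ht]; trivial : w ∈ LinearMap.range (𝔤.orbitDeriv l₀) ⊔ LinearMap.ker 𝔤.codiff₂)
      refine ⟨𝔤.toLin.symm t, ?_⟩
      simp [(hdker z).2 hz])
    (Φ := 𝔤.expMul) (𝔤.expMul_zero 1) 𝔤.hasStrictFDerivAt_expMul
  refine ⟨C, ψ, h1, h2, h3.mono fun p hp => ?_, h4⟩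
  rw [← hp]
  exact (hdker _).symm

end Rigidity

/-! ### The group `S`, structure groups, rigidity and normalisation. -/

section GroupAction

variable {L : Type*} [LieRing L] [LieAlgebra ℝ L] [FiniteDimensional ℝ L] (𝔤 : TwoGrading L)

/-- The group `S = GL(𝔤₋₁) × GL(𝔤₋₂)`. -/
abbrev TwoGrading.S : Type _ :=
  (𝔤.piece (-1) →L[ℝ] 𝔤.piece (-1))ˣ × (𝔤.piece (-2) →L[ℝ] 𝔤.piece (-2))ˣ

variable {𝔤}

/-- The pair of endomorphisms underlying an element of `S`. -/
noncomputable def TwoGrading.endPair (s : 𝔤.S) : 𝔤.EndPair := (s.1, s.2)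

/-- The pair `(s₁, s₂⁻¹)` of endomorphisms given by an element of `S`. -/
noncomputable def TwoGrading.mixedPair (s : 𝔤.S) : 𝔤.EndPair := (s.1, (s.2⁻¹ : (_)ˣ))

/-- The right action of `S` on `W`, `(l · s)(x, y) = s₂⁻¹ (l (s₁ x, s₁ y))`. -/
noncomputable def TwoGrading.actS (s : 𝔤.S) (l : 𝔤.W) : 𝔤.W :=
  AltMaps.actCLM (TwoGrading.mixedPair s) l

@[simp] theorem TwoGrading.toBilin_actS (s : 𝔤.S) (l : 𝔤.W) (x y : 𝔤.piece (-1)) :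
    (TwoGrading.actS s l).toBilin x y =
      (s.2⁻¹ : (_)ˣ).val (l.toBilin (s.1.val x) (s.1.val y)) := rfl

theorem TwoGrading.actS_mul (s t : 𝔤.S) (l : 𝔤.W) :
    TwoGrading.actS (s * t) l = TwoGrading.actS t (TwoGrading.actS s l) := by
  refine AltMaps.ext fun x y => ?_
  simp [mul_inv_rev]

@[simp] theorem TwoGrading.actS_one (l : 𝔤.W) : TwoGrading.actS (1 : 𝔤.S) l = l := by
  refine AltMaps.ext fun x y => ?_
  simp

theorem TwoGrading.continuous_endPair : Continuous (TwoGrading.endPair (𝔤 := 𝔤)) :=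
  (Units.continuous_val.comp continuous_fst).prodMk (Units.continuous_val.comp continuous_snd)

theorem TwoGrading.isInducing_endPair : IsInducing (TwoGrading.endPair (𝔤 := 𝔤)) :=
  Units.isOpenEmbedding_val.isInducing.prodMap Units.isOpenEmbedding_val.isInducing

theorem TwoGrading.continuous_mixedPair : Continuous (TwoGrading.mixedPair (𝔤 := 𝔤)) :=
  TwoGrading.continuous_endPair.comp (continuous_fst.prodMk continuous_snd.inv)

theorem TwoGrading.continuous_actS : Continuous fun p : 𝔤.S × 𝔤.W => TwoGrading.actS p.1 p.2 :=
  (AltMaps.contDiff_actCLM (n := 0)).continuous.comp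
    ((TwoGrading.continuous_mixedPair.comp continuous_fst).prodMk continuous_snd)

variable (𝔤) in
omit [FiniteDimensional ℝ L] in
theorem TwoGrading.orbitDeriv_add (l l' : 𝔤.W) (t : 𝔤.𝔰) :
    𝔤.orbitDeriv (l + l') t = 𝔤.orbitDeriv l t + 𝔤.orbitDeriv l' t := by
  refine AltMaps.ext fun x y => ?_
  simp only [map_add, TwoGrading.orbitDeriv_apply, LinearMap.add_apply]
  abel

variable (𝔤) in
omit [FiniteDimensional ℝ L] in
theorem TwoGrading.orbitDeriv_smul (c : ℝ) (l : 𝔤.W) (t : 𝔤.𝔰) :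
    𝔤.orbitDeriv (c • l) t = c • 𝔤.orbitDeriv l t := by
  refine AltMaps.ext fun x y => ?_
  simp only [map_smul, TwoGrading.orbitDeriv_apply, LinearMap.smul_apply, smul_add]

variable [LieAlgebra.IsSemisimple ℝ L]

variable (𝔤) in
/-- A subgroup of `S` that behaves like the image of `G₀`: it preserves the normalisation and
transversality conditions, and it contains the image of `exp 𝔤₀`. -/
structure TwoGrading.IsStructureGroup (Γ : Subgroup 𝔤.S) : Prop where
  isNormal : ∀ γ ∈ Γ, ∀ l, 𝔤.IsNormal l → 𝔤.IsNormal (TwoGrading.actS γ l)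
  isTransverse : ∀ γ ∈ Γ, ∀ l, 𝔤.IsTransverse l → 𝔤.IsTransverse (TwoGrading.actS γ l)
  exists_exp : ∀ A : 𝔤.piece 0, ∃ γ ∈ Γ, γ.1.val = NormedSpace.exp (𝔤.adPiece (-1) A) ∧
    γ.2.val = NormedSpace.exp (𝔤.adPiece (-2) A)

omit [LieAlgebra.IsSemisimple ℝ L] in
theorem TwoGrading.mixedPair_of_exp {γ : 𝔤.S} {A : 𝔤.piece 0}
    (h1 : γ.1.val = NormedSpace.exp (𝔤.adPiece (-1) A))
    (h2 : γ.2.val = NormedSpace.exp (𝔤.adPiece (-2) A)) :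
    TwoGrading.mixedPair γ = 𝔤.expMul A 1 := by
  have h3 : (γ.2⁻¹ : (_)ˣ).val = NormedSpace.exp (-(𝔤.adPiece (-2) A)) := by
    refine Units.inv_eq_of_mul_eq_one_right ?_
    let _ : NormedAlgebra ℚ (𝔤.piece (-2) →L[ℝ] 𝔤.piece (-2)) :=
      NormedAlgebra.restrictScalars ℚ ℝ _
    have h := NormedSpace.exp_add_of_commute (Commute.neg_right (Commute.refl (𝔤.adPiece (-2) A)))
    rw [add_neg_cancel, NormedSpace.exp_zero] at h
    rw [h2]
    exact h.symm
  simp only [TwoGrading.mixedPair, TwoGrading.expMul, h1, h3, Prod.fst_one, Prod.snd_one, one_mul,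
    mul_one]

theorem TwoGrading.IsStructureGroup.isNormal_exp {Γ : Subgroup 𝔤.S} (hΓ : 𝔤.IsStructureGroup Γ)
    (A : 𝔤.piece 0) (l : 𝔤.W) (hl : 𝔤.IsNormal l) :
    𝔤.IsNormal (AltMaps.actCLM (𝔤.expMul A 1) l) := by
  obtain ⟨γ, hγ, h1, h2⟩ := hΓ.exists_exp A
  rw [← TwoGrading.mixedPair_of_exp h1 h2]
  exact hΓ.isNormal γ hγ l hl

/-- Near the identity, only elements of the structure group map normal elements near `l₀` to
normal elements. -/
theorem TwoGrading.IsStructureGroup.eventually_mem {Γ : Subgroup 𝔤.S}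
    (hΓ : 𝔤.IsStructureGroup Γ) (hcoh : Subsingleton 𝔤.H1Zero) {l₀ : 𝔤.W}
    (hn : 𝔤.IsNormal l₀) (ht : 𝔤.IsTransverse l₀) :
    ∀ᶠ q : 𝔤.W × 𝔤.S in 𝓝 (l₀, 1),
      𝔤.IsNormal q.1 → 𝔤.IsNormal (TwoGrading.actS q.2 q.1) → q.2 ∈ Γ := by
  obtain ⟨C, ψ, -, -, h3, h4⟩ := 𝔤.exists_slice hcoh hΓ.isNormal_exp hn ht
  rw [nhds_prod_eq, eventually_prod_iff] at h3
  obtain ⟨pa, ha, pb, hb, hab⟩ := h3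
  have h5 : Tendsto (TwoGrading.mixedPair (𝔤 := 𝔤)) (𝓝 1) (𝓝 1) := by
    have : TwoGrading.mixedPair (1 : 𝔤.S) = 1 := by
      simp only [TwoGrading.mixedPair, Prod.fst_one, Prod.snd_one, inv_one, Units.val_one]
      rfl
    rw [← this]
    exact TwoGrading.continuous_mixedPair.tendsto 1
  rw [nhds_prod_eq]
  filter_upwards [ha.prod_mk (h5.eventually (h4 _ hb))] with ⟨l, s⟩ ⟨hl, c, hc, A, hs⟩ hnl hnsl
  obtain ⟨γ, hγ, e1, e2⟩ := hΓ.exists_exp A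
  have hγA := TwoGrading.mixedPair_of_exp e1 e2
  have h6 : TwoGrading.actS s l = TwoGrading.actS γ (AltMaps.actCLM (1 + (c : 𝔤.EndPair)) l) := by
    change AltMaps.actCLM (TwoGrading.mixedPair s) l = AltMaps.actCLM (TwoGrading.mixedPair γ) _
    rw [show TwoGrading.mixedPair s = _ from hs, hγA, 𝔤.actCLM_expMul]
  -- Removing the factor `γ ∈ Γ` from `s` keeps the result normal and leaves `1 + c` acting on `l`,
  -- so `c = ψ l` by uniqueness in the slice.
  have h7 := hΓ.isNormal _ (Γ.inv_mem hγ) _ hnsl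
  rw [show TwoGrading.actS (l, s).2 (l, s).1 = TwoGrading.actS s l from rfl, h6,
    ← TwoGrading.actS_mul, mul_inv_cancel, TwoGrading.actS_one] at h7
  have h8 : ψ l = c := (hab hl hc).1 h7
  -- As `l` is itself normal, `0 ∈ C` solves the same equation. Hence `c = 0`, and `s` is the factor
  -- `γ` alone.
  have h9 : ψ l = 0 := by
    refine (hab hl hb.self_of_nhds).1 ?_
    simp only [ZeroMemClass.coe_zero, add_zero]
    exact (congrArg 𝔤.IsNormal (AltMaps.act_id l)).mpr hnl
  have h10 : TwoGrading.mixedPair s = TwoGrading.mixedPair γ := by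
    rw [show TwoGrading.mixedPair s = _ from hs, hγA, ← h8, h9]
    simp
  have h11 : s = γ := by
    refine Prod.ext (Units.ext (congrArg Prod.fst h10)) (inv_injective (Units.ext ?_))
    exact congrArg Prod.snd h10
  exact h11 ▸ hγ

/-- Transversality amounts to surjectivity of `d ∘ D_l`. A right inverse `r` at `l₀` makes `d ∘ D_l
∘ r` depend continuously on `l` and equal `1` at `l₀`, so it stays invertible nearby. -/
theorem TwoGrading.eventually_isTransverse {l₀ : 𝔤.W} (ht : 𝔤.IsTransverse l₀) :
    ∀ᶠ l in 𝓝 l₀, 𝔤.IsTransverse l := by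
  obtain ⟨m, d, hd, hdker⟩ := exists_surjective_ker_eq 𝔤.codiff₂
  have hiff : ∀ l : 𝔤.W, Function.Surjective (d ∘ₗ 𝔤.orbitDeriv l) → 𝔤.IsTransverse l := by
    intro l hl
    refine (Submodule.eq_top_iff').2 fun w => ?_
    obtain ⟨t, ht⟩ := hl (d w)
    refine Submodule.mem_sup.2 ⟨_, ⟨t, rfl⟩, w - 𝔤.orbitDeriv l t, ?_, by abel⟩
    refine (hdker _).1 ?_
    rw [map_sub, sub_eq_zero]
    exact ht.symm
  obtain ⟨r, hr⟩ : ∃ r : (Fin m → ℝ) →ₗ[ℝ] 𝔤.𝔰, (d ∘ₗ 𝔤.orbitDeriv l₀) ∘ₗ r = LinearMap.id := by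
    refine LinearMap.exists_rightInverse_of_surjective _ (LinearMap.range_eq_top.2 fun y => ?_)
    obtain ⟨w, rfl⟩ := hd y
    obtain ⟨_, ⟨t, rfl⟩, z, hz, rfl⟩ := Submodule.mem_sup.1
      (by rw [ht]; trivial : w ∈ LinearMap.range (𝔤.orbitDeriv l₀) ⊔ LinearMap.ker 𝔤.codiff₂)
    exact ⟨t, by simp [(hdker z).2 hz]⟩
  let T : 𝔤.W →ₗ[ℝ] ((Fin m → ℝ) →L[ℝ] (Fin m → ℝ)) :=
    { toFun := fun l => LinearMap.toContinuousLinearMap ((d ∘ₗ 𝔤.orbitDeriv l) ∘ₗ r)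
      map_add' := fun l l' => ContinuousLinearMap.ext fun x =>
        (congrArg d (𝔤.orbitDeriv_add l l' (r x))).trans (map_add d _ _)
      map_smul' := fun c l => ContinuousLinearMap.ext fun x =>
        (congrArg d (𝔤.orbitDeriv_smul c l (r x))).trans (map_smul d _ _) }
  have hT : Continuous T := T.continuous_of_finiteDimensional
  have hT0 : T l₀ = 1 := ContinuousLinearMap.ext fun x => LinearMap.congr_fun hr x
  have h1 : ∀ᶠ l in 𝓝 l₀, IsUnit (T l) := by
    refine hT.continuousAt.eventually (p := fun f => IsUnit f) ?_
    rw [hT0]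
    exact Units.isOpen.mem_nhds isUnit_one
  filter_upwards [h1] with l hl
  obtain ⟨f, hf⟩ := hl
  refine hiff l fun y => ⟨r (f⁻¹.val y), ?_⟩
  have : T l ((f⁻¹ : (_)ˣ).val y) = y := by
    rw [← hf]
    exact congrArg (fun g : (Fin m → ℝ) →L[ℝ] (Fin m → ℝ) => g y) f.mul_inv
  exact this

/-- Elements near `l₀` can be normalised by the action of `S`, smoothly. -/
theorem TwoGrading.IsStructureGroup.exists_normaliser {Γ : Subgroup 𝔤.S}
    (hΓ : 𝔤.IsStructureGroup Γ) (hcoh : Subsingleton 𝔤.H1Zero) {l₀ : 𝔤.W}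
    (hn : 𝔤.IsNormal l₀) (ht : 𝔤.IsTransverse l₀) :
    ∃ γ : 𝔤.W → 𝔤.S, γ l₀ = 1 ∧ ∀ᶠ l in 𝓝 l₀, ContinuousAt γ l ∧
      ContDiffAt ℝ ∞ (fun l => TwoGrading.endPair (γ l)) l ∧
      𝔤.IsNormal (TwoGrading.actS (γ l) l) ∧ 𝔤.IsTransverse (TwoGrading.actS (γ l) l) := by
  classical
  obtain ⟨C, ψ, h0, h2, h3, -⟩ := 𝔤.exists_slice hcoh hΓ.isNormal_exp hn ht
  let f₁ : 𝔤.W → (𝔤.piece (-1) →L[ℝ] 𝔤.piece (-1)) := fun l => 1 + (ψ l : 𝔤.EndPair).1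
  let f₂ : 𝔤.W → (𝔤.piece (-2) →L[ℝ] 𝔤.piece (-2)) := fun l => 1 + (ψ l : 𝔤.EndPair).2
  -- The slice gives the mixed pair `1 + ψ l`; since a mixed pair contains the inverse of the second
  -- factor of `S`, that factor is inverted here. The value `1` away from the units is a dummy.
  let γ : 𝔤.W → 𝔤.S := fun l => if h : IsUnit (f₁ l) ∧ IsUnit (f₂ l) then
    (h.1.unit, h.2.unit⁻¹) else 1
  have hγ : ∀ l, IsUnit (f₁ l) → IsUnit (f₂ l) →
      TwoGrading.endPair (γ l) = (f₁ l, Ring.inverse (f₂ l)) ∧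
      TwoGrading.mixedPair (γ l) = 1 + (ψ l : 𝔤.EndPair) := by
    intro l hl1 hl2
    have e : γ l = (hl1.unit, hl2.unit⁻¹) := dif_pos ⟨hl1, hl2⟩
    rw [e]
    refine ⟨Prod.ext rfl ?_, Prod.ext rfl ?_⟩
    · change (hl2.unit⁻¹ : (_)ˣ).val = Ring.inverse (f₂ l)
      rw [← Ring.inverse_unit]
      rfl
    · change ((hl2.unit⁻¹)⁻¹ : (_)ˣ).val = f₂ l
      rw [inv_inv]
      rfl
  have hψ : ContDiffAt ℝ ω (fun l => (ψ l : 𝔤.EndPair)) l₀ :=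
    ContDiffAt.comp (g := fun c : C => (c : 𝔤.EndPair)) l₀
      (ContDiff.contDiffAt (f := C.subtypeL) (by fun_prop)) h2
  have hf1 : ContDiffAt ℝ ω f₁ l₀ := contDiffAt_const.add hψ.fst
  have hf2 : ContDiffAt ℝ ω f₂ l₀ := contDiffAt_const.add hψ.snd
  have hf10 : f₁ l₀ = 1 := by simp [f₁, h0]
  have hf20 : f₂ l₀ = 1 := by simp [f₂, h0]
  have hu1 : ∀ᶠ l in 𝓝 l₀, IsUnit (f₁ l) := by
    refine hf1.continuousAt.eventually (p := fun f => IsUnit f) ?_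
    rw [hf10]
    exact Units.isOpen.mem_nhds isUnit_one
  have hu2 : ∀ᶠ l in 𝓝 l₀, IsUnit (f₂ l) := by
    refine hf2.continuousAt.eventually (p := fun f => IsUnit f) ?_
    rw [hf20]
    exact Units.isOpen.mem_nhds isUnit_one
  -- Analyticity at `l₀` is inherited by all nearby points, whereas `C^∞` at a single point only
  -- controls each finite order on its own neighbourhood; hence the exponent `ω` in the slice.
  have hsm : ∀ᶠ l in 𝓝 l₀, ContDiffAt ℝ ∞ (fun l => TwoGrading.endPair (γ l)) l := by
    filter_upwards [hu1.eventually_nhds, hu2.eventually_nhds, hf1.eventually (by simp),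
      hf2.eventually (by simp)] with l a1 a2 a3 a4
    have e : (fun l => TwoGrading.endPair (γ l)) =ᶠ[𝓝 l] fun l => (f₁ l, Ring.inverse (f₂ l)) := by
      filter_upwards [a1, a2] with l' b1 b2 using (hγ l' b1 b2).1
    refine ContDiffAt.congr_of_eventuallyEq ?_ e
    obtain ⟨v, hv⟩ := a2.self_of_nhds
    refine (a3.of_le le_top).prodMk (ContDiffAt.comp (g := Ring.inverse) l ?_ (a4.of_le le_top))
    rw [← hv]
    exact contDiffAt_ringInverse ℝ v
  have hc : ContinuousAt γ l₀ := TwoGrading.isInducing_endPair.continuousAt_iff.2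
    hsm.self_of_nhds.continuousAt
  have hγ0 : γ l₀ = 1 := by
    have h := (hγ l₀ (hf10 ▸ isUnit_one) (hf20 ▸ isUnit_one)).1
    rw [hf10, hf20, Ring.inverse_one] at h
    exact Prod.ext (Units.ext (congrArg Prod.fst h)) (Units.ext (congrArg Prod.snd h))
  refine ⟨γ, hγ0, ?_⟩
  have htr : ∀ᶠ l in 𝓝 l₀, 𝔤.IsTransverse (TwoGrading.actS (γ l) l) := by
    have h := TwoGrading.continuous_actS.continuousAt.comp (x := l₀)
      (f := fun l => (γ l, l)) (hc.prodMk continuousAt_id)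
    refine h.eventually (p := fun l => 𝔤.IsTransverse l) ?_
    simp only [Function.comp_apply, hγ0, TwoGrading.actS_one]
    exact TwoGrading.eventually_isTransverse ht
  have hn' : ∀ᶠ l in 𝓝 l₀, 𝔤.IsNormal (AltMaps.actCLM (1 + (ψ l : 𝔤.EndPair)) l) := by
    have h := (continuousAt_id (x := l₀)).prodMk h2.continuousAt
    have h4 : Tendsto (fun l => (l, ψ l)) (𝓝 l₀) (𝓝 (l₀, 0)) := by
      have := h.tendsto
      rwa [h0] at this
    filter_upwards [h4.eventually h3] with l hl
    exact hl.2 rfl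
  filter_upwards [hsm, htr, hn', hu1, hu2] with l a1 a2 a3 a4 a5
  refine ⟨TwoGrading.isInducing_endPair.continuousAt_iff.2 a1.continuousAt, a1, ?_, a2⟩
  change 𝔤.IsNormal (AltMaps.actCLM (TwoGrading.mixedPair (γ l)) l)
  rwa [(hγ l a4 a5).2]

end GroupAction

/-! ### Tangent vectors in charts. -/

section Coordinates

variable {E : Type*} [NormedAddCommGroup E] [NormedSpace ℝ E]
  {M : Type*} [TopologicalSpace M] [ChartedSpace E M] [IsManifold 𝓘(ℝ, E) ∞ M]

/-- The map that sends the coordinates of a tangent vector at `x` in the chart around `x₁` to this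
vector, with the tangent space at `x` read as `E`. -/
noncomputable def coordMap (x₁ x : M) : E →L[ℝ] E := tangentCoordChange 𝓘(ℝ, E) x₁ x x

theorem ofCoord_eq_coordMap {x₁ : M} {y : E} (hy : y ∈ (extChartAt 𝓘(ℝ, E) x₁).target) (a : E) :
    (ofCoord x₁ y a : E) = coordMap x₁ ((extChartAt 𝓘(ℝ, E) x₁).symm y) a := by
  have h1 : MDifferentiableAt 𝓘(ℝ, E) 𝓘(ℝ, E) (extChartAt 𝓘(ℝ, E) x₁).symm y :=
    ((contMDiffOn_extChartAt_symm (n := 1) x₁).contMDiffAt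
      ((isOpen_extChartAt_target x₁).mem_nhds hy)).mdifferentiableAt (by simp)
  have h2 : coordMap x₁ ((extChartAt 𝓘(ℝ, E) x₁).symm y) =
      (show E →L[ℝ] E from mfderiv 𝓘(ℝ, E) 𝓘(ℝ, E) (extChartAt 𝓘(ℝ, E) x₁).symm y) := by
    rw [h1.mfderiv, coordMap, tangentCoordChange_def, (extChartAt 𝓘(ℝ, E) x₁).right_inv hy]
    rfl
  exact (congrArg (fun f : E →L[ℝ] E => f a) h2).symm

variable {x₁ x₂ x : M}

theorem coordMap_tangentCoordChange (h1 : x ∈ (extChartAt 𝓘(ℝ, E) x₁).source)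
    (h2 : x ∈ (extChartAt 𝓘(ℝ, E) x₂).source) (a : E) :
    coordMap x₂ x (tangentCoordChange 𝓘(ℝ, E) x₁ x₂ x a) = coordMap x₁ x a :=
  tangentCoordChange_comp ⟨⟨h1, h2⟩, mem_extChartAt_source x⟩

theorem tangentCoordChange_coordMap (h1 : x ∈ (extChartAt 𝓘(ℝ, E) x₁).source) (a : E) :
    tangentCoordChange 𝓘(ℝ, E) x x₁ x (coordMap x₁ x a) = a := by
  rw [coordMap, tangentCoordChange_comp ⟨⟨h1, mem_extChartAt_source x⟩, h1⟩,
    tangentCoordChange_self h1]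

theorem coordMap_tangentCoordChange_self (h1 : x ∈ (extChartAt 𝓘(ℝ, E) x₁).source) (a : E) :
    coordMap x₁ x (tangentCoordChange 𝓘(ℝ, E) x x₁ x a) = a := by
  rw [coordMap, tangentCoordChange_comp ⟨⟨mem_extChartAt_source x, h1⟩, mem_extChartAt_source x⟩,
    tangentCoordChange_self (mem_extChartAt_source x)]

/-- The tangent space at `x`, in the chart around `x₁`. -/
noncomputable def coordEquiv (h1 : x ∈ (extChartAt 𝓘(ℝ, E) x₁).source) :
    E ≃L[ℝ] E :=
  ContinuousLinearEquiv.equivOfInverse (coordMap x₁ x) (tangentCoordChange 𝓘(ℝ, E) x x₁ x)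
    (tangentCoordChange_coordMap h1) (coordMap_tangentCoordChange_self h1)

@[simp] theorem coordEquiv_apply (h1 : x ∈ (extChartAt 𝓘(ℝ, E) x₁).source) (a : E) :
    coordEquiv h1 a = coordMap x₁ x a := rfl

theorem contMDiffAt_tangentCoordChange (h1 : x ∈ (extChartAt 𝓘(ℝ, E) x₁).source)
    (h2 : x ∈ (extChartAt 𝓘(ℝ, E) x₂).source) :
    ContMDiffAt 𝓘(ℝ, E) 𝓘(ℝ, E →L[ℝ] E) ∞ (tangentCoordChange 𝓘(ℝ, E) x₁ x₂) x := by
  have _ : IsManifold 𝓘(ℝ, E) (∞ + 1) M := ‹IsManifold 𝓘(ℝ, E) ∞ M›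
  have h := contDiffOn_fderiv_coord_change (n := ∞) (I := 𝓘(ℝ, E)) (achart E x₁) (achart E x₂)
  have hs : (((achart E x₁).1.extend 𝓘(ℝ, E)).symm ≫ (achart E x₂).1.extend 𝓘(ℝ, E)).source =
      (extChartAt 𝓘(ℝ, E) x₁).target ∩
        (extChartAt 𝓘(ℝ, E) x₁).symm ⁻¹' (extChartAt 𝓘(ℝ, E) x₂).source :=
    PartialEquiv.trans_source _ _
  have hopen : IsOpen ((extChartAt 𝓘(ℝ, E) x₁).target ∩
        (extChartAt 𝓘(ℝ, E) x₁).symm ⁻¹' (extChartAt 𝓘(ℝ, E) x₂).source) :=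
    ContinuousOn.isOpen_inter_preimage (continuousOn_extChartAt_symm x₁)
      (isOpen_extChartAt_target x₁) (isOpen_extChartAt_source x₂)
  rw [hs] at h
  have h3 : extChartAt 𝓘(ℝ, E) x₁ x ∈ (extChartAt 𝓘(ℝ, E) x₁).target ∩
        (extChartAt 𝓘(ℝ, E) x₁).symm ⁻¹' (extChartAt 𝓘(ℝ, E) x₂).source :=
    ⟨(extChartAt 𝓘(ℝ, E) x₁).map_source h1, by
      rwa [mem_preimage, (extChartAt 𝓘(ℝ, E) x₁).left_inv h1]⟩
  have h4 := (h.contDiffAt (hopen.mem_nhds h3)).contMDiffAt.comp x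
    (contMDiffAt_extChartAt' (n := ∞) (x := x₁) (x' := x)
      (by rwa [extChartAt_source] at h1))
  exact h4

end Coordinates

/-! ### Local sections by graded frames, uniformly for smooth and continuous families. -/

section Sections

variable {E : Type*} [NormedAddCommGroup E] [NormedSpace ℝ E]
  {M : Type*} [TopologicalSpace M] [ChartedSpace E M] [IsManifold 𝓘(ℝ, E) ∞ M]
  {L : Type*} [LieRing L] [LieAlgebra ℝ L]
  (𝔤 : TwoGrading L)

/-- The graded frame `u` at `x` is given, in the chart around `x₁`, by `A` and `B`. -/
def HasCoords (x₁ x : M) {Hx : Submodule ℝ (TangentSpace 𝓘(ℝ, E) x)} (u : GradedFrame 𝔤 Hx)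
    (A : 𝔤.piece (-1) → E) (B : 𝔤.piece (-2) → E) : Prop :=
  (∀ v, ((u.fst v : TangentSpace 𝓘(ℝ, E) x) : E) = coordMap x₁ x (A v)) ∧
    ∀ w, u.snd w = Hx.mkQ (coordMap x₁ x (B w) : E)

variable {𝔤}

theorem isCoordFrame_iff_hasCoords {x₁ : M} {y : E}
    (hy : y ∈ (extChartAt 𝓘(ℝ, E) x₁).target)
    {Hx : Submodule ℝ (TangentSpace 𝓘(ℝ, E) ((extChartAt 𝓘(ℝ, E) x₁).symm y))}
    {u : GradedFrame 𝔤 Hx} {A : 𝔤.piece (-1) → E} {B : 𝔤.piece (-2) → E} :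
    IsCoordFrame 𝔤 x₁ y u A B ↔ HasCoords 𝔤 x₁ ((extChartAt 𝓘(ℝ, E) x₁).symm y) u A B := by
  refine and_congr (forall_congr' fun v => ?_) (forall_congr' fun w => ?_)
  · rw [← ofCoord_eq_coordMap hy]
  · rw [← ofCoord_eq_coordMap hy]

theorem HasCoords.change {x₁ x₂ x : M} (h1 : x ∈ (extChartAt 𝓘(ℝ, E) x₁).source)
    (h2 : x ∈ (extChartAt 𝓘(ℝ, E) x₂).source) {Hx : Submodule ℝ (TangentSpace 𝓘(ℝ, E) x)}
    {u : GradedFrame 𝔤 Hx} {A : 𝔤.piece (-1) → E} {B : 𝔤.piece (-2) → E}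
    (h : HasCoords 𝔤 x₁ x u A B) :
    HasCoords 𝔤 x₂ x u (fun v => tangentCoordChange 𝓘(ℝ, E) x₁ x₂ x (A v))
      (fun w => tangentCoordChange 𝓘(ℝ, E) x₁ x₂ x (B w)) := by
  refine ⟨fun v => (h.1 v).trans (coordMap_tangentCoordChange h1 h2 _).symm, fun w => ?_⟩
  rw [h.2 w, coordMap_tangentCoordChange h1 h2]

variable {EZ : Type*} [NormedAddCommGroup EZ] [NormedSpace ℝ EZ] {HZ : Type*} [TopologicalSpace HZ]
  (IZ : ModelWithCorners ℝ EZ HZ) {Z : Type*} [TopologicalSpace Z] [ChartedSpace HZ Z]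

/-- The family `K` of sets of graded frames at the points `π z` has, near `z₀`, a section which is
of class `C^n` in the chart around `x₁`. -/
def HasLocalSection (n : WithTop ℕ∞) (π : Z → M)
    (H : (z : Z) → Submodule ℝ (TangentSpace 𝓘(ℝ, E) (π z)))
    (K : (z : Z) → Set (GradedFrame 𝔤 (H z))) (x₁ : M) (z₀ : Z) : Prop :=
  ∃ (A : 𝔤.piece (-1) → Z → E) (B : 𝔤.piece (-2) → Z → E), ∀ᶠ z in 𝓝 z₀,
    (∀ v, ContMDiffAt IZ 𝓘(ℝ, E) n (A v) z) ∧ (∀ w, ContMDiffAt IZ 𝓘(ℝ, E) n (B w) z) ∧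
      ∃ u ∈ K z, HasCoords 𝔤 x₁ (π z) u (fun v => A v z) (fun w => B w z)

variable {IZ}

/-- The transition functions of the tangent bundle are smooth, so regularity of a section does not
depend on the chart. -/
theorem HasLocalSection.change {n : WithTop ℕ∞} (hn : n ≤ ∞) {π : Z → M}
    (hπ : ContMDiff IZ 𝓘(ℝ, E) n π)
    {H : (z : Z) → Submodule ℝ (TangentSpace 𝓘(ℝ, E) (π z))}
    {K : (z : Z) → Set (GradedFrame 𝔤 (H z))} {x₁ x₂ : M} {z₀ : Z}
    (h1 : π z₀ ∈ (extChartAt 𝓘(ℝ, E) x₁).source) (h2 : π z₀ ∈ (extChartAt 𝓘(ℝ, E) x₂).source)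
    (h : HasLocalSection IZ n π H K x₁ z₀) : HasLocalSection IZ n π H K x₂ z₀ := by
  obtain ⟨A, B, hAB⟩ := h
  refine ⟨fun v z => tangentCoordChange 𝓘(ℝ, E) x₁ x₂ (π z) (A v z),
    fun w z => tangentCoordChange 𝓘(ℝ, E) x₁ x₂ (π z) (B w z), ?_⟩
  filter_upwards [hAB,
    hπ.continuous.continuousAt.preimage_mem_nhds ((isOpen_extChartAt_source x₁).mem_nhds h1),
    hπ.continuous.continuousAt.preimage_mem_nhds ((isOpen_extChartAt_source x₂).mem_nhds h2)]
    with z ⟨hA, hB, u, hu, hc⟩ hz1 hz2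
  have hG : ContMDiffAt IZ 𝓘(ℝ, E →L[ℝ] E) n
      (fun z => tangentCoordChange 𝓘(ℝ, E) x₁ x₂ (π z)) z :=
    ContMDiffAt.comp z ((contMDiffAt_tangentCoordChange hz1 hz2).of_le hn) (hπ z)
  exact ⟨fun v => hG.clm_apply (hA v), fun w => hG.clm_apply (hB w), u, hu, hc.change hz1 hz2⟩

end Sections

/-! ### Graded frames as a torsor under `S`. -/

section Torsor

variable {L : Type*} [LieRing L] [LieAlgebra ℝ L] [FiniteDimensional ℝ L] {𝔤 : TwoGrading L}
  {T : Type*} [AddCommGroup T] [Module ℝ T] {Hx : Submodule ℝ T}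

omit [FiniteDimensional ℝ L] in
theorem GradedFrame.ext' {u u' : GradedFrame 𝔤 Hx} (h1 : ∀ v, u.fst v = u'.fst v)
    (h2 : ∀ w, u.snd w = u'.snd w) : u = u' := by
  cases u; cases u'
  congr
  · exact LinearEquiv.ext h1
  · exact LinearEquiv.ext h2

/-- The right action of `S` on graded frames. -/
noncomputable def GradedFrame.comp (u : GradedFrame 𝔤 Hx) (s : 𝔤.S) : GradedFrame 𝔤 Hx where
  fst := (ContinuousLinearEquiv.unitsEquiv ℝ (𝔤.piece (-1)) s.1).toLinearEquiv.trans u.fst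
  snd := (ContinuousLinearEquiv.unitsEquiv ℝ (𝔤.piece (-2)) s.2).toLinearEquiv.trans u.snd

@[simp] theorem GradedFrame.comp_fst (u : GradedFrame 𝔤 Hx) (s : 𝔤.S) (v : 𝔤.piece (-1)) :
    (u.comp s).fst v = u.fst (s.1.val v) := rfl

@[simp] theorem GradedFrame.comp_snd (u : GradedFrame 𝔤 Hx) (s : 𝔤.S) (w : 𝔤.piece (-2)) :
    (u.comp s).snd w = u.snd (s.2.val w) := rfl

@[simp] theorem GradedFrame.comp_one (u : GradedFrame 𝔤 Hx) : u.comp 1 = u :=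
  GradedFrame.ext' (fun _ => rfl) (fun _ => rfl)

theorem GradedFrame.comp_comp (u : GradedFrame 𝔤 Hx) (s t : 𝔤.S) :
    (u.comp s).comp t = u.comp (s * t) :=
  GradedFrame.ext' (fun _ => rfl) (fun _ => rfl)

theorem GradedFrame.comp_injective (u : GradedFrame 𝔤 Hx) : Function.Injective u.comp := by
  intro s t h
  refine Prod.ext (Units.ext (ContinuousLinearMap.ext fun v => ?_))
    (Units.ext (ContinuousLinearMap.ext fun v => ?_))
  · exact u.fst.injective (congrArg (fun u' : GradedFrame 𝔤 Hx => u'.fst v) h)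
  · exact u.snd.injective (congrArg (fun u' : GradedFrame 𝔤 Hx => u'.snd v) h)

theorem GradedFrame.exists_comp_eq (u u' : GradedFrame 𝔤 Hx) : ∃ s, u.comp s = u' := by
  refine ⟨((ContinuousLinearEquiv.unitsEquiv ℝ (𝔤.piece (-1))).symm
      (u'.fst.trans u.fst.symm).toContinuousLinearEquiv,
    (ContinuousLinearEquiv.unitsEquiv ℝ (𝔤.piece (-2))).symm
      (u'.snd.trans u.snd.symm).toContinuousLinearEquiv), GradedFrame.ext' (fun v => ?_)
      (fun w => ?_)⟩
  · exact u.fst.apply_symm_apply (u'.fst v)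
  · exact u.snd.apply_symm_apply (u'.snd w)

end Torsor

/-! ### Sections as `S`-valued functions relative to a reference frame. -/

section Sections

variable {EZ : Type*} [NormedAddCommGroup EZ] [NormedSpace ℝ EZ] {HZ : Type*} [TopologicalSpace HZ]
  {IZ : ModelWithCorners ℝ EZ HZ} {Z : Type*} [TopologicalSpace Z] [ChartedSpace HZ Z]

/-- In finite dimension `f z` is a fixed linear expression in its values on a basis. -/
theorem contMDiffAt_of_clm_apply {V U : Type*} [NormedAddCommGroup V] [NormedSpace ℝ V]
    [FiniteDimensional ℝ V] [NormedAddCommGroup U] [NormedSpace ℝ U] {n : WithTop ℕ∞}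
    {f : Z → V →L[ℝ] U} {z₀ : Z} (h : ∀ v, ContMDiffAt IZ 𝓘(ℝ, U) n (fun z => f z v) z₀) :
    ContMDiffAt IZ 𝓘(ℝ, V →L[ℝ] U) n f z₀ := by
  let b := Module.finBasis ℝ V
  have e : f = fun z => ∑ i, ContinuousLinearMap.smulRightL ℝ V U
      (LinearMap.toContinuousLinearMap (b.coord i)) (f z (b i)) := by
    funext z
    refine ContinuousLinearMap.ext fun v => ?_
    have h1 := congrArg (f z) (b.sum_repr v)
    simp only [map_sum, map_smul] at h1
    simp [h1]
  rw [e]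
  refine contMDiffAt_finsetSum fun i _ => ?_
  exact ContMDiffAt.clm_apply contMDiffAt_const (h (b i))

variable {E : Type*} [NormedAddCommGroup E] [NormedSpace ℝ E]
  {M : Type*} [TopologicalSpace M] [ChartedSpace E M] [IsManifold 𝓘(ℝ, E) ∞ M]
  {L : Type*} [LieRing L] [LieAlgebra ℝ L] [FiniteDimensional ℝ L] {𝔤 : TwoGrading L}

theorem contMDiffAt_inverse {V : Type*} [NormedAddCommGroup V] [NormedSpace ℝ V]
    [FiniteDimensional ℝ V] {n : WithTop ℕ∞}
    {R : Z → V →L[ℝ] E} {z : Z} (h : ContMDiffAt IZ 𝓘(ℝ, V →L[ℝ] E) n R z)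
    (hi : (R z).IsInvertible) :
    ContMDiffAt IZ 𝓘(ℝ, E →L[ℝ] V) n (fun z => (R z).inverse) z := by
  have _ := FiniteDimensional.complete ℝ V
  obtain ⟨e, he⟩ := hi
  have h1 : ContDiffAt ℝ n ContinuousLinearMap.inverse (R z) := by
    rw [← he]
    exact contDiffAt_map_inverse e
  exact h1.comp_contMDiffAt h

/-- Sections near `z₀` of a family of sets of graded frames, in terms of a reference frame that is
given by `R` in the chart around `x₁`. -/
theorem hasLocalSection_iff {n : WithTop ℕ∞} {π : Z → M}
    {H : (z : Z) → Submodule ℝ (TangentSpace 𝓘(ℝ, E) (π z))}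
    {K : (z : Z) → Set (GradedFrame 𝔤 (H z))} {x₁ : M} {z₀ : Z} {D : Set Z} (hD : D ∈ 𝓝 z₀)
    (hsrc : ∀ z ∈ D, π z ∈ (extChartAt 𝓘(ℝ, E) x₁).source)
    {R : Z → 𝔤.piece (-1) × 𝔤.piece (-2) →L[ℝ] E}
    (hR : ∀ z ∈ D, ContMDiffAt IZ 𝓘(ℝ, 𝔤.piece (-1) × 𝔤.piece (-2) →L[ℝ] E) n R z)
    (hinv : ∀ z ∈ D, (R z).IsInvertible)
    {uref : (z : Z) → z ∈ D → GradedFrame 𝔤 (H z)}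
    (hu : ∀ z hz, HasCoords 𝔤 x₁ (π z) (uref z hz) (fun v => R z (v, 0)) (fun w => R z (0, w))) :
    HasLocalSection IZ n π H K x₁ z₀ ↔ ∃ σ : Z → 𝔤.S, ∀ᶠ z in 𝓝 z₀,
      ContMDiffAt IZ 𝓘(ℝ, 𝔤.EndPair) n (fun z => TwoGrading.endPair (σ z)) z ∧
        ∀ hz, (uref z hz).comp (σ z) ∈ K z := by
  classical
  have hD' : ∀ᶠ z in 𝓝 z₀, D ∈ 𝓝 z := eventually_mem_nhds_iff.2 hD
  constructor
  · rintro ⟨A, B, hAB⟩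
    -- The element of `S` that relates the two frames is recovered from the coordinates by `R⁻¹`, so
    -- it inherits the regularity of `A`, `B` and `R`.
    have hex : ∀ z, ∃ s : 𝔤.S, ∀ hz : z ∈ D,
        (∃ u ∈ K z, HasCoords 𝔤 x₁ (π z) u (fun v => A v z) (fun w => B w z)) →
        (uref z hz).comp s ∈ K z ∧
          (∀ v, s.1.val v = ((R z).inverse (A v z)).1) ∧
          ∀ w, s.2.val w = ((R z).inverse (B w z)).2 := by
      intro z
      by_cases hz : z ∈ D
      swap
      · exact ⟨1, fun h => absurd h hz⟩
      by_cases he : ∃ u ∈ K z, HasCoords 𝔤 x₁ (π z) u (fun v => A v z) (fun w => B w z)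
      swap
      · exact ⟨1, fun _ h => absurd h he⟩
      obtain ⟨u, huK, hu1, hu2⟩ := he
      obtain ⟨s, hs⟩ := (uref z hz).exists_comp_eq u
      refine ⟨s, fun _ _ => ⟨hs ▸ huK, fun v => ?_, fun w => ?_⟩⟩
      all_goals obtain ⟨e, he⟩ := hinv z hz
      · have h1 : coordMap x₁ (π z) (R z (s.1.val v, 0)) = coordMap x₁ (π z) (A v z) := by
          rw [← hu1 v, ← hs]
          exact ((hu z hz).1 _).symm
        have h2 : R z (s.1.val v, 0) = A v z := (coordEquiv (hsrc z hz)).injective h1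
        rw [← h2, ← he, ContinuousLinearMap.inverse_equiv]
        exact (congrArg Prod.fst (e.symm_apply_apply (s.1.val v, 0))).symm
      -- `B w` is determined only modulo `H`. The ambiguity lies in the image of `𝔤₋₁ × 0` under `R`
      -- and disappears in the second component of `R⁻¹`.
      · have h1 : (H z).mkQ (coordMap x₁ (π z) (R z (0, s.2.val w)) : E) =
            (H z).mkQ (coordMap x₁ (π z) (B w z) : E) := by
          rw [← hu2 w, ← hs]
          exact ((hu z hz).2 _).symm
        have h2 : coordMap x₁ (π z) (B w z) - coordMap x₁ (π z) (R z (0, s.2.val w)) ∈ H z :=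
          (Submodule.Quotient.eq _).1 h1.symm
        obtain ⟨p, hp⟩ := (uref z hz).fst.surjective ⟨_, h2⟩
        have h3 : coordMap x₁ (π z) (R z (p, 0)) =
            coordMap x₁ (π z) (B w z) - coordMap x₁ (π z) (R z (0, s.2.val w)) := by
          rw [← (hu z hz).1 p, hp]
        have h4 : R z (p, s.2.val w) = B w z := by
          refine (coordEquiv (hsrc z hz)).injective ?_
          have : (p, s.2.val w) = (p, 0) + ((0 : 𝔤.piece (-1)), s.2.val w) := by simp
          rw [this, map_add, map_add, coordEquiv_apply, coordEquiv_apply, h3, coordEquiv_apply]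
          abel
        rw [← h4, ← he, ContinuousLinearMap.inverse_equiv]
        exact (congrArg Prod.snd (e.symm_apply_apply (p, s.2.val w))).symm
    choose σ hσ using hex
    refine ⟨σ, ?_⟩
    filter_upwards [hAB.eventually_nhds, hD'] with z hz1 hz2
    have hzD := mem_of_mem_nhds hz2
    obtain ⟨hA, hB, hK⟩ := hz1.self_of_nhds
    refine ⟨?_, fun hz => (hσ z hz hK).1⟩
    have hRi := contMDiffAt_inverse (hR z hzD) (hinv z hzD)
    refine ContMDiffAt.prodMk_space (contMDiffAt_of_clm_apply fun v => ?_)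
      (contMDiffAt_of_clm_apply fun w => ?_)
    · refine ContMDiffAt.congr_of_eventuallyEq
        (f := fun z => ContinuousLinearMap.fst ℝ _ _ ((R z).inverse (A v z)))
        (ContMDiffAt.clm_apply contMDiffAt_const (hRi.clm_apply (hA v))) ?_
      filter_upwards [hz1, hz2] with z' h1 h2 using (hσ z' h2 h1.2.2).2.1 v
    · refine ContMDiffAt.congr_of_eventuallyEq
        (f := fun z => ContinuousLinearMap.snd ℝ _ _ ((R z).inverse (B w z)))
        (ContMDiffAt.clm_apply contMDiffAt_const (hRi.clm_apply (hB w))) ?_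
      filter_upwards [hz1, hz2] with z' h1 h2 using (hσ z' h2 h1.2.2).2.2 w
  · rintro ⟨σ, hσ⟩
    refine ⟨fun v z => R z ((σ z).1.val v, 0), fun w z => R z (0, (σ z).2.val w), ?_⟩
    filter_upwards [hσ, hD] with z ⟨hs, hK⟩ hz
    have h1 : ContMDiffAt IZ 𝓘(ℝ, 𝔤.piece (-1) →L[ℝ] 𝔤.piece (-1)) n
        (fun z => (σ z).1.val) z :=
      ContMDiffAt.clm_apply (contMDiffAt_const (c := ContinuousLinearMap.fst ℝ _ _)) hs
    have h2 : ContMDiffAt IZ 𝓘(ℝ, 𝔤.piece (-2) →L[ℝ] 𝔤.piece (-2)) n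
        (fun z => (σ z).2.val) z :=
      ContMDiffAt.clm_apply (contMDiffAt_const (c := ContinuousLinearMap.snd ℝ _ _)) hs
    refine ⟨fun v => (hR z hz).clm_apply ?_, fun w => (hR z hz).clm_apply ?_, _, hK hz, ?_, ?_⟩
    · exact (h1.clm_apply contMDiffAt_const).prodMk_space contMDiffAt_const
    · exact contMDiffAt_const.prodMk_space (h2.clm_apply contMDiffAt_const)
    · exact fun v => (hu z hz).1 _
    · exact fun w => (hu z hz).2 _

end Sections

/-! ### Smooth and continuous fields in terms of local sections. -/

section Fields

/-- Being `C^0` at a point is obtained here from continuity on a neighbourhood, hence the hypothesis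
at all nearby points. -/
theorem contMDiffAt_zero_of_eventually {EZ : Type*} [NormedAddCommGroup EZ] [NormedSpace ℝ EZ]
    {HZ : Type*} [TopologicalSpace HZ] {IZ : ModelWithCorners ℝ EZ HZ} {Z : Type*}
    [TopologicalSpace Z] [ChartedSpace HZ Z] {F : Type*} [NormedAddCommGroup F] [NormedSpace ℝ F]
    {f : Z → F} {z : Z} (h : ∀ᶠ z' in 𝓝 z, ContinuousAt f z') : ContMDiffAt IZ 𝓘(ℝ, F) 0 f z :=
  (contMDiffOn_zero_iff.2 fun _ hz' => ContinuousAt.continuousWithinAt hz').contMDiffAt h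

variable {E : Type*} [NormedAddCommGroup E] [NormedSpace ℝ E]
  {M : Type*} [TopologicalSpace M] [ChartedSpace E M] [IsManifold 𝓘(ℝ, E) ∞ M]
  {L : Type*} [LieRing L] [LieAlgebra ℝ L] {𝔤 : TwoGrading L}

theorem exists_isCoordFrame_iff {x₁ x : M} (hx : x ∈ (extChartAt 𝓘(ℝ, E) x₁).source)
    {H : (x : M) → Submodule ℝ (TangentSpace 𝓘(ℝ, E) x)}
    {K : (x : M) → Set (GradedFrame 𝔤 (H x))} {A : 𝔤.piece (-1) → E} {B : 𝔤.piece (-2) → E} :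
    (∃ u ∈ K ((extChartAt 𝓘(ℝ, E) x₁).symm (extChartAt 𝓘(ℝ, E) x₁ x)),
      IsCoordFrame 𝔤 x₁ (extChartAt 𝓘(ℝ, E) x₁ x) u A B) ↔
    ∃ u ∈ K x, HasCoords 𝔤 x₁ x u A B := by
  simp only [isCoordFrame_iff_hasCoords ((extChartAt 𝓘(ℝ, E) x₁).map_source hx)]
  rw [(extChartAt 𝓘(ℝ, E) x₁).left_inv hx]

/-- The field `K` of sets of graded frames has a smooth section near `x₀`. -/
def HasSmoothSection (H : (x : M) → Submodule ℝ (TangentSpace 𝓘(ℝ, E) x))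
    (K : (x : M) → Set (GradedFrame 𝔤 (H x))) (x₁ x₀ : M) : Prop :=
  HasLocalSection 𝓘(ℝ, E) ∞ (fun x : M => x) H K x₁ x₀

/-- The family `K` of fields of sets of graded frames has a continuous section near `p`. -/
def HasContinuousSection (H : ℝ → (x : M) → Submodule ℝ (TangentSpace 𝓘(ℝ, E) x))
    (K : (t : ℝ) → (x : M) → Set (GradedFrame 𝔤 (H t x))) (x₁ : M) (p : ℝ × M) : Prop :=
  HasLocalSection (𝓘(ℝ, ℝ).prod 𝓘(ℝ, E)) 0 (Prod.snd : ℝ × M → M) (fun z => H z.1 z.2)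
    (fun z => K z.1 z.2) x₁ p

theorem isSmoothField_iff {H : (x : M) → Submodule ℝ (TangentSpace 𝓘(ℝ, E) x)}
    {K : (x : M) → Set (GradedFrame 𝔤 (H x))} :
    IsSmoothField 𝔤 H K ↔ ∀ x₀, HasSmoothSection H K x₀ x₀ := by
  refine forall_congr' fun x₀ => ⟨?_, ?_⟩
  · rintro ⟨N, hN, A, B, hA, hB, hK⟩
    refine ⟨fun v x => A v (extChartAt 𝓘(ℝ, E) x₀ x), fun w x => B w (extChartAt 𝓘(ℝ, E) x₀ x), ?_⟩
    have h1 := (continuousAt_extChartAt (I := 𝓘(ℝ, E)) x₀).eventually (eventually_mem_nhds_iff.2 hN)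
    filter_upwards [h1, extChartAt_source_mem_nhds (I := 𝓘(ℝ, E)) x₀] with x hx hsrc
    have hφ : ContMDiffAt 𝓘(ℝ, E) 𝓘(ℝ, E) ∞ (extChartAt 𝓘(ℝ, E) x₀) x :=
      contMDiffAt_extChartAt' (by rwa [extChartAt_source] at hsrc)
    exact ⟨fun v => ((hA v).contDiffAt hx).contMDiffAt.comp x hφ,
      fun w => ((hB w).contDiffAt hx).contMDiffAt.comp x hφ,
      (exists_isCoordFrame_iff hsrc).1 (hK _ (mem_of_mem_nhds hx))⟩
  · rintro ⟨A, B, hAB⟩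
    have h1 : Tendsto (extChartAt 𝓘(ℝ, E) x₀).symm (𝓝 (extChartAt 𝓘(ℝ, E) x₀ x₀)) (𝓝 x₀) := by
      have := (continuousAt_extChartAt_symm (I := 𝓘(ℝ, E)) x₀).tendsto
      rwa [(extChartAt 𝓘(ℝ, E) x₀).left_inv (mem_extChartAt_source x₀)] at this
    refine ⟨_, inter_mem (h1.eventually hAB) (extChartAt_target_mem_nhds x₀),
      fun v y => A v ((extChartAt 𝓘(ℝ, E) x₀).symm y),
      fun w y => B w ((extChartAt 𝓘(ℝ, E) x₀).symm y), fun v y hy => ?_, fun w y hy => ?_,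
      fun y hy => ?_⟩
    · have hφ := (contMDiffOn_extChartAt_symm (I := 𝓘(ℝ, E)) (n := ∞) x₀).contMDiffAt
        ((isOpen_extChartAt_target x₀).mem_nhds hy.2)
      exact (ContMDiffAt.comp y (hy.1.1 v) hφ).contDiffAt.contDiffWithinAt
    · have hφ := (contMDiffOn_extChartAt_symm (I := 𝓘(ℝ, E)) (n := ∞) x₀).contMDiffAt
        ((isOpen_extChartAt_target x₀).mem_nhds hy.2)
      exact (ContMDiffAt.comp y (hy.1.2.1 w) hφ).contDiffAt.contDiffWithinAt
    · obtain ⟨u, hu, hc⟩ := hy.1.2.2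
      exact ⟨u, hu, (isCoordFrame_iff_hasCoords hy.2).2 hc⟩

theorem isContinuousField_iff {J : Set ℝ}
    {H : ℝ → (x : M) → Submodule ℝ (TangentSpace 𝓘(ℝ, E) x)}
    {K : (t : ℝ) → (x : M) → Set (GradedFrame 𝔤 (H t x))} :
    IsContinuousField 𝔤 J H K ↔ ∀ t₀ ∈ J, ∀ x₀, HasContinuousSection H K x₀ (t₀, x₀) := by
  refine forall_congr' fun t₀ => forall_congr' fun _ => forall_congr' fun x₀ => ⟨?_, ?_⟩
  · rintro ⟨N, hN, A, B, hA, hB, hK⟩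
    refine ⟨fun v z => A v (z.1, extChartAt 𝓘(ℝ, E) x₀ z.2),
      fun w z => B w (z.1, extChartAt 𝓘(ℝ, E) x₀ z.2), ?_⟩
    have h0 : ContinuousAt (fun z : ℝ × M => (z.1, extChartAt 𝓘(ℝ, E) x₀ z.2)) (t₀, x₀) :=
      continuousAt_fst.prodMk
        (ContinuousAt.comp (f := Prod.snd) (continuousAt_extChartAt x₀) continuousAt_snd)
    have h1 := h0.eventually (eventually_mem_nhds_iff.2 hN)
    have h2 : ∀ᶠ z : ℝ × M in 𝓝 (t₀, x₀),
        ContinuousAt (fun z : ℝ × M => (z.1, extChartAt 𝓘(ℝ, E) x₀ z.2)) z ∧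
        z.2 ∈ (extChartAt 𝓘(ℝ, E) x₀).source := by
      filter_upwards [continuousAt_snd.preimage_mem_nhds
        (extChartAt_source_mem_nhds (I := 𝓘(ℝ, E)) x₀)] with z hsrc
      exact ⟨continuousAt_fst.prodMk
        (ContinuousAt.comp (continuousAt_extChartAt' hsrc) continuousAt_snd), hsrc⟩
    filter_upwards [h1.eventually_nhds, h2.eventually_nhds] with z hz hφ
    refine ⟨fun v => contMDiffAt_zero_of_eventually ?_,
      fun w => contMDiffAt_zero_of_eventually ?_, ?_⟩
    · filter_upwards [hz, hφ] with z' hz' hφ'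
      exact ContinuousAt.comp (f := fun z : ℝ × M => (z.1, extChartAt 𝓘(ℝ, E) x₀ z.2))
        ((hA v).continuousAt hz') hφ'.1
    · filter_upwards [hz, hφ] with z' hz' hφ'
      exact ContinuousAt.comp (f := fun z : ℝ × M => (z.1, extChartAt 𝓘(ℝ, E) x₀ z.2))
        ((hB w).continuousAt hz') hφ'.1
    · exact (exists_isCoordFrame_iff hφ.self_of_nhds.2 (K := K z.1)).1
        (hK _ (mem_of_mem_nhds hz.self_of_nhds))
  · rintro ⟨A, B, hAB⟩
    have h1 : Tendsto (fun p : ℝ × E => (p.1, (extChartAt 𝓘(ℝ, E) x₀).symm p.2))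
        (𝓝 (t₀, extChartAt 𝓘(ℝ, E) x₀ x₀)) (𝓝 (t₀, x₀)) := by
      have := (continuousAt_extChartAt_symm (I := 𝓘(ℝ, E)) x₀).tendsto
      rw [(extChartAt 𝓘(ℝ, E) x₀).left_inv (mem_extChartAt_source x₀)] at this
      exact (continuousAt_fst.tendsto).prodMk_nhds (this.comp continuousAt_snd.tendsto)
    refine ⟨_, inter_mem (h1.eventually hAB)
        (continuousAt_snd.preimage_mem_nhds
          (extChartAt_target_mem_nhds (I := 𝓘(ℝ, E)) x₀)),
      fun v p => A v (p.1, (extChartAt 𝓘(ℝ, E) x₀).symm p.2),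
      fun w p => B w (p.1, (extChartAt 𝓘(ℝ, E) x₀).symm p.2), fun v p hp => ?_, fun w p hp => ?_,
      fun p hp => ?_⟩
    · have hφ : ContinuousAt (fun p : ℝ × E => (p.1, (extChartAt 𝓘(ℝ, E) x₀).symm p.2)) p :=
        continuousAt_fst.prodMk
          (ContinuousAt.comp (continuousAt_extChartAt_symm'' hp.2) continuousAt_snd)
      exact (ContinuousAt.comp (f := fun p : ℝ × E => (p.1, (extChartAt 𝓘(ℝ, E) x₀).symm p.2))
        (hp.1.1 v).continuousAt hφ).continuousWithinAt
    · have hφ : ContinuousAt (fun p : ℝ × E => (p.1, (extChartAt 𝓘(ℝ, E) x₀).symm p.2)) p :=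
        continuousAt_fst.prodMk
          (ContinuousAt.comp (continuousAt_extChartAt_symm'' hp.2) continuousAt_snd)
      exact (ContinuousAt.comp (f := fun p : ℝ × E => (p.1, (extChartAt 𝓘(ℝ, E) x₀).symm p.2))
        (hp.1.2.1 w).continuousAt hφ).continuousWithinAt
    · obtain ⟨u, hu, hc⟩ := hp.1.2.2
      exact ⟨u, hu, (isCoordFrame_iff_hasCoords hp.2).2 hc⟩

end Fields

/-! ### The Levi form of a frame in a vector space. -/

section LeviForm

variable {V U E : Type*} [NormedAddCommGroup V] [NormedSpace ℝ V] [NormedAddCommGroup U]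
  [NormedSpace ℝ U] [NormedAddCommGroup E] [NormedSpace ℝ E]

/-- The Levi form of the distribution `R (V × 0)` in the frame `R` of `E`, where `D` is the
derivative of `R`. -/
noncomputable def leviForm (R : V × U →L[ℝ] E) (D : E →L[ℝ] V × U →L[ℝ] E) : AltMaps V U :=
  AltMaps.mk (LinearMap.mk₂ ℝ
    (fun a b => (R.inverse (D (R (a, 0)) (b, 0) - D (R (b, 0)) (a, 0))).2)
    (fun a a' b => by
      have h : (a + a', (0 : U)) = (a, 0) + (a', 0) := by simp
      rw [← Prod.snd_add, ← map_add R.inverse]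
      congr 2
      simp only [h, map_add, add_apply]
      abel)
    (fun c a b => by
      have h : (c • a, (0 : U)) = c • (a, (0 : U)) := by simp
      rw [← Prod.smul_snd, ← map_smul]
      simp only [h, map_smul, smul_apply, smul_sub])
    (fun a b b' => by
      have h : (b + b', (0 : U)) = (b, 0) + (b', 0) := by simp
      rw [← Prod.snd_add, ← map_add R.inverse]
      congr 2
      simp only [h, map_add, add_apply]
      abel)
    (fun c a b => by
      have h : (c • b, (0 : U)) = c • (b, (0 : U)) := by simp
      rw [← Prod.smul_snd, ← map_smul]
      simp only [h, map_smul, smul_apply, smul_sub])) fun a => by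
    simp

@[simp] theorem leviForm_apply (R : V × U →L[ℝ] E) (D : E →L[ℝ] V × U →L[ℝ] E) (a b : V) :
    (leviForm R D).toBilin a b = (R.inverse (D (R (a, 0)) (b, 0) - D (R (b, 0)) (a, 0))).2 := rfl

/-- Derivatives of the coefficients `f`, `g` contribute only vectors `R (·, 0)`, tangent to the
distribution, which the second component of `R⁻¹` kills. What remains is tensorial and involves only
the first derivative of `R`. -/
theorem lieBracket_eq_leviForm {R : E → V × U →L[ℝ] E} {y : E} (hR : DifferentiableAt ℝ R y)
    (hi : (R y).IsInvertible) {f g : E → V} (hf : DifferentiableAt ℝ f y)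
    (hg : DifferentiableAt ℝ g y) :
    ((R y).inverse (VectorField.lieBracket ℝ (fun y => R y (f y, 0)) (fun y => R y (g y, 0)) y)).2 =
      (leviForm (R y) (fderiv ℝ R y)).toBilin (f y) (g y) := by
  have key : ∀ h : E → V, DifferentiableAt ℝ h y → ∀ a : E,
      fderiv ℝ (fun y => R y (h y, 0)) y a = fderiv ℝ R y a (h y, 0) + R y (fderiv ℝ h y a, 0) := by
    intro h hh a
    have h1 : HasFDerivAt (fun y => (h y, (0 : U)))
        ((fderiv ℝ h y).prod (0 : E →L[ℝ] U)) y :=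
      hh.hasFDerivAt.prodMk (hasFDerivAt_const (0 : U) y)
    rw [(hR.hasFDerivAt.clm_apply h1).fderiv]
    simp [add_comm]
  obtain ⟨e, he⟩ := hi
  have h0 : ∀ a : V, ((R y).inverse (R y (a, 0))).2 = 0 := fun a => by
    rw [← he, ContinuousLinearMap.inverse_equiv]
    exact congrArg Prod.snd (e.symm_apply_apply (a, 0))
  rw [VectorField.lieBracket_eq]
  simp only [key g hg, key f hf, leviForm_apply, map_sub, map_add, Prod.snd_sub, Prod.snd_add, h0,
    add_zero]

variable [FiniteDimensional ℝ V] [FiniteDimensional ℝ U]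
  {EZ : Type*} [NormedAddCommGroup EZ] [NormedSpace ℝ EZ] {HZ : Type*} [TopologicalSpace HZ]
  {IZ : ModelWithCorners ℝ EZ HZ} {Z : Type*} [TopologicalSpace Z] [ChartedSpace HZ Z]

theorem AltMaps.contMDiffAt_of_apply {n : WithTop ℕ∞} {l : Z → AltMaps V U} {z : Z}
    (h : ∀ a b, ContMDiffAt IZ 𝓘(ℝ, U) n (fun z => (l z).toBilin a b) z) :
    ContMDiffAt IZ 𝓘(ℝ, AltMaps V U) n l z := by
  have h1 : ContMDiffAt IZ 𝓘(ℝ, V →L[ℝ] V →L[ℝ] U) n (fun z => AltMaps.toCLM (l z)) z :=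
    contMDiffAt_of_clm_apply fun a => contMDiffAt_of_clm_apply fun b => h a b
  have h2 : ContMDiffAt IZ 𝓘(ℝ, AltMaps V U) n
      (fun z => AltMaps.alternate (AltMaps.toCLM (l z))) z :=
    ContMDiffAt.clm_apply contMDiffAt_const h1
  refine h2.congr_of_eventuallyEq (Eventually.of_forall fun z => ?_)
  exact (AltMaps.alternate_eq fun x y => rfl).symm

theorem contMDiffAt_leviForm {n : WithTop ℕ∞} {R : Z → V × U →L[ℝ] E}
    {D : Z → E →L[ℝ] V × U →L[ℝ] E} {z : Z} (hR : ContMDiffAt IZ 𝓘(ℝ, V × U →L[ℝ] E) n R z)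
    (hi : (R z).IsInvertible) (hD : ContMDiffAt IZ 𝓘(ℝ, E →L[ℝ] V × U →L[ℝ] E) n D z) :
    ContMDiffAt IZ 𝓘(ℝ, AltMaps V U) n (fun z => leviForm (R z) (D z)) z := by
  refine AltMaps.contMDiffAt_of_apply fun a b => ?_
  have hRi := contMDiffAt_inverse hR hi
  have h1 : ∀ a b : V, ContMDiffAt IZ 𝓘(ℝ, E) n (fun z => D z (R z (a, 0)) (b, 0)) z := fun a b =>
    ContMDiffAt.clm_apply (hD.clm_apply (hR.clm_apply contMDiffAt_const)) contMDiffAt_const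
  exact ContMDiffAt.clm_apply (contMDiffAt_const (c := ContinuousLinearMap.snd ℝ V U))
    (hRi.clm_apply ((h1 a b).sub (h1 b a)))

end LeviForm

/-! ### The Levi bracket on a manifold, computed in a chart. -/

section Levi

variable {E : Type*} [NormedAddCommGroup E] [NormedSpace ℝ E] [CompleteSpace E]
  {M : Type*} [TopologicalSpace M] [ChartedSpace E M] [IsManifold 𝓘(ℝ, E) ∞ M]
  {L : Type*} [LieRing L] [LieAlgebra ℝ L] [FiniteDimensional ℝ L]
  {𝔤 : TwoGrading L}

omit [CompleteSpace E] in
theorem contMDiffAt_section_iff {x₁ x : M} (hx : x ∈ (extChartAt 𝓘(ℝ, E) x₁).source)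
    {X : (x : M) → TangentSpace 𝓘(ℝ, E) x} :
    ContMDiffAt 𝓘(ℝ, E) 𝓘(ℝ, E).tangent ∞ (fun y => (⟨y, X y⟩ : TangentBundle 𝓘(ℝ, E) M)) x ↔
      ContMDiffAt 𝓘(ℝ, E) 𝓘(ℝ, E) ∞
        (fun y => tangentCoordChange 𝓘(ℝ, E) y x₁ y (X y : E)) x := by
  have _ : IsManifold 𝓘(ℝ, E) (∞ + 1) M := ‹IsManifold 𝓘(ℝ, E) ∞ M›
  refine Bundle.Trivialization.contMDiffAt_section_iff
    (trivializationAt E (TangentSpace 𝓘(ℝ, E)) x₁) ?_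
  rw [extChartAt_source] at hx
  exact hx

/-- A vector field in the coordinates of the chart around `x₁`. -/
noncomputable def coordField (x₁ : M) (X : (x : M) → TangentSpace 𝓘(ℝ, E) x) (y : E) : E :=
  tangentCoordChange 𝓘(ℝ, E) ((extChartAt 𝓘(ℝ, E) x₁).symm y) x₁ ((extChartAt 𝓘(ℝ, E) x₁).symm y)
    (X ((extChartAt 𝓘(ℝ, E) x₁).symm y))

omit [CompleteSpace E] in
theorem coordMap_coordField {x₁ x : M} (hx : x ∈ (extChartAt 𝓘(ℝ, E) x₁).source)
    (X : (x : M) → TangentSpace 𝓘(ℝ, E) x) :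
    coordMap x₁ x (coordField x₁ X (extChartAt 𝓘(ℝ, E) x₁ x)) = X x := by
  rw [coordField, (extChartAt 𝓘(ℝ, E) x₁).left_inv hx]
  exact coordMap_tangentCoordChange_self hx _

omit [CompleteSpace E] in
theorem contDiffAt_coordField {x₁ x : M} (hx : x ∈ (extChartAt 𝓘(ℝ, E) x₁).source)
    {X : (x : M) → TangentSpace 𝓘(ℝ, E) x}
    (hX : ContMDiffAt 𝓘(ℝ, E) 𝓘(ℝ, E).tangent ∞
      (fun y => (⟨y, X y⟩ : TangentBundle 𝓘(ℝ, E) M)) x) :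
    ContDiffAt ℝ ∞ (coordField x₁ X) (extChartAt 𝓘(ℝ, E) x₁ x) := by
  rw [contMDiffAt_section_iff hx, ← (extChartAt 𝓘(ℝ, E) x₁).left_inv hx] at hX
  exact (ContMDiffAt.comp _ hX ((contMDiffOn_extChartAt_symm (I := 𝓘(ℝ, E)) (n := ∞)
    x₁).contMDiffAt ((isOpen_extChartAt_target x₁).mem_nhds
      ((extChartAt 𝓘(ℝ, E) x₁).map_source hx)))).contDiffAt

/-- The coordinate expression of a field is its pullback by the inverse chart, and brackets commute
with pullback. -/
theorem mlieBracket_eq_coordMap {x₁ x : M} (hx : x ∈ (extChartAt 𝓘(ℝ, E) x₁).source)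
    {X Y : (x : M) → TangentSpace 𝓘(ℝ, E) x}
    (hX : ContMDiffAt 𝓘(ℝ, E) 𝓘(ℝ, E).tangent ∞
      (fun y => (⟨y, X y⟩ : TangentBundle 𝓘(ℝ, E) M)) x)
    (hY : ContMDiffAt 𝓘(ℝ, E) 𝓘(ℝ, E).tangent ∞
      (fun y => (⟨y, Y y⟩ : TangentBundle 𝓘(ℝ, E) M)) x) :
    VectorField.mlieBracket 𝓘(ℝ, E) X Y x = coordMap x₁ x
      (VectorField.lieBracket ℝ (coordField x₁ X) (coordField x₁ Y)
        (extChartAt 𝓘(ℝ, E) x₁ x)) := by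
  obtain ⟨y, hy, rfl⟩ : ∃ y ∈ (extChartAt 𝓘(ℝ, E) x₁).target,
      (extChartAt 𝓘(ℝ, E) x₁).symm y = x :=
    ⟨_, (extChartAt 𝓘(ℝ, E) x₁).map_source hx, (extChartAt 𝓘(ℝ, E) x₁).left_inv hx⟩
  rw [(extChartAt 𝓘(ℝ, E) x₁).right_inv hy]
  have hinv : ∀ y' ∈ (extChartAt 𝓘(ℝ, E) x₁).target,
      ∀ Z : (x : M) → TangentSpace 𝓘(ℝ, E) x,
      (coordMap x₁ ((extChartAt 𝓘(ℝ, E) x₁).symm y') (VectorField.mpullback 𝓘(ℝ, E) 𝓘(ℝ, E)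
        (extChartAt 𝓘(ℝ, E) x₁).symm Z y' : E) : E) = Z ((extChartAt 𝓘(ℝ, E) x₁).symm y') := by
    intro y' hy' Z
    have hi : (mfderiv 𝓘(ℝ, E) 𝓘(ℝ, E) (extChartAt 𝓘(ℝ, E) x₁).symm y').IsInvertible := by
      have := isInvertible_mfderivWithin_extChartAt_symm hy'
      rwa [modelWithCornersSelf_coe, range_id, mfderivWithin_univ] at this
    refine (ofCoord_eq_coordMap hy' _).symm.trans ?_
    exact hi.self_apply_inverse _
  have heq : ∀ Z : (x : M) → TangentSpace 𝓘(ℝ, E) x,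
      VectorField.mpullback 𝓘(ℝ, E) 𝓘(ℝ, E) (extChartAt 𝓘(ℝ, E) x₁).symm Z =ᶠ[𝓝 y]
        coordField x₁ Z := by
    intro Z
    filter_upwards [(isOpen_extChartAt_target x₁).mem_nhds hy] with y' hy'
    have hs := (extChartAt 𝓘(ℝ, E) x₁).map_target hy'
    refine (coordEquiv hs).injective ?_
    refine (hinv y' hy' Z).trans ?_
    have := coordMap_coordField hs Z
    rw [(extChartAt 𝓘(ℝ, E) x₁).right_inv hy'] at this
    exact this.symm
  have _ : IsManifold 𝓘(ℝ, E) (minSmoothness ℝ 2) M := IsManifold.of_le (n := ∞)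
    (by rw [minSmoothness_of_isRCLikeNormedField]; exact ENat.LEInfty.out)
  have h1 := VectorField.mpullback_mlieBracket (I := 𝓘(ℝ, E)) (I' := 𝓘(ℝ, E)) (n := ∞)
    (f := (extChartAt 𝓘(ℝ, E) x₁).symm) (x₀ := y) (hX.mdifferentiableAt (by simp))
    (hY.mdifferentiableAt (by simp))
    ((contMDiffOn_extChartAt_symm x₁).contMDiffAt ((isOpen_extChartAt_target x₁).mem_nhds hy))
    (by rw [minSmoothness_of_isRCLikeNormedField]; exact ENat.LEInfty.out)
  have h2 := hinv y hy (VectorField.mlieBracket 𝓘(ℝ, E) X Y)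
  rw [← h2]
  refine congrArg (fun a : E => coordMap x₁ ((extChartAt 𝓘(ℝ, E) x₁).symm y) a) (h1.trans ?_)
  refine ((heq X).mlieBracket_vectorField_eq (heq Y)).trans ?_
  exact (congrFun VectorField.mlieBracketWithin_univ.symm y).trans
    ((congrFun VectorField.mlieBracketWithin_eq_lieBracketWithin y).trans
      (congrFun VectorField.lieBracketWithin_univ y))

/-- The Levi bracket of a distribution that is given by a frame `R` in the chart around `x₁`. -/
theorem isLevi_iff {H : (x : M) → Submodule ℝ (TangentSpace 𝓘(ℝ, E) x)} {x₁ x : M}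
    (hx : x ∈ (extChartAt 𝓘(ℝ, E) x₁).source)
    {R : E → 𝔤.piece (-1) × 𝔤.piece (-2) →L[ℝ] E}
    (hR : ContDiffAt ℝ ∞ R (extChartAt 𝓘(ℝ, E) x₁ x))
    (hi : ∀ᶠ x' in 𝓝 x, (R (extChartAt 𝓘(ℝ, E) x₁ x')).IsInvertible)
    (hH : ∀ᶠ x' in 𝓝 x, ∀ a : E, (coordMap x₁ x' a : E) ∈ H x' ↔
      ((R (extChartAt 𝓘(ℝ, E) x₁ x')).inverse a).2 = 0)
    {u : GradedFrame 𝔤 (H x)}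
    (hu : HasCoords 𝔤 x₁ x u (fun v => R (extChartAt 𝓘(ℝ, E) x₁ x) (v, 0))
      (fun w => R (extChartAt 𝓘(ℝ, E) x₁ x) (0, w))) (l : 𝔤.W) :
    IsLevi 𝔤 H x u l ↔ l = leviForm (R (extChartAt 𝓘(ℝ, E) x₁ x))
      (fderiv ℝ R (extChartAt 𝓘(ℝ, E) x₁ x)) := by
  set y := extChartAt 𝓘(ℝ, E) x₁ x with hy
  have hsrc := (isOpen_extChartAt_source (I := 𝓘(ℝ, E)) x₁).mem_nhds hx
  have htend : Tendsto (extChartAt 𝓘(ℝ, E) x₁).symm (𝓝 y) (𝓝 x) := by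
    have := (continuousAt_extChartAt_symm' (I := 𝓘(ℝ, E)) hx).tendsto
    rwa [(extChartAt 𝓘(ℝ, E) x₁).left_inv hx] at this
  have hRd : DifferentiableAt ℝ R y := hR.differentiableAt (by simp)
  have hRi : ContDiffAt ℝ ∞ (fun y => (R y).inverse) y :=
    (contMDiffAt_inverse hR.contMDiffAt hi.self_of_nhds).contDiffAt
  have hlevi : IsLevi 𝔤 H x u (leviForm (R y) (fderiv ℝ R y)) := by
    intro X Y hX hY hXY v w hv hw
    -- Every smooth local section of `H` is, in coordinates, `R (f, 0)` with `f` the first component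
    -- of `R⁻¹` applied to it.
    have hpr : ∀ Z : (x : M) → TangentSpace 𝓘(ℝ, E) x,
        ContMDiffAt 𝓘(ℝ, E) 𝓘(ℝ, E).tangent ∞
          (fun y => (⟨y, Z y⟩ : TangentBundle 𝓘(ℝ, E) M)) x → (∀ᶠ y in 𝓝 x, Z y ∈ H y) →
        ∀ v, Z x = u.fst v → ∃ f : E → 𝔤.piece (-1), DifferentiableAt ℝ f y ∧ f y = v ∧
          coordField x₁ Z =ᶠ[𝓝 y] fun y => R y (f y, 0) := by
      intro Z hZ hZH v hv
      refine ⟨fun y => ((R y).inverse (coordField x₁ Z y)).1, ?_, ?_, ?_⟩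
      · exact ((hRi.clm_apply (contDiffAt_coordField hx hZ)).fst).differentiableAt (by simp)
      · have h1 : coordField x₁ Z y = R y (v, 0) := by
          refine (coordEquiv hx).injective ?_
          exact (coordMap_coordField hx Z).trans (hv.trans (hu.1 v))
        simp only [h1]
        exact congrArg Prod.fst (hi.self_of_nhds.inverse_apply_self _)
      · filter_upwards [htend.eventually hi, htend.eventually hH, htend.eventually hZH,
          htend.eventually hsrc, (isOpen_extChartAt_target x₁).mem_nhds
            ((extChartAt 𝓘(ℝ, E) x₁).map_source hx)] with y' a1 a2 a3 a4 a5
        rw [(extChartAt 𝓘(ℝ, E) x₁).right_inv a5] at a1 a2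
        have h1 := coordMap_coordField a4 Z
        rw [(extChartAt 𝓘(ℝ, E) x₁).right_inv a5] at h1
        have h2 := (a2 (coordField x₁ Z y')).1 (by rw [h1]; exact a3)
        have h4 : (((R y').inverse (coordField x₁ Z y')).1, (0 : 𝔤.piece (-2))) =
            (R y').inverse (coordField x₁ Z y') := Prod.ext rfl h2.symm
        rw [h4, a1.self_apply_inverse]
    obtain ⟨f, hf, hfv, hfX⟩ := hpr X hX (hXY.mono fun _ h => h.1) v hv
    obtain ⟨g, hg, hgw, hgY⟩ := hpr Y hY (hXY.mono fun _ h => h.2) w hw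
    have h1 := lieBracket_eq_leviForm hRd hi.self_of_nhds hf hg
    rw [← hfX.lieBracket_vectorField_eq hgY, hfv, hgw] at h1
    rw [mlieBracket_eq_coordMap hx hX hY, hu.2]
    refine (Submodule.Quotient.eq _).2 ?_
    have h2 := (hH.self_of_nhds (VectorField.lieBracket ℝ (coordField x₁ X) (coordField x₁ Y) y -
      R y (0, (leviForm (R y) (fderiv ℝ R y)).toBilin v w))).2 (by
        rw [map_sub, Prod.snd_sub, h1, sub_eq_zero]
        exact (congrArg Prod.snd (hi.self_of_nhds.inverse_apply_self
          (0, (leviForm (R y) (fderiv ℝ R y)).toBilin v w))).symm)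
    rw [map_sub] at h2
    exact h2
  refine ⟨fun hl => ?_, fun hl => hl ▸ hlevi⟩
  refine AltMaps.ext fun v w => ?_
  -- Uniqueness: the fields `R (v, 0)` are smooth sections of `H` with any prescribed value at `x`,
  -- so the condition `IsLevi` is never vacuous and determines `l`.
  let X : 𝔤.piece (-1) → (x : M) → TangentSpace 𝓘(ℝ, E) x :=
    fun v x' => (coordMap x₁ x' (R (extChartAt 𝓘(ℝ, E) x₁ x') (v, 0)) : E)
  have hX : ∀ v, ContMDiffAt 𝓘(ℝ, E) 𝓘(ℝ, E).tangent ∞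
      (fun y => (⟨y, X v y⟩ : TangentBundle 𝓘(ℝ, E) M)) x := by
    intro v
    rw [contMDiffAt_section_iff hx]
    have h1 : ContMDiffAt 𝓘(ℝ, E) 𝓘(ℝ, E) ∞
        (fun x' => R (extChartAt 𝓘(ℝ, E) x₁ x') (v, 0)) x :=
      ContMDiffAt.clm_apply (ContMDiffAt.comp x hR.contMDiffAt
        (contMDiffAt_extChartAt' (by rwa [extChartAt_source] at hx))) contMDiffAt_const
    refine h1.congr_of_eventuallyEq ?_
    filter_upwards [hsrc] with x' hx' using tangentCoordChange_coordMap hx' _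
  have hXH : ∀ v, ∀ᶠ x' in 𝓝 x, X v x' ∈ H x' := by
    intro v
    filter_upwards [hi, hH] with x' h1 h2
    exact (h2 _).2 (congrArg Prod.snd (h1.inverse_apply_self _))
  have e1 := hl (X v) (X w) (hX v) (hX w) ((hXH v).and (hXH w)) v w (hu.1 v).symm (hu.1 w).symm
  have e2 := hlevi (X v) (X w) (hX v) (hX w) ((hXH v).and (hXH w)) v w (hu.1 v).symm
    (hu.1 w).symm
  exact u.snd.injective (e1.symm.trans e2)

end Levi

/-! ### Reference frames adapted to a continuous family of distributions. -/

section ReferenceFrame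

variable {E : Type*} [NormedAddCommGroup E] [NormedSpace ℝ E] [FiniteDimensional ℝ E]
  {M : Type*} [TopologicalSpace M] [ChartedSpace E M] [IsManifold 𝓘(ℝ, E) ∞ M]
  {L : Type*} [LieRing L] [LieAlgebra ℝ L] [FiniteDimensional ℝ L]
  {𝔤 : TwoGrading L}

theorem continuousAt_sum_comp {ι Z A B C : Type*} [Fintype ι] [TopologicalSpace Z]
    [NormedAddCommGroup A] [NormedSpace ℝ A] [NormedAddCommGroup B] [NormedSpace ℝ B]
    [NormedAddCommGroup C] [NormedSpace ℝ C] (T : ι → B →L[ℝ] C) {f : ι → Z → A →L[ℝ] B} {z : Z}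
    (hf : ∀ i, ContinuousAt (f i) z) : ContinuousAt (fun z => ∑ i, (T i).comp (f i z)) z :=
  tendsto_finsetSum _ fun i _ => continuousAt_const.clm_comp (hf i)

/-- Near each `(t₀, x₀)` a continuous family of distributions is given by frames of the tangent
spaces, in the chart around `x₀`. -/
theorem IsContinuousFamily.exists_frame {J : Set ℝ}
    {H : ℝ → (x : M) → Submodule ℝ (TangentSpace 𝓘(ℝ, E) x)}
    (hH : IsContinuousFamily J (Module.finrank ℝ (𝔤.piece (-1))) H)
    (hrank : ∀ t ∈ J, ∀ x,
      Module.finrank ℝ (H t x) = Module.finrank ℝ (𝔤.piece (-1)) ∧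
      Module.finrank ℝ (TangentSpace 𝓘(ℝ, E) x ⧸ H t x) = Module.finrank ℝ (𝔤.piece (-2)))
    {t₀ : ℝ} (ht₀ : t₀ ∈ J) (x₀ : M) :
    ∃ R : ℝ → E → 𝔤.piece (-1) × 𝔤.piece (-2) →L[ℝ] E,
      ∀ᶠ p : ℝ × E in 𝓝 (t₀, extChartAt 𝓘(ℝ, E) x₀ x₀),
        ContDiffAt ℝ ∞ (R p.1) p.2 ∧ ContinuousAt (fun p : ℝ × E => R p.1 p.2) p ∧
        ContinuousAt (fun p : ℝ × E => fderiv ℝ (R p.1) p.2) p ∧ (R p.1 p.2).IsInvertible ∧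
        ∀ a : E, (ofCoord x₀ p.2 a ∈ H p.1 ((extChartAt 𝓘(ℝ, E) x₀).symm p.2) ↔
          ((R p.1 p.2).inverse a).2 = 0) := by
  obtain ⟨N, hN, X, hX1, hX2, hX3, hX4⟩ := hH t₀ ht₀ x₀
  set p₀ : ℝ × E := (t₀, extChartAt 𝓘(ℝ, E) x₀ x₀) with hp₀
  let b := Module.finBasis ℝ (𝔤.piece (-1))
  let c : Fin (Module.finrank ℝ (𝔤.piece (-1))) → (𝔤.piece (-1) × 𝔤.piece (-2) →L[ℝ] ℝ) :=
    fun i => (LinearMap.toContinuousLinearMap (b.coord i)).comp (ContinuousLinearMap.fst ℝ _ _)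
  let T : Fin (Module.finrank ℝ (𝔤.piece (-1))) → (E →L[ℝ] 𝔤.piece (-1) × 𝔤.piece (-2) →L[ℝ] E) :=
    fun i => ContinuousLinearMap.smulRightL ℝ (𝔤.piece (-1) × 𝔤.piece (-2)) E (c i)
  -- The fields `X i` are completed to a frame of `E` by a constant complement chosen at the base
  -- point.
  obtain ⟨C, hC⟩ := (Submodule.span ℝ (range fun i => X i p₀.1 p₀.2)).exists_isCompl
  have hli := (hX4 p₀ (mem_of_mem_nhds hN)).1
  have hdim : Module.finrank ℝ (𝔤.piece (-1)) + Module.finrank ℝ (𝔤.piece (-2)) =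
      Module.finrank ℝ E := by
    have _ : FiniteDimensional ℝ (TangentSpace 𝓘(ℝ, E) x₀) :=
      inferInstanceAs (FiniteDimensional ℝ E)
    have h := (H t₀ x₀).finrank_quotient_add_finrank
    rw [(hrank t₀ ht₀ x₀).1, (hrank t₀ ht₀ x₀).2, add_comm] at h
    exact h
  have hCdim : Module.finrank ℝ (𝔤.piece (-2)) = Module.finrank ℝ C := by
    have h := Submodule.finrank_add_eq_of_isCompl hC
    rw [finrank_span_eq_card hli, Fintype.card_fin] at h
    omega
  let j : 𝔤.piece (-2) ≃ₗ[ℝ] C := LinearEquiv.ofFinrankEq _ _ hCdim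
  let j' : 𝔤.piece (-1) × 𝔤.piece (-2) →L[ℝ] E :=
    LinearMap.toContinuousLinearMap (C.subtype ∘ₗ j.toLinearMap ∘ₗ LinearMap.snd ℝ _ _)
  let R : ℝ → E → 𝔤.piece (-1) × 𝔤.piece (-2) →L[ℝ] E := fun t y => ∑ i, T i (X i t y) + j'
  have hRapply : ∀ t y v w, R t y (v, w) = ∑ i, b.repr v i • X i t y + (j w : E) := by
    intro t y v w
    simp [R, T, c, j']
  have hcont : ∀ p, N ∈ 𝓝 p → ContinuousAt (fun p : ℝ × E => R p.1 p.2) p := by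
    intro p hp
    refine ContinuousAt.add (tendsto_finsetSum _ fun i _ => ?_) continuousAt_const
    exact (T i).continuous.continuousAt.comp ((hX2 i).continuousAt hp)
  have hinv : (R p₀.1 p₀.2).IsInvertible := by
    have hinj : Function.Injective (R p₀.1 p₀.2) := by
      rw [injective_iff_map_eq_zero]
      rintro ⟨v, w⟩ hvw
      rw [hRapply] at hvw
      have h1 : ∑ i, b.repr v i • X i p₀.1 p₀.2 ∈
          Submodule.span ℝ (range fun i => X i p₀.1 p₀.2) :=
        Submodule.sum_mem _ fun i _ => Submodule.smul_mem _ _ (Submodule.subset_span ⟨i, rfl⟩)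
      have h2 : ∑ i, b.repr v i • X i p₀.1 p₀.2 = 0 := by
        refine Submodule.disjoint_def.1 hC.disjoint _ h1 ?_
        rw [eq_neg_of_add_eq_zero_left hvw]
        exact C.neg_mem (j w).2
      have h3 : (j w : E) = 0 := by rwa [h2, zero_add] at hvw
      have h4 : v = 0 := by
        refine b.ext_elem fun i => ?_
        rw [Fintype.linearIndependent_iff.1 hli _ h2 i]
        simp
      have h5 : w = 0 := j.map_eq_zero_iff.1 (Subtype.ext h3)
      rw [h4, h5]
      rfl
    have hfin : Module.finrank ℝ (𝔤.piece (-1) × 𝔤.piece (-2)) = Module.finrank ℝ E := by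
      rw [Module.finrank_prod, hdim]
    exact ⟨(LinearEquiv.ofInjectiveOfFinrankEq _ hinj hfin).toContinuousLinearEquiv, rfl⟩
  -- Invertibility is an open condition, so the constant complement remains one at nearby `(t, x)`.
  have hev : ∀ᶠ p in 𝓝 p₀, (R p.1 p.2).IsInvertible := by
    obtain ⟨e, he⟩ := hinv
    have h1 := e.nhds
    rw [he] at h1
    exact (hcont p₀ hN).eventually h1
  have htarget : ∀ᶠ p : ℝ × E in 𝓝 p₀, p.2 ∈ (extChartAt 𝓘(ℝ, E) x₀).target :=
    continuousAt_snd.preimage_mem_nhds (extChartAt_target_mem_nhds (I := 𝓘(ℝ, E)) x₀)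
  refine ⟨R, ?_⟩
  filter_upwards [eventually_mem_nhds_iff.2 hN, hev, htarget] with p hp hip hpt
  have hpN := mem_of_mem_nhds hp
  refine ⟨?_, hcont p hp, ?_, hip, fun a => ?_⟩
  · refine ContDiffAt.add (ContDiffAt.sum fun i _ => ?_) contDiffAt_const
    exact ContDiffAt.clm_apply contDiffAt_const (hX1 i p hpN)
  · have h1 : ∀ q ∈ N, fderiv ℝ (R q.1) q.2 = ∑ i, (T i).comp (fderiv ℝ (X i q.1) q.2) := by
      intro q hq
      have h2 : HasFDerivAt (R q.1) (∑ i, (T i).comp (fderiv ℝ (X i q.1) q.2)) q.2 := by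
        refine HasFDerivAt.add_const j' (HasFDerivAt.fun_sum fun i _ => ?_)
        exact (T i).hasFDerivAt.comp q.2
          (((hX1 i q hq).differentiableAt (by simp)).hasFDerivAt)
      exact h2.fderiv
    have h2 : ContinuousAt (fun q : ℝ × E => ∑ i, (T i).comp (fderiv ℝ (X i q.1) q.2)) p :=
      continuousAt_sum_comp T fun i => (hX3 i).continuousAt hp
    refine h2.congr ?_
    filter_upwards [hp] with q hq using (h1 q hq).symm
  · have hofinj : Function.Injective (ofCoord x₀ p.2 : E →ₗ[ℝ] _) := by
      intro a a' h
      rw [ofCoord_eq_coordMap hpt, ofCoord_eq_coordMap hpt] at h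
      exact (coordEquiv ((extChartAt 𝓘(ℝ, E) x₀).map_target hpt)).injective h
    have h1 : ofCoord x₀ p.2 a ∈ H p.1 ((extChartAt 𝓘(ℝ, E) x₀).symm p.2) ↔
        a ∈ Submodule.span ℝ (range fun i => X i p.1 p.2) := by
      rw [(hX4 p hpN).2, show (range fun i => ofCoord x₀ p.2 (X i p.1 p.2)) =
        ofCoord x₀ p.2 '' (range fun i => X i p.1 p.2) by rw [← range_comp]; rfl,
        ← Submodule.map_span]
      exact ⟨fun ⟨a', ha', h⟩ => hofinj h ▸ ha', fun h => ⟨a, h, rfl⟩⟩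
    rw [h1]
    constructor
    · intro ha
      obtain ⟨f, rfl⟩ := (Submodule.mem_span_range_iff_exists_fun ℝ).1 ha
      have h2 : R p.1 p.2 (b.equivFun.symm f, 0) = ∑ i, f i • X i p.1 p.2 := by
        rw [hRapply, map_zero]
        simp only [ZeroMemClass.coe_zero, add_zero]
        refine Finset.sum_congr rfl fun i _ => ?_
        rw [← b.equivFun_apply, LinearEquiv.apply_symm_apply]
      rw [← h2]
      exact congrArg Prod.snd (hip.inverse_apply_self _)
    · intro ha
      have h2 := hip.self_apply_inverse a
      rw [show (R p.1 p.2).inverse a = (((R p.1 p.2).inverse a).1, 0) from Prod.ext rfl ha,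
        hRapply, map_zero] at h2
      rw [← h2]
      simp only [ZeroMemClass.coe_zero, add_zero]
      exact Submodule.sum_mem _ fun i _ => Submodule.smul_mem _ _ (Submodule.subset_span ⟨i, rfl⟩)

omit [FiniteDimensional ℝ L] in
-- The hypothesis says that `e` carries `𝔤₋₁ × 0` onto `Hx`, so `e` induces isomorphisms onto `Hx`
-- and onto the quotient.
theorem GradedFrame.exists_of_equiv {T : Type*} [AddCommGroup T] [Module ℝ T] {Hx : Submodule ℝ T}
    (e : (𝔤.piece (-1) × 𝔤.piece (-2)) ≃ₗ[ℝ] T) (he : ∀ z, e z ∈ Hx ↔ z.2 = 0) :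
    ∃ u : GradedFrame 𝔤 Hx, (∀ v, (u.fst v : T) = e (v, 0)) ∧
      ∀ w, u.snd w = Hx.mkQ (e (0, w)) := by
  let f : 𝔤.piece (-1) →ₗ[ℝ] Hx :=
    LinearMap.codRestrict Hx (e.toLinearMap ∘ₗ LinearMap.inl ℝ _ _) fun v => (he _).2 rfl
  let g : 𝔤.piece (-2) →ₗ[ℝ] T ⧸ Hx := Hx.mkQ ∘ₗ e.toLinearMap ∘ₗ LinearMap.inr ℝ _ _
  have hf : Function.Bijective f := by
    refine ⟨fun v v' h => ?_, fun x => ?_⟩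
    · exact congrArg Prod.fst (e.injective (congrArg Subtype.val h))
    · refine ⟨(e.symm x).1, Subtype.ext ?_⟩
      have h : (e.symm x).2 = 0 := (he _).1 (by rw [e.apply_symm_apply]; exact x.2)
      change e ((e.symm x).1, 0) = x
      rw [← h]
      exact e.apply_symm_apply _
  have hg : Function.Bijective g := by
    refine ⟨?_, fun q => ?_⟩
    · rw [injective_iff_map_eq_zero]
      intro w hw
      exact (he (0, w)).1 ((Submodule.Quotient.mk_eq_zero _).1 hw)
    · obtain ⟨x, rfl⟩ := Hx.mkQ_surjective q
      refine ⟨(e.symm x).2, (Submodule.Quotient.eq _).2 ?_⟩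
      change e (0, (e.symm x).2) - x ∈ Hx
      have h : e (0, (e.symm x).2) - e (e.symm x) = e (-(e.symm x).1, 0) := by
        rw [← map_sub]
        exact congrArg e (Prod.ext (zero_sub _) (sub_self _))
      rw [e.apply_symm_apply] at h
      rw [h]
      exact (he _).2 rfl
  exact ⟨⟨LinearEquiv.ofBijective f hf, LinearEquiv.ofBijective g hg⟩, fun v => rfl, fun w => rfl⟩

end ReferenceFrame

/-! ### Local models, which hide charts from the rest of the argument. -/

section LocalModel

variable {E : Type*} [NormedAddCommGroup E] [NormedSpace ℝ E]
  {M : Type*} [TopologicalSpace M] [ChartedSpace E M] [IsManifold 𝓘(ℝ, E) ∞ M]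
  {L : Type*} [LieRing L] [LieAlgebra ℝ L] [FiniteDimensional ℝ L]

/-- A reference frame for a family of distributions over an open subset of `ℝ × M`, together with
its Levi form. -/
structure LocalModel (𝔤 : TwoGrading L)
    (H : ℝ → (x : M) → Submodule ℝ (TangentSpace 𝓘(ℝ, E) x)) where
  /-- the domain -/
  dom : Set (ℝ × M)
  isOpen_dom : IsOpen dom
  /-- the reference frame -/
  frame : ∀ p ∈ dom, GradedFrame 𝔤 (H p.1 p.2)
  /-- the Levi form in the reference frame -/
  levi : ℝ × M → 𝔤.W
  continuousAt_levi : ∀ p ∈ dom, ContinuousAt levi p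
  contMDiffAt_levi : ∀ p ∈ dom, ContMDiffAt 𝓘(ℝ, E) 𝓘(ℝ, 𝔤.W) ∞ (fun x => levi (p.1, x)) p.2
  isLevi_iff : ∀ p hp l, IsLevi 𝔤 (H p.1) p.2 (frame p hp) l ↔ l = levi p
  hasContinuousSection_iff : ∀ K : (t : ℝ) → (x : M) → Set (GradedFrame 𝔤 (H t x)), ∀ p ∈ dom,
    HasContinuousSection H K p.2 p ↔ ∃ σ : ℝ × M → 𝔤.S, ∀ᶠ q in 𝓝 p, ContinuousAt σ q ∧
      ∀ hq, (frame q hq).comp (σ q) ∈ K q.1 q.2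
  hasSmoothSection_iff : ∀ t, ∀ K : (x : M) → Set (GradedFrame 𝔤 (H t x)), ∀ x, (t, x) ∈ dom →
    (HasSmoothSection (H t) K x x ↔ ∃ σ : M → 𝔤.S, ∀ᶠ x' in 𝓝 x,
      ContMDiffAt 𝓘(ℝ, E) 𝓘(ℝ, 𝔤.EndPair) ∞ (fun x => TwoGrading.endPair (σ x)) x' ∧
      ∀ hx', (frame (t, x') hx').comp (σ x') ∈ K x')

theorem IsContinuousFamily.exists_localModel [FiniteDimensional ℝ E] {𝔤 : TwoGrading L} {J : Set ℝ}
    {H : ℝ → (x : M) → Submodule ℝ (TangentSpace 𝓘(ℝ, E) x)}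
    (hH : IsContinuousFamily J (Module.finrank ℝ (𝔤.piece (-1))) H)
    (hrank : ∀ t ∈ J, ∀ x,
      Module.finrank ℝ (H t x) = Module.finrank ℝ (𝔤.piece (-1)) ∧
      Module.finrank ℝ (TangentSpace 𝓘(ℝ, E) x ⧸ H t x) = Module.finrank ℝ (𝔤.piece (-2)))
    {t₀ : ℝ} (ht₀ : t₀ ∈ J) (x₀ : M) : ∃ m : LocalModel 𝔤 H, (t₀, x₀) ∈ m.dom := by
  obtain ⟨R, hR⟩ := hH.exists_frame hrank ht₀ x₀
  have h0 : ContinuousAt (fun z : ℝ × M => (z.1, extChartAt 𝓘(ℝ, E) x₀ z.2)) (t₀, x₀) :=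
    continuousAt_fst.prodMk
      (ContinuousAt.comp (f := Prod.snd) (continuousAt_extChartAt x₀) continuousAt_snd)
  have h1 := (h0.eventually hR).and (continuousAt_snd.preimage_mem_nhds
    (extChartAt_source_mem_nhds (I := 𝓘(ℝ, E)) x₀) :
      ∀ᶠ z : ℝ × M in 𝓝 (t₀, x₀), z.2 ∈ (extChartAt 𝓘(ℝ, E) x₀).source)
  obtain ⟨D, hDsub, hDopen, hD0⟩ := mem_nhds_iff.1 h1
  have hmem : ∀ q ∈ D, ∀ a : E, (coordMap x₀ q.2 a : E) ∈ H q.1 q.2 ↔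
      ((R q.1 (extChartAt 𝓘(ℝ, E) x₀ q.2)).inverse a).2 = 0 := by
    intro q hq a
    have h2 := (hDsub hq).1.2.2.2.2 a
    have hsrc := (hDsub hq).2
    rw [← h2]
    have h3 := ofCoord_eq_coordMap ((extChartAt 𝓘(ℝ, E) x₀).map_source hsrc) a
    rw [(extChartAt 𝓘(ℝ, E) x₀).left_inv hsrc] at h3
    -- The tangent spaces at both points are modelled by the same `E`, so membership transfers along
    -- the equality of points.
    have h4 : ∀ x' : M, x' = q.2 → ∀ v : E, v ∈ H q.1 x' ↔ v ∈ H q.1 q.2 := by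
      rintro _ rfl v
      rfl
    rw [← h3]
    exact (h4 _ ((extChartAt 𝓘(ℝ, E) x₀).left_inv hsrc) _).symm
  have hframe : ∀ q ∈ D, ∃ u : GradedFrame 𝔤 (H q.1 q.2), HasCoords 𝔤 x₀ q.2 u
      (fun v => R q.1 (extChartAt 𝓘(ℝ, E) x₀ q.2) (v, 0))
      (fun w => R q.1 (extChartAt 𝓘(ℝ, E) x₀ q.2) (0, w)) := by
    intro q hq
    obtain ⟨e, he⟩ := (hDsub hq).1.2.2.2.1
    have he' : ∀ z, R q.1 (extChartAt 𝓘(ℝ, E) x₀ q.2) z = e z := fun z => by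
      rw [← he]
      rfl
    obtain ⟨u, hu⟩ := GradedFrame.exists_of_equiv (T := TangentSpace 𝓘(ℝ, E) q.2)
      (Hx := H q.1 q.2) (e.trans (coordEquiv (hDsub hq).2)).toLinearEquiv (fun z => by
        refine (hmem q hq (e z)).trans ?_
        rw [← he' z, (hDsub hq).1.2.2.2.1.inverse_apply_self])
    refine ⟨u, fun v => (hu.1 v).trans ?_, fun w => (hu.2 w).trans ?_⟩
    · exact congrArg (fun a : E => coordMap x₀ q.2 a) (he' (v, 0)).symm
    · exact congrArg (fun a : E => (H q.1 q.2).mkQ (coordMap x₀ q.2 a : E)) (he' (0, w)).symm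
  choose frame hframe using hframe
  have hRc : ∀ q ∈ D, ContMDiffAt (𝓘(ℝ, ℝ).prod 𝓘(ℝ, E))
      𝓘(ℝ, 𝔤.piece (-1) × 𝔤.piece (-2) →L[ℝ] E) 0
      (fun q : ℝ × M => R q.1 (extChartAt 𝓘(ℝ, E) x₀ q.2)) q := by
    intro q hq
    refine contMDiffAt_zero_of_eventually ?_
    filter_upwards [hDopen.mem_nhds hq] with q' hq'
    exact ContinuousAt.comp (f := fun z : ℝ × M => (z.1, extChartAt 𝓘(ℝ, E) x₀ z.2))
      (hDsub hq').1.2.1 (continuousAt_fst.prodMk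
        (ContinuousAt.comp (continuousAt_extChartAt' (hDsub hq').2) continuousAt_snd))
  have hDc : ∀ q ∈ D, ContMDiffAt (𝓘(ℝ, ℝ).prod 𝓘(ℝ, E))
      𝓘(ℝ, E →L[ℝ] 𝔤.piece (-1) × 𝔤.piece (-2) →L[ℝ] E) 0
      (fun q : ℝ × M => fderiv ℝ (R q.1) (extChartAt 𝓘(ℝ, E) x₀ q.2)) q := by
    intro q hq
    refine contMDiffAt_zero_of_eventually ?_
    filter_upwards [hDopen.mem_nhds hq] with q' hq'
    exact ContinuousAt.comp (f := fun z : ℝ × M => (z.1, extChartAt 𝓘(ℝ, E) x₀ z.2))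
      (hDsub hq').1.2.2.1 (continuousAt_fst.prodMk
        (ContinuousAt.comp (continuousAt_extChartAt' (hDsub hq').2) continuousAt_snd))
  have hφ : ∀ q ∈ D, ContMDiffAt 𝓘(ℝ, E) 𝓘(ℝ, E) ∞ (extChartAt 𝓘(ℝ, E) x₀) q.2 := fun q hq =>
    contMDiffAt_extChartAt' (by
      have h2 := (hDsub hq).2
      rwa [extChartAt_source] at h2)
  have hRs : ∀ q ∈ D, ContMDiffAt 𝓘(ℝ, E) 𝓘(ℝ, 𝔤.piece (-1) × 𝔤.piece (-2) →L[ℝ] E) ∞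
      (fun x : M => R q.1 (extChartAt 𝓘(ℝ, E) x₀ x)) q.2 := fun q hq =>
    ContMDiffAt.comp q.2 (hDsub hq).1.1.contMDiffAt (hφ q hq)
  have hDs : ∀ q ∈ D, ContMDiffAt 𝓘(ℝ, E)
      𝓘(ℝ, E →L[ℝ] 𝔤.piece (-1) × 𝔤.piece (-2) →L[ℝ] E) ∞
      (fun x : M => fderiv ℝ (R q.1) (extChartAt 𝓘(ℝ, E) x₀ x)) q.2 := fun q hq =>
    ContMDiffAt.comp q.2 ((hDsub hq).1.1.fderiv_right (m := ∞) le_rfl).contMDiffAt (hφ q hq)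
  have hslice : ∀ q ∈ D, ∀ᶠ x in 𝓝 q.2, (q.1, x) ∈ D := fun q hq =>
    (Continuous.prodMk_right q.1).continuousAt.preimage_mem_nhds (hDopen.mem_nhds hq)
  refine ⟨{ dom := D, isOpen_dom := hDopen, frame := frame,
            levi := fun q => leviForm (R q.1 (extChartAt 𝓘(ℝ, E) x₀ q.2))
              (fderiv ℝ (R q.1) (extChartAt 𝓘(ℝ, E) x₀ q.2))
            continuousAt_levi := fun q hq =>
              (contMDiffAt_leviForm (hRc q hq) (hDsub hq).1.2.2.2.1 (hDc q hq)).continuousAt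
            contMDiffAt_levi := fun q hq =>
              contMDiffAt_leviForm (hRs q hq) (hDsub hq).1.2.2.2.1 (hDs q hq)
            isLevi_iff := fun q hq l => ?_
            hasContinuousSection_iff := fun K q hq => ?_
            hasSmoothSection_iff := fun t K x hx => ?_ }, hD0⟩
  · refine PartialReg.isLevi_iff (hDsub hq).2 (hDsub hq).1.1 ?_ ?_ (hframe q hq) l
    · filter_upwards [hslice q hq] with x hx using (hDsub hx).1.2.2.2.1
    · filter_upwards [hslice q hq] with x hx using hmem _ hx
  · have h2 := hasLocalSection_iff (n := 0) (IZ := 𝓘(ℝ, ℝ).prod 𝓘(ℝ, E))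
      (π := (Prod.snd : ℝ × M → M)) (H := fun z => H z.1 z.2) (K := fun z => K z.1 z.2)
      (hDopen.mem_nhds hq) (fun z hz => (hDsub hz).2) hRc
      (fun z hz => (hDsub hz).1.2.2.2.1) (uref := frame) hframe
    have h3 : HasContinuousSection H K q.2 q ↔ HasContinuousSection H K x₀ q :=
      ⟨HasLocalSection.change (by simp) contMDiff_snd (mem_extChartAt_source _) (hDsub hq).2,
        HasLocalSection.change (by simp) contMDiff_snd (hDsub hq).2 (mem_extChartAt_source _)⟩
    refine (h3.trans h2).trans (exists_congr fun σ => ⟨fun h => ?_, fun h => ?_⟩)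
    · filter_upwards [h] with z hz
      exact ⟨TwoGrading.isInducing_endPair.continuousAt_iff.2 hz.1.continuousAt, hz.2⟩
    · filter_upwards [h.eventually_nhds] with z hz
      refine ⟨contMDiffAt_zero_of_eventually ?_, hz.self_of_nhds.2⟩
      filter_upwards [hz] with z' hz'
      exact ContinuousAt.comp (f := σ) TwoGrading.continuous_endPair.continuousAt hz'.1
  · have h2 := hasLocalSection_iff (n := ∞) (IZ := 𝓘(ℝ, E))
      (π := fun x : M => x) (H := H t) (K := K) (D := {x | (t, x) ∈ D})
      (hslice (t, x) hx) (fun z hz => (hDsub hz).2) (fun z hz => hRs (t, z) hz)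
      (fun z hz => (hDsub hz).1.2.2.2.1) (uref := fun z hz => frame (t, z) hz)
      (fun z hz => hframe (t, z) hz)
    have h3 : HasSmoothSection (H t) K x x ↔ HasSmoothSection (H t) K x₀ x :=
      ⟨HasLocalSection.change le_rfl contMDiff_id (mem_extChartAt_source _) (hDsub hx).2,
        HasLocalSection.change le_rfl contMDiff_id (hDsub hx).2 (mem_extChartAt_source _)⟩
    exact h3.trans h2

end LocalModel

/-! ### Smoothness of inversion and of the action along maps from `M`. -/

section Abstract

variable {E : Type*} [NormedAddCommGroup E] [NormedSpace ℝ E]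
  {M : Type*} [TopologicalSpace M] [ChartedSpace E M]

theorem contMDiffAt_units_prod_inv {A B : Type*} [NormedRing A] [NormedAlgebra ℝ A]
    [NormedRing B] [NormedAlgebra ℝ B] [CompleteSpace B] {n : WithTop ℕ∞} {f : M → Aˣ × Bˣ} {x : M}
    (hf : ContMDiffAt 𝓘(ℝ, E) 𝓘(ℝ, A × B) n (fun x => (((f x).1 : A), ((f x).2 : B))) x) :
    ContMDiffAt 𝓘(ℝ, E) 𝓘(ℝ, A × B) n (fun x => (((f x).1 : A), (((f x).2⁻¹ : Bˣ) : B))) x := by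
  have h1 : ContDiffAt ℝ n (fun z : A × B => (z.1, Ring.inverse z.2))
      (((f x).1 : A), ((f x).2 : B)) :=
    contDiffAt_fst.prodMk (ContDiffAt.comp (g := Ring.inverse) (f := Prod.snd)
      (((f x).1 : A), ((f x).2 : B)) (contDiffAt_ringInverse ℝ (f x).2) contDiffAt_snd)
  refine (ContDiffAt.comp_contMDiffAt (f := fun x => (((f x).1 : A), ((f x).2 : B))) h1
    hf).congr_of_eventuallyEq (Eventually.of_forall fun z => ?_)
  exact Prod.ext rfl (Ring.inverse_unit (f z).2).symm

theorem AltMaps.contMDiffAt_actCLM {V U : Type*} [NormedAddCommGroup V] [NormedSpace ℝ V]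
    [FiniteDimensional ℝ V] [NormedAddCommGroup U] [NormedSpace ℝ U] [FiniteDimensional ℝ U]
    {n : WithTop ℕ∞} {f : M → (V →L[ℝ] V) × (U →L[ℝ] U)} {l : M → AltMaps V U} {x : M}
    (hf : ContMDiffAt 𝓘(ℝ, E) 𝓘(ℝ, (V →L[ℝ] V) × (U →L[ℝ] U)) n f x)
    (hl : ContMDiffAt 𝓘(ℝ, E) 𝓘(ℝ, AltMaps V U) n l x) :
    ContMDiffAt 𝓘(ℝ, E) 𝓘(ℝ, AltMaps V U) n (fun x => AltMaps.actCLM (f x) (l x)) x :=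
  ContDiffAt.comp_contMDiffAt (f := fun x => (f x, l x))
    (AltMaps.contDiff_actCLM (V := V) (U := U)).contDiffAt (hf.prodMk_space hl)

end Abstract

/-! ### Local existence and local uniqueness of suitable families. -/

section Local

variable {E : Type*} [NormedAddCommGroup E] [NormedSpace ℝ E]
  {M : Type*} [TopologicalSpace M] [ChartedSpace E M] [IsManifold 𝓘(ℝ, E) ∞ M]
  {L : Type*} [LieRing L] [LieAlgebra ℝ L] [FiniteDimensional ℝ L] {𝔤 : TwoGrading L}

theorem IsLevi.comp {H : (x : M) → Submodule ℝ (TangentSpace 𝓘(ℝ, E) x)} {x : M}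
    {u : GradedFrame 𝔤 (H x)} {l : 𝔤.W} (h : IsLevi 𝔤 H x u l) (s : 𝔤.S) :
    IsLevi 𝔤 H x (u.comp s) (TwoGrading.actS s l) := by
  intro X Y hX hY hXY v w hv hw
  refine (h X Y hX hY hXY (s.1.val v) (s.1.val w) hv hw).trans ?_
  rw [TwoGrading.toBilin_actS, GradedFrame.comp_snd]
  refine congrArg u.snd ?_
  exact (congrArg (fun f : 𝔤.piece (-2) →L[ℝ] 𝔤.piece (-2) => f _) s.2.mul_inv).symm

theorem LocalModel.isLevi_comp_iff {H : ℝ → (x : M) → Submodule ℝ (TangentSpace 𝓘(ℝ, E) x)}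
    (m : LocalModel 𝔤 H) {p : ℝ × M} (hp : p ∈ m.dom) (s : 𝔤.S) (l : 𝔤.W) :
    IsLevi 𝔤 (H p.1) p.2 ((m.frame p hp).comp s) l ↔ l = TwoGrading.actS s (m.levi p) := by
  constructor
  · intro h
    have h1 := h.comp s⁻¹
    rw [GradedFrame.comp_comp, mul_inv_cancel, GradedFrame.comp_one, m.isLevi_iff] at h1
    rw [← h1, ← TwoGrading.actS_mul, inv_mul_cancel, TwoGrading.actS_one]
  · rintro rfl
    exact ((m.isLevi_iff p hp _).2 rfl).comp s

variable [LieAlgebra.IsSemisimple ℝ L]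

/-- `K` is an orbit of `Γ` in the set of graded frames at `x`, and the Levi bracket satisfies in
its frames the normalisation and transversality conditions. -/
def IsSuitable (Γ : Subgroup 𝔤.S) (H : (x : M) → Submodule ℝ (TangentSpace 𝓘(ℝ, E) x)) (x : M)
    (K : Set (GradedFrame 𝔤 (H x))) : Prop :=
  (∃ u : GradedFrame 𝔤 (H x), K = {u' | ∃ γ ∈ Γ, u' = u.comp γ}) ∧ ∀ u ∈ K,
    (∃ l, IsLevi 𝔤 H x u l ∧ 𝔤.IsNormal l) ∧ ∃ l, IsLevi 𝔤 H x u l ∧ 𝔤.IsTransverse l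

variable {Γ : Subgroup 𝔤.S} {H : ℝ → (x : M) → Submodule ℝ (TangentSpace 𝓘(ℝ, E) x)}

theorem IsSuitable.eq_orbit {H : (x : M) → Submodule ℝ (TangentSpace 𝓘(ℝ, E) x)} {x : M}
    {K : Set (GradedFrame 𝔤 (H x))} (h : IsSuitable Γ H x K) {u : GradedFrame 𝔤 (H x)}
    (hu : u ∈ K) : K = {u' | ∃ γ ∈ Γ, u' = u.comp γ} := by
  obtain ⟨⟨u₀, rfl⟩, -⟩ := h
  obtain ⟨γ, hγ, rfl⟩ := hu
  ext u'
  constructor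
  · rintro ⟨δ, hδ, rfl⟩
    exact ⟨γ⁻¹ * δ, Γ.mul_mem (Γ.inv_mem hγ) hδ, by rw [GradedFrame.comp_comp, mul_inv_cancel_left]⟩
  · rintro ⟨δ, hδ, rfl⟩
    exact ⟨γ * δ, Γ.mul_mem hγ hδ, GradedFrame.comp_comp _ _ _⟩

theorem LocalModel.isNormal_and_isTransverse (m : LocalModel 𝔤 H) {p : ℝ × M} (hp : p ∈ m.dom)
    {K : Set (GradedFrame 𝔤 (H p.1 p.2))} (h : IsSuitable Γ (H p.1) p.2 K) {s : 𝔤.S}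
    (hs : (m.frame p hp).comp s ∈ K) : 𝔤.IsNormal (TwoGrading.actS s (m.levi p)) ∧
      𝔤.IsTransverse (TwoGrading.actS s (m.levi p)) := by
  obtain ⟨⟨l, hl, hn⟩, l', hl', ht⟩ := h.2 _ hs
  rw [m.isLevi_comp_iff] at hl hl'
  exact ⟨hl ▸ hn, hl' ▸ ht⟩

theorem LocalModel.isSuitable_orbit (hΓ : 𝔤.IsStructureGroup Γ) (m : LocalModel 𝔤 H) {p : ℝ × M}
    (hp : p ∈ m.dom) {s : 𝔤.S} (hn : 𝔤.IsNormal (TwoGrading.actS s (m.levi p)))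
    (ht : 𝔤.IsTransverse (TwoGrading.actS s (m.levi p))) :
    IsSuitable Γ (H p.1) p.2 {u' | ∃ γ ∈ Γ, u' = ((m.frame p hp).comp s).comp γ} := by
  refine ⟨⟨_, rfl⟩, ?_⟩
  rintro _ ⟨γ, hγ, rfl⟩
  have h : IsLevi 𝔤 (H p.1) p.2 (((m.frame p hp).comp s).comp γ)
      (TwoGrading.actS γ (TwoGrading.actS s (m.levi p))) :=
    ((m.isLevi_comp_iff hp s _).2 rfl).comp γ
  exact ⟨⟨_, h, hΓ.isNormal γ hγ _ hn⟩, _, h, hΓ.isTransverse γ hγ _ ht⟩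

/-- For two continuous families of suitable partial regularisations, agreement is a locally
constant condition. -/
theorem LocalModel.eventually_eq_of_eq (hΓ : 𝔤.IsStructureGroup Γ)
    (hcoh : Subsingleton 𝔤.H1Zero) (m : LocalModel 𝔤 H) {p : ℝ × M} (hp : p ∈ m.dom)
    {K K' : (t : ℝ) → (x : M) → Set (GradedFrame 𝔤 (H t x))}
    (hK : HasContinuousSection H K p.2 p) (hK' : HasContinuousSection H K' p.2 p)
    (hs : ∀ᶠ q : ℝ × M in 𝓝 p, IsSuitable Γ (H q.1) q.2 (K q.1 q.2))
    (hs' : ∀ᶠ q : ℝ × M in 𝓝 p, IsSuitable Γ (H q.1) q.2 (K' q.1 q.2)) :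
    ∀ᶠ z : (ℝ × M) × (ℝ × M) in 𝓝 (p, p),
      K z.1.1 z.1.2 = K' z.1.1 z.1.2 → K z.2.1 z.2.2 = K' z.2.1 z.2.2 := by
  obtain ⟨σ, hσ⟩ := (m.hasContinuousSection_iff K p hp).1 hK
  obtain ⟨σ', hσ'⟩ := (m.hasContinuousSection_iff K' p hp).1 hK'
  obtain ⟨hn, ht⟩ := m.isNormal_and_isTransverse hp hs'.self_of_nhds (hσ'.self_of_nhds.2 hp)
  have hrig := hΓ.eventually_mem hcoh hn ht
  have c1 : ContinuousAt (fun z : (ℝ × M) × (ℝ × M) => σ z.1) (p, p) :=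
    ContinuousAt.comp (f := Prod.fst) hσ.self_of_nhds.1 continuousAt_fst
  have c2 : ContinuousAt (fun z : (ℝ × M) × (ℝ × M) => σ z.2) (p, p) :=
    ContinuousAt.comp (f := Prod.snd) hσ.self_of_nhds.1 continuousAt_snd
  have c1' : ContinuousAt (fun z : (ℝ × M) × (ℝ × M) => σ' z.1) (p, p) :=
    ContinuousAt.comp (f := Prod.fst) hσ'.self_of_nhds.1 continuousAt_fst
  have c2' : ContinuousAt (fun z : (ℝ × M) × (ℝ × M) => σ' z.2) (p, p) :=
    ContinuousAt.comp (f := Prod.snd) hσ'.self_of_nhds.1 continuousAt_snd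
  have cl : ContinuousAt (fun z : (ℝ × M) × (ℝ × M) => m.levi z.2) (p, p) :=
    ContinuousAt.comp (f := Prod.snd) (m.continuousAt_levi p hp) continuousAt_snd
  -- If the families agree at `q = z.1`, then `σ' q = σ q * γ` with `γ ∈ Γ`. The comparison element
  -- `h = σ q' * (σ q)⁻¹ * σ' q` equals `σ q' * γ`, so it gives a frame of `K` at `q' = z.2`, while
  -- `h⁻¹ * σ' q'` tends to `1`. Thus `γ` itself need not be close to `1`.
  have ch := (c2.mul c1.inv).mul c1'
  have hc : ContinuousAt (fun z : (ℝ × M) × (ℝ × M) =>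
      (TwoGrading.actS (σ z.2 * (σ z.1)⁻¹ * σ' z.1) (m.levi z.2),
        (σ z.2 * (σ z.1)⁻¹ * σ' z.1)⁻¹ * σ' z.2)) (p, p) :=
    (ContinuousAt.comp (f := fun z : (ℝ × M) × (ℝ × M) =>
      (σ z.2 * (σ z.1)⁻¹ * σ' z.1, m.levi z.2)) TwoGrading.continuous_actS.continuousAt
      (ch.prodMk cl)).prodMk (ch.inv.mul c2')
  have hrig' := hc.eventually (p := fun q : 𝔤.W × 𝔤.S =>
      𝔤.IsNormal q.1 → 𝔤.IsNormal (TwoGrading.actS q.2 q.1) → q.2 ∈ Γ) (by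
    simpa only [mul_inv_cancel, one_mul, inv_mul_cancel] using hrig)
  have hgood : ∀ᶠ q in 𝓝 p, q ∈ m.dom ∧ IsSuitable Γ (H q.1) q.2 (K q.1 q.2) ∧
      IsSuitable Γ (H q.1) q.2 (K' q.1 q.2) ∧
      (∀ hq, (m.frame q hq).comp (σ q) ∈ K q.1 q.2) ∧
      ∀ hq, (m.frame q hq).comp (σ' q) ∈ K' q.1 q.2 := by
    filter_upwards [m.isOpen_dom.mem_nhds hp, hs, hs', hσ, hσ'] with q a1 a2 a3 a4 a5
    exact ⟨a1, a2, a3, a4.2, a5.2⟩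
  have hgood1 : ∀ᶠ z : (ℝ × M) × (ℝ × M) in 𝓝 (p, p), _ := continuousAt_fst.eventually hgood
  have hgood2 : ∀ᶠ z : (ℝ × M) × (ℝ × M) in 𝓝 (p, p), _ := continuousAt_snd.eventually hgood
  filter_upwards [hrig', hgood1, hgood2] with ⟨q, q'⟩ hr ⟨a1, a2, a3, a4, a5⟩ ⟨b1, b2, b3, b4, b5⟩
    heq
  dsimp only at *
  have h1 := a2.eq_orbit (a4 a1)
  have h2 : (m.frame q a1).comp (σ' q) ∈ K q.1 q.2 := heq ▸ a5 a1
  rw [h1] at h2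
  obtain ⟨γ, hγ, h3⟩ := h2
  have h4 : σ' q = σ q * γ := (m.frame q a1).comp_injective (by rw [h3, GradedFrame.comp_comp])
  have h5 : (σ q)⁻¹ * σ' q = γ := by rw [h4, inv_mul_cancel_left]
  rw [mul_assoc, h5, ← TwoGrading.actS_mul, mul_inv_cancel_left] at hr
  -- Both `h` and `σ' q'` make the Levi form at `q'` normal, so rigidity puts `h⁻¹ * σ' q'` in `Γ`.
  have h6 := hr (by
    rw [TwoGrading.actS_mul]
    exact hΓ.isNormal γ hγ _ (m.isNormal_and_isTransverse b1 b2 (b4 b1)).1)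
    (m.isNormal_and_isTransverse b1 b3 (b5 b1)).1
  have h7 : (m.frame q' b1).comp (σ' q') ∈ K q'.1 q'.2 := by
    rw [b2.eq_orbit (b4 b1)]
    refine ⟨γ * ((σ q' * γ)⁻¹ * σ' q'), Γ.mul_mem hγ h6, ?_⟩
    rw [GradedFrame.comp_comp, ← mul_assoc, mul_inv_cancel_left]
  rw [b3.eq_orbit (b5 b1), b2.eq_orbit h7]

omit [IsManifold 𝓘(ℝ, E) ∞ M] [LieAlgebra.IsSemisimple ℝ L] in
theorem TwoGrading.contMDiffAt_endPair_mul {n : WithTop ℕ∞} {f g : M → 𝔤.S} {x : M}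
    (hf : ContMDiffAt 𝓘(ℝ, E) 𝓘(ℝ, 𝔤.EndPair) n (fun x => TwoGrading.endPair (f x)) x)
    (hg : ContMDiffAt 𝓘(ℝ, E) 𝓘(ℝ, 𝔤.EndPair) n (fun x => TwoGrading.endPair (g x)) x) :
    ContMDiffAt 𝓘(ℝ, E) 𝓘(ℝ, 𝔤.EndPair) n (fun x => TwoGrading.endPair (f x * g x)) x := by
  have h : ContDiff ℝ n (fun z : 𝔤.EndPair × 𝔤.EndPair =>
      ((z.1.1 * z.2.1, z.1.2 * z.2.2) : 𝔤.EndPair)) :=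
    (contDiff_fst.fst.mul contDiff_snd.fst).prodMk (contDiff_fst.snd.mul contDiff_snd.snd)
  exact h.contDiffAt.comp_contMDiffAt (hf.prodMk_space hg)

omit [IsManifold 𝓘(ℝ, E) ∞ M] [LieAlgebra.IsSemisimple ℝ L] in
theorem TwoGrading.contMDiffAt_actS {n : WithTop ℕ∞} {f : M → 𝔤.S} {l : M → 𝔤.W} {x : M}
    (hf : ContMDiffAt 𝓘(ℝ, E) 𝓘(ℝ, 𝔤.EndPair) n (fun x => TwoGrading.endPair (f x)) x)
    (hl : ContMDiffAt 𝓘(ℝ, E) 𝓘(ℝ, 𝔤.W) n l x) :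
    ContMDiffAt 𝓘(ℝ, E) 𝓘(ℝ, 𝔤.W) n (fun x => TwoGrading.actS (f x) (l x)) x :=
  AltMaps.contMDiffAt_actCLM (contMDiffAt_units_prod_inv hf) hl

/-- A suitable partial regularisation of `H τ` extends, near `(τ, x₀)`, to a continuous family. -/
theorem LocalModel.exists_extension (hΓ : 𝔤.IsStructureGroup Γ)
    (hcoh : Subsingleton 𝔤.H1Zero) (m : LocalModel 𝔤 H) {τ : ℝ} {x₀ : M} (hp : (τ, x₀) ∈ m.dom)
    {K₀ : (x : M) → Set (GradedFrame 𝔤 (H τ x))} (hK₀ : HasSmoothSection (H τ) K₀ x₀ x₀)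
    (hs : ∀ x, IsSuitable Γ (H τ) x (K₀ x)) :
    ∃ K : (t : ℝ) → (x : M) → Set (GradedFrame 𝔤 (H t x)), ∀ᶠ q : ℝ × M in 𝓝 (τ, x₀),
      IsSuitable Γ (H q.1) q.2 (K q.1 q.2) ∧ HasContinuousSection H K q.2 q ∧
      HasSmoothSection (H q.1) (K q.1) q.2 q.2 ∧ K τ q.2 = K₀ q.2 := by
  classical
  obtain ⟨σ, hσ⟩ := (m.hasSmoothSection_iff τ K₀ x₀ hp).1 hK₀
  obtain ⟨hn, ht⟩ := m.isNormal_and_isTransverse (p := (τ, x₀)) hp (hs x₀) (hσ.self_of_nhds.2 hp)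
  obtain ⟨γ, hγ1, hγ⟩ := hΓ.exists_normaliser hcoh hn ht
  -- The initial section `σ` is kept constant in `t` relative to the reference frame, and `γ`
  -- corrects the resulting failure of normality.
  let l : ℝ × M → 𝔤.W := fun q => TwoGrading.actS (σ q.2) (m.levi q)
  let g : ℝ × M → 𝔤.S := fun q => σ q.2 * γ (l q)
  let K : (t : ℝ) → (x : M) → Set (GradedFrame 𝔤 (H t x)) := fun t x =>
    {u' | ∃ hq : (t, x) ∈ m.dom, ∃ δ ∈ Γ, u' = ((m.frame (t, x) hq).comp (g (t, x))).comp δ}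
  have hKeq : ∀ q : ℝ × M, ∀ hq : q ∈ m.dom,
      K q.1 q.2 = {u' | ∃ δ ∈ Γ, u' = ((m.frame q hq).comp (g q)).comp δ} := by
    intro q hq
    ext u
    exact ⟨fun ⟨_, δ, h⟩ => ⟨δ, h⟩, fun ⟨δ, h⟩ => ⟨hq, δ, h⟩⟩
  have hmem : ∀ q : ℝ × M, ∀ hq : q ∈ m.dom, (m.frame q hq).comp (g q) ∈ K q.1 q.2 := by
    intro q hq
    rw [hKeq q hq]
    exact ⟨1, Γ.one_mem, (GradedFrame.comp_one _).symm⟩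
  have hσc : ∀ᶠ x in 𝓝 x₀, ContinuousAt σ x := hσ.mono fun x hx =>
    TwoGrading.isInducing_endPair.continuousAt_iff.2 hx.1.continuousAt
  have hlc : ∀ q : ℝ × M, q ∈ m.dom → ContinuousAt σ q.2 → ContinuousAt l q := fun q hq hc =>
    ContinuousAt.comp (f := fun q : ℝ × M => (σ q.2, m.levi q))
      TwoGrading.continuous_actS.continuousAt
      ((ContinuousAt.comp (f := Prod.snd) hc continuousAt_snd).prodMk (m.continuousAt_levi q hq))
  have hl0 : ContinuousAt l (τ, x₀) := hlc (τ, x₀) hp hσc.self_of_nhds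
  have e1 : ∀ᶠ q : ℝ × M in 𝓝 (τ, x₀), q ∈ m.dom := m.isOpen_dom.mem_nhds hp
  have e2 : ∀ᶠ q : ℝ × M in 𝓝 (τ, x₀), _ := hl0.eventually hγ
  have e3 : ∀ᶠ q : ℝ × M in 𝓝 (τ, x₀), _ := continuousAt_snd.eventually hσ
  have e4 : ∀ᶠ q : ℝ × M in 𝓝 (τ, x₀), _ := continuousAt_snd.eventually hσc
  have hrig := hΓ.eventually_mem hcoh hn ht
  have hτ : Tendsto (fun q : ℝ × M => (τ, q.2)) (𝓝 (τ, x₀)) (𝓝 (τ, x₀)) :=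
    (continuous_const.prodMk continuous_snd).tendsto (τ, x₀)
  -- At time `τ` the element `l` is already normal, and the correction, being near `1`, takes it to
  -- a normal element; by rigidity the correction lies in `Γ`, so the orbit is the given one.
  have e5 : ∀ᶠ q : ℝ × M in 𝓝 (τ, x₀), K τ q.2 = K₀ q.2 := by
    have hcγ : Tendsto (fun q => (l q, γ (l q))) (𝓝 (τ, x₀)) (𝓝 (l (τ, x₀), 1)) := by
      have h := hl0.prodMk (ContinuousAt.comp (f := l) hγ.self_of_nhds.1 hl0)
      have h' := h.tendsto
      rwa [show ((γ ∘ l) (τ, x₀)) = 1 from hγ1] at h'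
    filter_upwards [hτ.eventually e1, hτ.eventually e2, e3, hτ.eventually (hcγ.eventually hrig)]
      with q a1 a2 a3 a4
    have h1 := a4 (m.isNormal_and_isTransverse (p := (τ, q.2)) a1 (hs q.2) (a3.2 a1)).1 a2.2.2.1
    rw [hKeq (τ, q.2) a1, (hs q.2).eq_orbit (a3.2 a1)]
    ext u
    constructor
    · rintro ⟨δ, hδ, rfl⟩
      refine ⟨γ (l (τ, q.2)) * δ, Γ.mul_mem h1 hδ, ?_⟩
      rw [GradedFrame.comp_comp, GradedFrame.comp_comp, ← mul_assoc]
    · rintro ⟨δ, hδ, rfl⟩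
      refine ⟨(γ (l (τ, q.2)))⁻¹ * δ, Γ.mul_mem (Γ.inv_mem h1) hδ, ?_⟩
      rw [GradedFrame.comp_comp, GradedFrame.comp_comp]
      simp only [g, mul_assoc, mul_inv_cancel_left]
  refine ⟨K, ?_⟩
  have hall := (e1.and (e2.and (e3.and e4))).and e5
  filter_upwards [hall.eventually_nhds] with q hq
  obtain ⟨⟨a1, a2, a3, a4⟩, a5⟩ := hq.self_of_nhds
  refine ⟨?_, ?_, ?_, a5⟩
  · rw [hKeq q a1]
    have h1 : TwoGrading.actS (g q) (m.levi q) = TwoGrading.actS (γ (l q)) (l q) :=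
      TwoGrading.actS_mul _ _ _
    exact m.isSuitable_orbit hΓ a1 (h1 ▸ a2.2.2.1) (h1 ▸ a2.2.2.2)
  · refine (m.hasContinuousSection_iff K q a1).2 ⟨g, ?_⟩
    filter_upwards [hq] with q' hq'
    obtain ⟨⟨b1, b2, b3, b4⟩, b5⟩ := hq'
    exact ⟨(ContinuousAt.comp (f := Prod.snd) b4 continuousAt_snd).mul
      (ContinuousAt.comp (f := l) b2.1 (hlc q' b1 b4)), hmem q'⟩
  · refine (m.hasSmoothSection_iff q.1 (K q.1) q.2 a1).2 ⟨fun x => g (q.1, x), ?_⟩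
    have h1 := ((Continuous.prodMk_right q.1).continuousAt (x := q.2)).eventually hq
    filter_upwards [h1] with x hx
    obtain ⟨⟨b1, b2, b3, b4⟩, b5⟩ := hx
    refine ⟨TwoGrading.contMDiffAt_endPair_mul b3.1 ?_, fun hx' => hmem (q.1, x) hx'⟩
    have h2 : ContMDiffAt 𝓘(ℝ, E) 𝓘(ℝ, 𝔤.W) ∞ (fun x => l (q.1, x)) x :=
      TwoGrading.contMDiffAt_actS b3.1 (m.contMDiffAt_levi (q.1, x) b1)
    exact ContDiffAt.comp_contMDiffAt (f := fun x => l (q.1, x)) b2.2.1 h2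

end Local

/-! ### Transport of graded frames along equalities of subspaces. -/

section Transport

variable {E : Type*} [NormedAddCommGroup E] [NormedSpace ℝ E]
  {L : Type*} [LieRing L] [LieAlgebra ℝ L] {𝔤 : TwoGrading L}
  {T : Type*} [AddCommGroup T] [Module ℝ T] {P Q : Submodule ℝ T}

/-- A graded frame of `P ⊕ T/P`, regarded as a graded frame of `Q ⊕ T/Q` for `Q = P`. -/
def GradedFrame.transport (h : P = Q) (u : GradedFrame 𝔤 P) : GradedFrame 𝔤 Q := h ▸ u

theorem GradedFrame.coe_transport_fst (h : P = Q) (u : GradedFrame 𝔤 P) (v : 𝔤.piece (-1)) :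
    ((u.transport h).fst v : T) = u.fst v := by
  subst h
  rfl

theorem GradedFrame.mkQ_eq_transport_snd_iff (h : P = Q) (u : GradedFrame 𝔤 P) (z : T)
    (w : 𝔤.piece (-2)) : Q.mkQ z = (u.transport h).snd w ↔ P.mkQ z = u.snd w := by
  subst h
  rfl

theorem GradedFrame.transport_comp [FiniteDimensional ℝ L] (h : P = Q) (u : GradedFrame 𝔤 P)
    (s : 𝔤.S) : (u.comp s).transport h = (u.transport h).comp s := by
  subst h
  rfl

end Transport

/-! ### Uniqueness in time, gluing, and the common time interval. -/

section Gluing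

variable {E : Type*} [NormedAddCommGroup E] [NormedSpace ℝ E]
  {M : Type*} [TopologicalSpace M] [ChartedSpace E M] [IsManifold 𝓘(ℝ, E) ∞ M]
  {L : Type*} [LieRing L] [LieAlgebra ℝ L] [FiniteDimensional ℝ L] {𝔤 : TwoGrading L}

omit [FiniteDimensional ℝ L] in
theorem IsLevi.transport {H H' : (x : M) → Submodule ℝ (TangentSpace 𝓘(ℝ, E) x)} {x : M}
    (hHH' : ∀ᶠ y in 𝓝 x, H y = H' y) (h : H x = H' x) {u : GradedFrame 𝔤 (H x)} {l : 𝔤.W}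
    (hu : IsLevi 𝔤 H x u l) : IsLevi 𝔤 H' x (u.transport h) l := by
  intro X Y hX hY hXY v w hv hw
  refine (GradedFrame.mkQ_eq_transport_snd_iff h u _ _).2 (hu X Y hX hY ?_ v w ?_ ?_)
  · filter_upwards [hHH', hXY] with y h1 h2
    rwa [h1]
  · exact hv.trans (GradedFrame.coe_transport_fst h u v)
  · exact hw.trans (GradedFrame.coe_transport_fst h u w)

omit [FiniteDimensional ℝ L] in
theorem HasCoords.transport {x₁ x : M} {P Q : Submodule ℝ (TangentSpace 𝓘(ℝ, E) x)} (h : P = Q)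
    {u : GradedFrame 𝔤 P} {A : 𝔤.piece (-1) → E} {B : 𝔤.piece (-2) → E}
    (hu : HasCoords 𝔤 x₁ x u A B) : HasCoords 𝔤 x₁ x (u.transport h) A B := by
  subst h
  exact hu

/-- A field `K` of sets of graded frames of `H`, regarded as a field for a distribution `H'` where
the latter agrees with `H`. -/
def transportField (H H' : (x : M) → Submodule ℝ (TangentSpace 𝓘(ℝ, E) x))
    (K : (x : M) → Set (GradedFrame 𝔤 (H x))) (x : M) : Set (GradedFrame 𝔤 (H' x)) :=
  {u' | ∃ h : H x = H' x, ∃ u ∈ K x, u' = u.transport h}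

omit [IsManifold 𝓘(ℝ, E) ∞ M] [FiniteDimensional ℝ L] in
theorem transportField_self (H : (x : M) → Submodule ℝ (TangentSpace 𝓘(ℝ, E) x))
    (K : (x : M) → Set (GradedFrame 𝔤 (H x))) (x : M) : transportField H H K x = K x := by
  ext u
  exact ⟨fun ⟨_, u', hu', h⟩ => h ▸ hu', fun hu => ⟨rfl, u, hu, rfl⟩⟩

variable [LieAlgebra.IsSemisimple ℝ L] {Γ : Subgroup 𝔤.S}

theorem IsSuitable.transport {H H' : (x : M) → Submodule ℝ (TangentSpace 𝓘(ℝ, E) x)} {x : M}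
    {K : (x : M) → Set (GradedFrame 𝔤 (H x))} (hK : IsSuitable Γ H x (K x))
    (hHH' : ∀ᶠ y in 𝓝 x, H y = H' y) : IsSuitable Γ H' x (transportField H H' K x) := by
  have h := hHH'.self_of_nhds
  constructor
  · obtain ⟨u, hu⟩ := hK.1
    refine ⟨u.transport h, ?_⟩
    ext u'
    constructor
    · rintro ⟨_, u₁, hu₁, rfl⟩
      rw [hu] at hu₁
      obtain ⟨γ, hγ, rfl⟩ := hu₁
      exact ⟨γ, hγ, GradedFrame.transport_comp h u γ⟩
    · rintro ⟨γ, hγ, rfl⟩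
      refine ⟨h, u.comp γ, ?_, (GradedFrame.transport_comp h u γ).symm⟩
      rw [hu]
      exact ⟨γ, hγ, rfl⟩
  · rintro _ ⟨_, u, hu, rfl⟩
    obtain ⟨⟨l, hl, hn⟩, l', hl', ht⟩ := hK.2 u hu
    exact ⟨⟨l, hl.transport hHH' h, hn⟩, l', hl'.transport hHH' h, ht⟩

variable {H : ℝ → (x : M) → Submodule ℝ (TangentSpace 𝓘(ℝ, E) x)}

omit [LieAlgebra.IsSemisimple ℝ L] [FiniteDimensional ℝ L] in
theorem HasSmoothSection.transport {H H' : (x : M) → Submodule ℝ (TangentSpace 𝓘(ℝ, E) x)}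
    {K : (x : M) → Set (GradedFrame 𝔤 (H x))} {x₁ x : M} (h : HasSmoothSection H K x₁ x)
    (hHH' : ∀ᶠ y in 𝓝 x, H y = H' y) : HasSmoothSection H' (transportField H H' K) x₁ x := by
  obtain ⟨A, B, hAB⟩ := h
  refine ⟨A, B, ?_⟩
  filter_upwards [hAB, hHH'] with y ⟨hA, hB, u, hu, hc⟩ hy
  exact ⟨hA, hB, u.transport hy, ⟨hy, u, hu, rfl⟩, hc.transport hy⟩

omit [LieAlgebra.IsSemisimple ℝ L] [FiniteDimensional ℝ L] in
theorem HasSmoothSection.hasContinuousSection_transport {τ : ℝ}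
    {K : (x : M) → Set (GradedFrame 𝔤 (H τ x))} {x₁ x : M} {t : ℝ}
    (h : HasSmoothSection (H τ) K x₁ x) (hH : ∀ᶠ q : ℝ × M in 𝓝 (t, x), H τ q.2 = H q.1 q.2) :
    HasContinuousSection H (fun t => transportField (H τ) (H t) K) x₁ (t, x) := by
  obtain ⟨A, B, hAB⟩ := h
  refine ⟨fun v q => A v q.2, fun w q => B w q.2, ?_⟩
  have h1 : ∀ᶠ q : ℝ × M in 𝓝 (t, x), _ := continuousAt_snd.eventually hAB
  filter_upwards [h1, hH] with q ⟨hA, hB, u, hu, hc⟩ hq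
  exact ⟨fun v => ((hA v).of_le zero_le).comp q contMDiffAt_snd,
    fun w => ((hB w).of_le zero_le).comp q contMDiffAt_snd,
    u.transport hq, ⟨hq, u, hu, rfl⟩, hc.transport hq⟩

/-- At a fixed point of `M`, agreement passes from each time to nearby times and back again, so it
propagates through the connected set `J`. -/
theorem LocalModel.eqOn_of_eq (hΓ : 𝔤.IsStructureGroup Γ) (hcoh : Subsingleton 𝔤.H1Zero)
    {J : Set ℝ} (hJ : IsPreconnected J) {x : M} (hm : ∀ t ∈ J, ∃ m : LocalModel 𝔤 H, (t, x) ∈ m.dom)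
    {K K' : (t : ℝ) → (x : M) → Set (GradedFrame 𝔤 (H t x))}
    (hK : ∀ t ∈ J, HasContinuousSection H K x (t, x))
    (hK' : ∀ t ∈ J, HasContinuousSection H K' x (t, x))
    (hs : ∀ t ∈ J, ∀ᶠ q : ℝ × M in 𝓝 (t, x), IsSuitable Γ (H q.1) q.2 (K q.1 q.2))
    (hs' : ∀ t ∈ J, ∀ᶠ q : ℝ × M in 𝓝 (t, x), IsSuitable Γ (H q.1) q.2 (K' q.1 q.2))
    {τ : ℝ} (hτ : τ ∈ J) (h : K τ x = K' τ x) {t : ℝ} (ht : t ∈ J) : K t x = K' t x := by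
  refine hJ.induction₂' (fun s t => K s x = K' s x → K t x = K' t x) (fun s hs₁ => ?_)
    (fun _ _ _ _ _ _ h1 h2 h3 => h2 (h1 h3)) hτ ht h
  obtain ⟨m, hm⟩ := hm s hs₁
  have h1 := m.eventually_eq_of_eq hΓ hcoh hm (hK s hs₁) (hK' s hs₁) (hs s hs₁) (hs' s hs₁)
  have c1 : Tendsto (fun t : ℝ => (((s, x), (t, x)) : (ℝ × M) × (ℝ × M))) (𝓝 s)
      (𝓝 ((s, x), (s, x))) :=
    (continuous_const.prodMk (Continuous.prodMk_left x)).tendsto s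
  have c2 : Tendsto (fun t : ℝ => (((t, x), (s, x)) : (ℝ × M) × (ℝ × M))) (𝓝 s)
      (𝓝 ((s, x), (s, x))) :=
    ((Continuous.prodMk_left x).prodMk continuous_const).tendsto s
  exact eventually_nhdsWithin_of_eventually_nhds ((c1.eventually h1).and (c2.eventually h1))

/-- At `(t, x)` the family `K` is suitable and has continuous and smooth sections, and at
`(τ, x)` it is equal to `K₀`. -/
structure IsExtensionAt (Γ : Subgroup 𝔤.S)
    (H : ℝ → (x : M) → Submodule ℝ (TangentSpace 𝓘(ℝ, E) x)) (τ : ℝ)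
    (K₀ : (x : M) → Set (GradedFrame 𝔤 (H τ x)))
    (K : (t : ℝ) → (x : M) → Set (GradedFrame 𝔤 (H t x))) (t : ℝ) (x : M) : Prop where
  isSuitable : IsSuitable Γ (H t) x (K t x)
  hasContinuousSection : HasContinuousSection H K x (t, x)
  hasSmoothSection : HasSmoothSection (H t) (K t) x x
  eq_initial : K τ x = K₀ x

/-- Local extensions over a common interval of times are unique, and they fit together. -/
theorem exists_unique_extension_of_local (hΓ : 𝔤.IsStructureGroup Γ)
    (hcoh : Subsingleton 𝔤.H1Zero) {J : Set ℝ} (hJ : IsPreconnected J) (hJo : IsOpen J)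
    (hm : ∀ t ∈ J, ∀ x, ∃ m : LocalModel 𝔤 H, (t, x) ∈ m.dom) {τ : ℝ} (hτ : τ ∈ J)
    {K₀ : (x : M) → Set (GradedFrame 𝔤 (H τ x))}
    (hloc : ∀ x, ∃ K, ∀ᶠ y in 𝓝 x, ∀ t ∈ J, IsExtensionAt Γ H τ K₀ K t y) :
    ∃ K, (∀ t ∈ J, ∀ x, IsExtensionAt Γ H τ K₀ K t x) ∧
      ∀ K', K' τ = K₀ → (∀ t ∈ J, ∀ x, HasContinuousSection H K' x (t, x)) →
        (∀ t ∈ J, ∀ x, IsSuitable Γ (H t) x (K' t x)) → ∀ t ∈ J, ∀ x, K' t x = K t x := by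
  choose F hF using hloc
  -- At each `y` near `x` the extensions chosen for `x` and for `y` agree at time `τ`, hence at all
  -- times in `J`. So the diagonal choice `F x t x` coincides near `x` with the single extension `F
  -- x`.
  have hF' : ∀ x, ∀ᶠ y in 𝓝 x, ∀ t ∈ J, F y t y = F x t y := by
    intro x
    have hsuit : ∀ x' y, (∀ᶠ z in 𝓝 y, ∀ t ∈ J, IsExtensionAt Γ H τ K₀ (F x') t z) →
        ∀ t ∈ J, ∀ᶠ q : ℝ × M in 𝓝 (t, y), IsSuitable Γ (H q.1) q.2 (F x' q.1 q.2) := by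
      intro x' y h t ht
      filter_upwards [Eventually.prod_nhds (hJo.mem_nhds ht) h] with q hq
      exact (hq.2 q.1 hq.1).isSuitable
    filter_upwards [(hF x).eventually_nhds] with y hy t ht
    have h1 := (hF y).self_of_nhds
    have h2 := hy.self_of_nhds
    exact LocalModel.eqOn_of_eq hΓ hcoh hJ (fun t ht => hm t ht y)
      (fun t ht => (h1 t ht).hasContinuousSection) (fun t ht => (h2 t ht).hasContinuousSection)
      (hsuit y y (hF y)) (hsuit x y hy) hτ
      ((h1 τ hτ).eq_initial.trans (h2 τ hτ).eq_initial.symm) ht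
  have hext : ∀ t ∈ J, ∀ x, IsExtensionAt Γ H τ K₀ (fun t x => F x t x) t x := by
    intro t ht x
    have h1 := (hF x).self_of_nhds t ht
    refine ⟨h1.isSuitable, ?_, ?_, h1.eq_initial⟩
    · obtain ⟨A, B, hAB⟩ := h1.hasContinuousSection
      refine ⟨A, B, ?_⟩
      filter_upwards [hAB, Eventually.prod_nhds (hJo.mem_nhds ht) (hF' x)]
        with q ⟨hA, hB, u, hu, hc⟩ hq
      exact ⟨hA, hB, u, (hq.2 q.1 hq.1).symm ▸ hu, hc⟩
    · obtain ⟨A, B, hAB⟩ := h1.hasSmoothSection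
      refine ⟨A, B, ?_⟩
      filter_upwards [hAB, hF' x] with y ⟨hA, hB, u, hu, hc⟩ hy
      exact ⟨hA, hB, u, (hy t ht).symm ▸ hu, hc⟩
  refine ⟨fun t x => F x t x, hext, fun K' h0 hc hs t ht x => ?_⟩
  have hev : ∀ t ∈ J, ∀ᶠ q : ℝ × M in 𝓝 (t, x), q.1 ∈ J := fun t ht =>
    continuousAt_fst.eventually (hJo.mem_nhds ht)
  exact LocalModel.eqOn_of_eq hΓ hcoh hJ (fun t ht => hm t ht x) (fun t ht => hc t ht x)
    (fun t ht => (hext t ht x).hasContinuousSection)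
    (fun t ht => (hev t ht).mono fun q hq => hs q.1 hq q.2)
    (fun t ht => (hev t ht).mono fun q hq => (hext q.1 hq q.2).isSuitable) hτ
    ((congrFun h0 x).trans (hext τ hτ x).eq_initial.symm) ht

/-- Near a compact set of points, extensions exist over a common neighbourhood of the initial
time. -/
theorem exists_extension_of_isCompact (hΓ : 𝔤.IsStructureGroup Γ)
    (hcoh : Subsingleton 𝔤.H1Zero) {τ : ℝ} (hm : ∀ x, ∃ m : LocalModel 𝔤 H, (τ, x) ∈ m.dom)
    {K₀ : (x : M) → Set (GradedFrame 𝔤 (H τ x))} (hK₀ : ∀ x, HasSmoothSection (H τ) K₀ x x)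
    (hs : ∀ x, IsSuitable Γ (H τ) x (K₀ x)) {C : Set M} (hC : IsCompact C) :
    ∃ V ∈ 𝓝 τ, ∀ x ∈ C, ∃ K, ∀ᶠ y in 𝓝 x, ∀ t ∈ V, IsExtensionAt Γ H τ K₀ K t y := by
  refine hC.induction_on (p := fun C => ∃ V ∈ 𝓝 τ, ∀ x ∈ C, ∃ K, ∀ᶠ y in 𝓝 x, ∀ t ∈ V,
    IsExtensionAt Γ H τ K₀ K t y) ⟨univ, univ_mem, by simp⟩ ?_ ?_ ?_
  · rintro C D hCD ⟨V, hV, h⟩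
    exact ⟨V, hV, fun x hx => h x (hCD hx)⟩
  · rintro C D ⟨V, hV, h⟩ ⟨V', hV', h'⟩
    refine ⟨V ∩ V', inter_mem hV hV', fun x hx => ?_⟩
    rcases hx with hx | hx
    · obtain ⟨K, hK⟩ := h x hx
      exact ⟨K, hK.mono fun y hy t ht => hy t ht.1⟩
    · obtain ⟨K, hK⟩ := h' x hx
      exact ⟨K, hK.mono fun y hy t ht => hy t ht.2⟩
  · intro x _
    obtain ⟨m, hx⟩ := hm x
    obtain ⟨K, hK⟩ := m.exists_extension hΓ hcoh hx (hK₀ x) hs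
    -- A product neighbourhood makes the interval of times independent of the points near `x`;
    -- compactness then needs only finitely many intersections.
    obtain ⟨V, hV, U, hU, hVU⟩ := mem_nhds_prod_iff.1 hK
    obtain ⟨U', hU'U, hU'o, hxU'⟩ := mem_nhds_iff.1 hU
    refine ⟨U', mem_nhdsWithin_of_mem_nhds (hU'o.mem_nhds hxU'), V, hV, fun y hy => ⟨K, ?_⟩⟩
    filter_upwards [hU'o.mem_nhds hy] with z hz t ht
    obtain ⟨h1, h2, h3, h4⟩ := hVU (mk_mem_prod ht (hU'U hz))
    exact ⟨h1, h2, h3, h4⟩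

/-- Extension of a suitable partial regularisation along a family of distributions that is
constant outside a compact set. -/
theorem exists_unique_extension [FiniteDimensional ℝ E] [T2Space M] (hΓ : 𝔤.IsStructureGroup Γ)
    (hcoh : Subsingleton 𝔤.H1Zero) {a b τ : ℝ} (hτ : τ ∈ Ioo a b)
    (hrank : ∀ t ∈ Ioo a b, ∀ x,
      Module.finrank ℝ (H t x) = Module.finrank ℝ (𝔤.piece (-1)) ∧
      Module.finrank ℝ (TangentSpace 𝓘(ℝ, E) x ⧸ H t x) = Module.finrank ℝ (𝔤.piece (-2)))
    (hH : IsContinuousFamily (Ioo a b) (Module.finrank ℝ (𝔤.piece (-1))) H)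
    {C : Set M} (hC : IsCompact C)
    (hconst : ∀ x ∉ C, ∀ s ∈ Ioo a b, ∀ t ∈ Ioo a b, H s x = H t x)
    {K₀ : (x : M) → Set (GradedFrame 𝔤 (H τ x))} (hK₀ : ∀ x, HasSmoothSection (H τ) K₀ x x)
    (hs : ∀ x, IsSuitable Γ (H τ) x (K₀ x)) :
    ∃ c d : ℝ, τ ∈ Ioo c d ∧ Ioo c d ⊆ Ioo a b ∧
      ∃ K, (∀ t ∈ Ioo c d, ∀ x, IsExtensionAt Γ H τ K₀ K t x) ∧
      ∀ K', K' τ = K₀ → (∀ t ∈ Ioo c d, ∀ x, HasContinuousSection H K' x (t, x)) →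
        (∀ t ∈ Ioo c d, ∀ x, IsSuitable Γ (H t) x (K' t x)) →
        ∀ t ∈ Ioo c d, ∀ x, K' t x = K t x := by
  have hm : ∀ t ∈ Ioo a b, ∀ x, ∃ m : LocalModel 𝔤 H, (t, x) ∈ m.dom := fun t ht x =>
    hH.exists_localModel hrank ht x
  obtain ⟨V, hV, hVC⟩ := exists_extension_of_isCompact hΓ hcoh (hm τ hτ) hK₀ hs hC
  obtain ⟨c, d, hcd, hsub⟩ := mem_nhds_iff_exists_Ioo_subset.1
    (inter_mem hV (isOpen_Ioo.mem_nhds hτ))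
  refine ⟨c, d, hcd, fun t ht => (hsub ht).2, exists_unique_extension_of_local hΓ hcoh
    isPreconnected_Ioo isOpen_Ioo (fun t ht => hm t (hsub ht).2) hcd fun x => ?_⟩
  by_cases hx : x ∈ C
  · obtain ⟨K, hK⟩ := hVC x hx
    exact ⟨K, hK.mono fun y hy t ht => hy t (hsub ht).1⟩
  -- Off the compact set, closed because `M` is Hausdorff, the distribution is constant in time on
  -- an open set. So the initial frames can be kept, and the Levi bracket, being local, does not
  -- change.
  · refine ⟨fun t => transportField (H τ) (H t) K₀, ?_⟩
    filter_upwards [hC.isClosed.isOpen_compl.mem_nhds hx] with y hy t ht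
    have h1 : ∀ᶠ z in 𝓝 y, H τ z = H t z := by
      filter_upwards [hC.isClosed.isOpen_compl.mem_nhds hy] with z hz
      exact hconst z hz τ hτ t (hsub ht).2
    have h2 : ∀ᶠ q : ℝ × M in 𝓝 (t, y), H τ q.2 = H q.1 q.2 := by
      filter_upwards [Eventually.prod_nhds (isOpen_Ioo.mem_nhds ht)
        (hC.isClosed.isOpen_compl.mem_nhds hy)] with q hq
      exact hconst q.2 hq.2 τ hτ q.1 (hsub hq.1).2
    exact ⟨(hs y).transport h1, (hK₀ y).hasContinuousSection_transport h2,
      (hK₀ y).transport h1, transportField_self _ _ y⟩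

end Gluing

/-! ### Groups of graded automorphisms as structure groups. -/

section StructureGroup

variable {L : Type*} [LieRing L] [LieAlgebra ℝ L] [FiniteDimensional ℝ L] {𝔤 : TwoGrading L}

/-- The subgroup of `S` consisting of the restrictions of the automorphisms of `𝔤` that belong
to the group `Φ` and preserve the grading. -/
def TwoGrading.restrictionGroup (𝔤 : TwoGrading L) (Φ : Set (L ≃ₗ⁅ℝ⁆ L)) (h1 : LieEquiv.refl ∈ Φ)
    (hmul : ∀ φ ∈ Φ, ∀ ψ ∈ Φ, ψ.trans φ ∈ Φ) (hinv : ∀ φ ∈ Φ, φ.symm ∈ Φ) : Subgroup 𝔤.S where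
  carrier := {s | ∃ φ ∈ Φ, (∀ i : ℤ, ∀ x ∈ 𝔤.piece i, φ x ∈ 𝔤.piece i) ∧
    (∀ v, (s.1.val v : L) = φ v) ∧ ∀ w, (s.2.val w : L) = φ w}
  one_mem' := ⟨_, h1, fun _ _ h => h, fun _ => rfl, fun _ => rfl⟩
  mul_mem' := by
    rintro s t ⟨φ, hφ, hφg, hs1, hs2⟩ ⟨ψ, hψ, hψg, ht1, ht2⟩
    refine ⟨_, hmul φ hφ ψ hψ, fun i x hx => hφg i _ (hψg i x hx), fun v => ?_, fun w => ?_⟩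
    · exact (hs1 (t.1.val v)).trans (congrArg φ (ht1 v))
    · exact (hs2 (t.2.val w)).trans (congrArg φ (ht2 w))
  inv_mem' := by
    rintro s ⟨φ, hφ, hφg, hs1, hs2⟩
    refine ⟨_, hinv φ hφ, 𝔤.symm_mem φ hφg, fun v => ?_, fun w => ?_⟩
    · refine ((LieEquiv.symm_apply_apply φ _).symm.trans (congrArg φ.symm (hs1 _).symm)).trans ?_
      exact congrArg (fun f : 𝔤.piece (-1) →L[ℝ] 𝔤.piece (-1) => φ.symm (f v)) s.1.mul_inv
    · refine ((LieEquiv.symm_apply_apply φ _).symm.trans (congrArg φ.symm (hs2 _).symm)).trans ?_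
      exact congrArg (fun f : 𝔤.piece (-2) →L[ℝ] 𝔤.piece (-2) => φ.symm (f w)) s.2.mul_inv

variable (𝔤) in
theorem TwoGrading.exists_restriction (φ : L ≃ₗ⁅ℝ⁆ L)
    (hφ : ∀ i : ℤ, ∀ x ∈ 𝔤.piece i, φ x ∈ 𝔤.piece i) :
    ∃ s : 𝔤.S, (∀ v, s.1.val v = 𝔤.restr φ hφ (-1) v) ∧ ∀ w, s.2.val w = 𝔤.restr φ hφ (-2) w :=
  ⟨((ContinuousLinearEquiv.unitsEquiv ℝ _).symm (𝔤.restr φ hφ (-1)).toContinuousLinearEquiv,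
    (ContinuousLinearEquiv.unitsEquiv ℝ _).symm (𝔤.restr φ hφ (-2)).toContinuousLinearEquiv),
    fun _ => rfl, fun _ => rfl⟩

theorem TwoGrading.actS_eq_autAct {φ : L ≃ₗ⁅ℝ⁆ L}
    (hφ : ∀ i : ℤ, ∀ x ∈ 𝔤.piece i, φ x ∈ 𝔤.piece i) {s : 𝔤.S} (h1 : ∀ v, (s.1.val v : L) = φ v)
    (h2 : ∀ w, (s.2.val w : L) = φ w) (l : 𝔤.W) :
    TwoGrading.actS s l = 𝔤.autAct φ hφ l := by
  refine AltMaps.ext fun x y => ?_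
  rw [TwoGrading.toBilin_actS, TwoGrading.autAct, AltMaps.toBilin_act]
  have e1 : ∀ v, s.1.val v = 𝔤.restr φ hφ (-1) v := fun v => Subtype.ext (h1 v)
  have e2 : ∀ w, s.2.val w = 𝔤.restr φ hφ (-2) w := fun v => Subtype.ext (h2 v)
  refine (𝔤.restr φ hφ (-2)).injective ?_
  rw [LinearEquiv.coe_coe, LinearEquiv.coe_coe, LinearEquiv.apply_symm_apply, ← e2, ← e1, ← e1]
  exact congrArg (fun f : 𝔤.piece (-2) →L[ℝ] 𝔤.piece (-2) => f _) s.2.mul_inv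

theorem TwoGrading.isStructureGroup_restrictionGroup [LieAlgebra.IsSemisimple ℝ L]
    {Φ : Set (L ≃ₗ⁅ℝ⁆ L)} (h1 : LieEquiv.refl ∈ Φ)
    (hmul : ∀ φ ∈ Φ, ∀ ψ ∈ Φ, ψ.trans φ ∈ Φ) (hinv : ∀ φ ∈ Φ, φ.symm ∈ Φ)
    (hexp : ∀ A : 𝔤.piece 0, ∃ φ ∈ Φ, ∀ i, ∀ x : 𝔤.piece i,
      φ x = (NormedSpace.exp (𝔤.adPiece i A) x : 𝔤.piece i)) :
    𝔤.IsStructureGroup (𝔤.restrictionGroup Φ h1 hmul hinv) where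
  isNormal := by
    rintro s ⟨φ, -, hφ, hs1, hs2⟩ l hl
    rw [TwoGrading.actS_eq_autAct hφ hs1 hs2]
    exact 𝔤.codiff₂_k_sub_autAct φ hφ hl
  isTransverse := by
    rintro s ⟨φ, -, hφ, hs1, hs2⟩ l hl
    rw [TwoGrading.actS_eq_autAct hφ hs1 hs2]
    exact 𝔤.isTransverse_autAct φ hφ hl
  exists_exp A := by
    obtain ⟨φ, hφ, h⟩ := hexp A
    have hg : ∀ i : ℤ, ∀ x ∈ 𝔤.piece i, φ x ∈ 𝔤.piece i := fun i x hx => by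
      rw [h i ⟨x, hx⟩]
      exact Subtype.property _
    obtain ⟨s, hs1, hs2⟩ := 𝔤.exists_restriction φ hg
    refine ⟨s, ⟨φ, hφ, hg, fun v => congrArg Subtype.val (hs1 v),
      fun w => congrArg Subtype.val (hs2 w)⟩, ContinuousLinearMap.ext fun v => ?_,
      ContinuousLinearMap.ext fun w => ?_⟩
    · exact (hs1 v).trans (Subtype.ext (h (-1) v))
    · exact (hs2 w).trans (Subtype.ext (h (-2) w))

theorem GradedFrame.orbit_restrictionGroup {T : Type*} [AddCommGroup T] [Module ℝ T]
    {Hx : Submodule ℝ T} (u : GradedFrame 𝔤 Hx)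
    {Φ : Set (L ≃ₗ⁅ℝ⁆ L)} (h1 : LieEquiv.refl ∈ Φ)
    (hmul : ∀ φ ∈ Φ, ∀ ψ ∈ Φ, ψ.trans φ ∈ Φ) (hinv : ∀ φ ∈ Φ, φ.symm ∈ Φ) :
    {u' | ∃ γ ∈ 𝔤.restrictionGroup Φ h1 hmul hinv, u' = u.comp γ} =
      {u' | ∃ φ ∈ Φ, ∃ hφ : ∀ i : ℤ, ∀ x ∈ 𝔤.piece i, φ x ∈ 𝔤.piece i,
        (∀ v, u'.fst v = u.fst (𝔤.restr φ hφ (-1) v)) ∧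
        ∀ w, u'.snd w = u.snd (𝔤.restr φ hφ (-2) w)} := by
  ext u'
  constructor
  · rintro ⟨s, ⟨φ, hφ, hφg, hs1, hs2⟩, rfl⟩
    exact ⟨φ, hφ, hφg, fun v => congrArg u.fst (Subtype.ext (hs1 v)),
      fun w => congrArg u.snd (Subtype.ext (hs2 w))⟩
  · rintro ⟨φ, hφ, hφg, h1, h2⟩
    obtain ⟨s, hs1, hs2⟩ := 𝔤.exists_restriction φ hφg
    refine ⟨s, ⟨φ, hφ, hφg, fun v => congrArg Subtype.val (hs1 v),
      fun w => congrArg Subtype.val (hs2 w)⟩, GradedFrame.ext' (fun v => ?_) fun w => ?_⟩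
    · rw [h1, GradedFrame.comp_fst, hs1]
    · rw [h2, GradedFrame.comp_snd, hs2]

/-- The inclusion of a graded piece intertwines the two actions of `ad A`, hence also their
exponentials; so `exp (ad A)` preserves the grading. -/
theorem TwoGrading.exp_adPiece {V : Type*} [NormedAddCommGroup V] [NormedSpace ℝ V]
    [CompleteSpace V] (ι : L ≃ₗ[ℝ] V) (A : 𝔤.piece 0) {a : V →L[ℝ] V}
    (ha : ∀ w, a (ι w) = ι ⁅(A : L), w⁆) (i : ℤ) (x : 𝔤.piece i) :
    NormedSpace.exp a (ι x) = ι (NormedSpace.exp (𝔤.adPiece i A) x : 𝔤.piece i) := by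
  have : CompleteSpace (𝔤.piece i) := FiniteDimensional.complete ℝ _
  exact (exp_intertwine (LinearMap.toContinuousLinearMap (ι.toLinearMap ∘ₗ (𝔤.piece i).subtype))
    (fun x => (ha x).symm) x).symm

end StructureGroup

/-! ### The image of `G₀` in `S`. -/

section LieGroup

variable {EG : Type*} [NormedAddCommGroup EG] [NormedSpace ℝ EG] [FiniteDimensional ℝ EG]
  {G : Type*} [Group G] [TopologicalSpace G] [ChartedSpace EG G] [LieGroup 𝓘(ℝ, EG) ∞ G]

theorem refl_mem_range_adEquiv :
    LieEquiv.refl ∈ range (adEquiv (EG := EG) (G := G)) :=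
  ⟨1, LieEquiv.ext fun v => congrArg (fun f : EG →L[ℝ] EG => f v) adCLM_one⟩

theorem trans_mem_range_adEquiv : ∀ φ ∈ range (adEquiv (EG := EG) (G := G)),
    ∀ ψ ∈ range (adEquiv (EG := EG) (G := G)),
    ψ.trans φ ∈ range (adEquiv (EG := EG) (G := G)) := by
  rintro _ ⟨g, rfl⟩ _ ⟨h, rfl⟩
  exact ⟨g * h, LieEquiv.ext fun v => congrArg (fun f : EG →L[ℝ] EG => f v) (adCLM_mul g h)⟩

theorem symm_mem_range_adEquiv : ∀ φ ∈ range (adEquiv (EG := EG) (G := G)),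
    φ.symm ∈ range (adEquiv (EG := EG) (G := G)) := by
  rintro _ ⟨g, rfl⟩
  exact ⟨g⁻¹, LieEquiv.ext fun v => rfl⟩

/-- The image of `G₀` in `S`. -/
noncomputable def adGroup (𝔤 : TwoGrading (GroupLieAlgebra 𝓘(ℝ, EG) G)) : Subgroup 𝔤.S :=
  𝔤.restrictionGroup (range adEquiv) refl_mem_range_adEquiv trans_mem_range_adEquiv
    symm_mem_range_adEquiv

variable {𝔤 : TwoGrading (GroupLieAlgebra 𝓘(ℝ, EG) G)}

theorem isG₀Orbit_iff {T : Type*} [AddCommGroup T] [Module ℝ T] {Hx : Submodule ℝ T}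
    (K : Set (GradedFrame 𝔤 Hx)) :
    IsG₀Orbit 𝔤 K ↔ ∃ u : GradedFrame 𝔤 Hx, K = {u' | ∃ γ ∈ adGroup 𝔤, u' = u.comp γ} := by
  refine exists_congr fun u => ?_
  have h : {u' | ∃ γ ∈ adGroup 𝔤, u' = u.comp γ} = _ := u.orbit_restrictionGroup
    refl_mem_range_adEquiv trans_mem_range_adEquiv symm_mem_range_adEquiv
  rw [h]
  refine Eq.congr_right (Set.ext fun u' => ⟨?_, ?_⟩)
  · rintro ⟨g, hg, h1, h2⟩
    exact ⟨adEquiv g, ⟨g, rfl⟩, hg, h1, h2⟩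
  · rintro ⟨_, ⟨g, rfl⟩, hg, h1, h2⟩
    exact ⟨g, hg, h1, h2⟩

variable [LieAlgebra.IsSemisimple ℝ (GroupLieAlgebra 𝓘(ℝ, EG) G)]

variable (𝔤) in
theorem isStructureGroup_adGroup : 𝔤.IsStructureGroup (adGroup 𝔤) := by
  refine TwoGrading.isStructureGroup_restrictionGroup _ _ _ fun A => ?_
  have : CompleteSpace EG := FiniteDimensional.complete ℝ EG
  let a : EG →L[ℝ] EG := LinearMap.toContinuousLinearMap
    (LieAlgebra.ad ℝ (GroupLieAlgebra 𝓘(ℝ, EG) G) A : EG →ₗ[ℝ] EG)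
  -- A group element with `Ad g = exp (ad A)`; it lies in `G₀` because `ad A` preserves each piece.
  obtain ⟨g, hg⟩ := exists_adCLM_eq_exp (A : GroupLieAlgebra 𝓘(ℝ, EG) G) (a := a) fun _ => rfl
  refine ⟨adEquiv g, ⟨g, rfl⟩, fun i x => ?_⟩
  refine (congrArg (fun f : EG →L[ℝ] EG => f (x : GroupLieAlgebra 𝓘(ℝ, EG) G)) hg).trans ?_
  exact TwoGrading.exp_adPiece (V := EG)
    (LinearEquiv.refl ℝ EG : GroupLieAlgebra 𝓘(ℝ, EG) G ≃ₗ[ℝ] EG) A (a := a) (fun _ => rfl) i x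

variable {E : Type*} [NormedAddCommGroup E] [NormedSpace ℝ E]
  {M : Type*} [TopologicalSpace M] [ChartedSpace E M] [IsManifold 𝓘(ℝ, E) ∞ M]

theorem isSuitableAt_iff {H : (x : M) → Submodule ℝ (TangentSpace 𝓘(ℝ, E) x)} {x : M}
    {K : Set (GradedFrame 𝔤 (H x))} :
    IsSuitableAt 𝔤 H x K ↔ IsSuitable (adGroup 𝔤) H x K := by
  rw [IsSuitableAt, IsPartialRegularisationAt, IsSuitable, isG₀Orbit_iff, and_assoc]
  exact and_congr_right fun _ => forall₂_and.symm

end LieGroup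

end PartialReg

/-! ### The proposition. -/

theorem mainTheorem5
    {EG : Type*} [NormedAddCommGroup EG] [NormedSpace ℝ EG] [FiniteDimensional ℝ EG]
    {G : Type*} [Group G] [TopologicalSpace G] [ChartedSpace EG G] [LieGroup 𝓘(ℝ, EG) ∞ G]
    [LieAlgebra.IsSemisimple ℝ (GroupLieAlgebra 𝓘(ℝ, EG) G)]
    (𝔤 : PartialReg.TwoGrading (GroupLieAlgebra 𝓘(ℝ, EG) G))
    {E : Type*} [NormedAddCommGroup E] [NormedSpace ℝ E] [FiniteDimensional ℝ E]
    {M : Type*} [TopologicalSpace M] [T2Space M] [ChartedSpace E M] [IsManifold 𝓘(ℝ, E) ∞ M]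
    (a b τ : ℝ) (hτ : τ ∈ Set.Ioo a b)
    (H : ℝ → (x : M) → Submodule ℝ (TangentSpace 𝓘(ℝ, E) x))
    (hrank : ∀ t ∈ Set.Ioo a b, ∀ x,
      Module.finrank ℝ (H t x) = Module.finrank ℝ (𝔤.piece (-1)) ∧
      Module.finrank ℝ (TangentSpace 𝓘(ℝ, E) x ⧸ H t x) = Module.finrank ℝ (𝔤.piece (-2)))
    (hH : PartialReg.IsContinuousFamily (Set.Ioo a b) (Module.finrank ℝ (𝔤.piece (-1))) H)
    (M' : Set M) (hM' : IsCompact M')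
    (hconst : ∀ x ∉ M', ∀ s ∈ Set.Ioo a b, ∀ t ∈ Set.Ioo a b, H s x = H t x)
    (hcoh : Subsingleton 𝔤.H1Zero)
    (K₀ : (x : M) → Set (PartialReg.GradedFrame 𝔤 (H τ x)))
    (hK₀smooth : PartialReg.IsSmoothField 𝔤 (H τ) K₀)
    (hK₀ : ∀ x, PartialReg.IsSuitableAt 𝔤 (H τ) x (K₀ x)) :
    ∃ c d : ℝ, τ ∈ Set.Ioo c d ∧ Set.Ioo c d ⊆ Set.Ioo a b ∧
      ∃ K : (t : ℝ) → (x : M) → Set (PartialReg.GradedFrame 𝔤 (H t x)),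
        (K τ = K₀ ∧
          PartialReg.IsContinuousField 𝔤 (Set.Ioo c d) H K ∧
          ∀ t ∈ Set.Ioo c d, PartialReg.IsSmoothField 𝔤 (H t) (K t) ∧
            ∀ x, PartialReg.IsSuitableAt 𝔤 (H t) x (K t x)) ∧
        ∀ K' : (t : ℝ) → (x : M) → Set (PartialReg.GradedFrame 𝔤 (H t x)),
          K' τ = K₀ →
          PartialReg.IsContinuousField 𝔤 (Set.Ioo c d) H K' →
          (∀ t ∈ Set.Ioo c d, ∀ x, PartialReg.IsSuitableAt 𝔤 (H t) x (K' t x)) →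
          ∀ t ∈ Set.Ioo c d, ∀ x, K' t x = K t x := by
  obtain ⟨c, d, hcd, hsub, K, hK, huniq⟩ := PartialReg.exists_unique_extension
    (PartialReg.isStructureGroup_adGroup 𝔤) hcoh hτ hrank hH hM' hconst
    (PartialReg.isSmoothField_iff.1 hK₀smooth) fun x => PartialReg.isSuitableAt_iff.1 (hK₀ x)
  refine ⟨c, d, hcd, hsub, K, ⟨funext fun x => (hK τ hcd x).eq_initial,
    PartialReg.isContinuousField_iff.2 fun t ht x => (hK t ht x).hasContinuousSection,
    fun t ht => ⟨PartialReg.isSmoothField_iff.2 fun x => (hK t ht x).hasSmoothSection,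
      fun x => PartialReg.isSuitableAt_iff.2 (hK t ht x).isSuitable⟩⟩, fun K' h0 hc hs => ?_⟩
  exact huniq K' h0 (PartialReg.isContinuousField_iff.1 hc) fun t ht x =>
    PartialReg.isSuitableAt_iff.1 (hs t ht x)
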